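/- Let $k=\mathbb{F}_q$ be a finite field, $t=\sqrt q>0$, and let $B$ be a finite-dimensional $k$-algebra of global dimension at most $2$. Let $\mathcal{A}=\mathrm{mod}\,B$ be the category of finitely generated right $B$-modules and $\mathcal{P}\subset\mathcal{A}$ the full subcategory of projective objects. For objects $A,C$ of $\mathcal{A}$ put $\langle A,C\rangle=\sum_{i\ge 0}(-1)^i\dim_k\mathrm{Ext}^i_{\mathcal{A}}(A,C)$; this depends only on the classes $\hat A,\hat C$ in the Grothendieck group and is extended bilinearly. In any abelian category, write $\mathrm{Ext}^1(A,C)_D\subset\mathrm{Ext}^1(A,C)$ for the set of classes of extensions $0\to C\to D\to A\to 0$ with middle term isomorphic to $D$. The twisted Ringel–Hall algebra $\mathcal{H}_{tw}(\mathcal{A})$ is the complex vector space with basis the isomorphism classes $[A]$ of objects of $\mathcal{A}$, with unit $[0]$ and multiplication $$[A]*[C]=t^{\langle A,C\rangle}\sum_{[D]}\frac{|\mathrm{Ext}^1_{\mathcal{A}}(A,C)_D|}{|\mathrm{Hom}_{\mathcal{A}}(A,C)|}\,[D].$$ Let $\mathcal{C}_2(\mathcal{A})$ be the abelian category of $\mathbb{Z}/2$-graded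 complexes $M=(d_1:M_1\to M_0,\ d_0:M_0\to M_1)$, $d_0d_1=0=d_1d_0$, and let $\mathcal{H}_{tw}(\mathcal{C}_2(\mathcal{P}))$ be the complex vector space with basis the isomorphism classes $[M]$ of complexes with $M_0,M_1\in\mathcal{P}$, with unit $[0]$ and multiplication $$[M]*[N]=t^{\langle M_0,N_0\rangle+\langle M_1,N_1\rangle}\sum_{[L]}\frac{|\mathrm{Ext}^1_{\mathcal{C}_2(\mathcal{A})}(M,N)_L|}{|\mathrm{Hom}_{\mathcal{C}_2(\mathcal{A})}(M,N)|}\,[L].$$ Bridgeland's localized Ringel–Hall algebra $\mathcal{DH}(\mathcal{A})$ is the localization of $\mathcal{H}_{tw}(\mathcal{C}_2(\mathcal{P}))$ obtained by inverting all $[M]$ with $M$ acyclic. For $P\in\mathcal{P}$ let $K_P$ be the acyclic complex with $M_1=M_0=P$, $d_1=1$, $d_0=0$, and $K_P^*$ the one with $d_1=0$, $d_0=1$; for $\alpha=\hat P-\hat Q$ with $P,Q\in\mathcal{P}$ put $K_\alpha=[K_P]*[K_Q]^{-1}$ and $K_\alpha^*=[K_P^*]*[K_Q^*]^{-1}$ in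 $\mathcal{DH}(\mathcal{A})$. Every $A\in\mathcal{A}$ has a minimal projective resolution $0\to P_2\xrightarrow{a_2}P_1\xrightarrow{a_1}P_0\xrightarrow{a_0}A\to 0$. Let $C_A$ be the complex $M_1=P_1$, $M_0=P_0\oplus P_2$, $d_1=\binom{a_1}{0}$, $d_0=(0\ \ a_2)$, and put $$E_A=t^{\langle \hat P_1-2\hat P_2,\hat A\rangle}\,K_{-\hat P_1}*K_{\hat P_2}*K^*_{-\hat P_2}*[C_A]\in\mathcal{DH}(\mathcal{A}).$$ Then there is an injective homomorphism of unital algebras $$I_+:\mathcal{H}_{tw}(\mathcal{A})\hookrightarrow\mathcal{DH}(\mathcal{A}),\qquad [A]\mapsto E_A,$$ where $E_A$ may be computed from any minimal projective resolution of $A$. -/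

import Mathlib

open CategoryTheory CategoryTheory.Limits CategoryTheory.Abelian
open scoped ZeroObject

universe w v u

namespace BridgelandHall

noncomputable section

attribute [local instance] CategoryTheory.HasExt.standard

/-! ### The Euler form and the Hall numbers of an abelian category -/

section AbelianCategory

variable {𝒞 : Type u} [Category.{v} 𝒞] [Abelian 𝒞]

/-- The Euler form `⟨X, Y⟩ = ∑ i, (-1) ^ i * dim_k Ext^i(X, Y)` of a `k`-linear abelian category
(a finite sum if the category has finite global dimension). -/
def euler (k : Type w) [Field k] [Linear k 𝒞] (X Y : 𝒞) : ℤ :=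
  ∑ᶠ i : ℕ, (-1) ^ i * (Module.finrank k (Ext X Y i) : ℤ)

/-- `Ext¹(A, C)_B`: the set of those classes in `Ext¹(A, C)` that are represented by a short exact
sequence `0 ⟶ C ⟶ B ⟶ A ⟶ 0` with middle term `B`. -/
def extWithMiddle (A C B : 𝒞) : Set (Ext A C 1) :=
  {ξ | ∃ (f : C ⟶ B) (g : B ⟶ A) (h : f ≫ g = 0) (hS : (ShortComplex.mk f g h).ShortExact),
    hS.extClass = ξ}

/-- The structure constant `|Ext¹(A, C)_B| / |Hom(A, C)|` of the Ringel-Hall algebra. -/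
def hallNumber (A C B : 𝒞) : ℂ :=
  (Nat.card (extWithMiddle A C B) : ℂ) / (Nat.card (A ⟶ C) : ℂ)

/-! ### Twisted Ringel-Hall algebras -/

/-- The set of isomorphism classes of objects with the property `P`. -/
abbrev IsoClass (P : ObjectProperty 𝒞) : Type u :=
  Quotient (isIsomorphicSetoid P.FullSubcategory)

/-- A chosen object in an isomorphism class. -/
def IsoClass.rep {P : ObjectProperty 𝒞} (a : IsoClass P) : 𝒞 :=
  (Quotient.out a).obj

/-- The underlying vector space of the Ringel-Hall algebra spanned by the objects with the
property `P`, with multiplication twisted by the powers `t ^ χ(A, C)`: the complex vector space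
with basis the isomorphism classes `[A]` of objects with the property `P`. -/
@[nolint unusedArguments]
def TwHall (P : ObjectProperty 𝒞) (_t : ℂ) (_χ : 𝒞 → 𝒞 → ℤ) : Type u :=
  IsoClass P →₀ ℂ

namespace TwHall

variable (P : ObjectProperty 𝒞) (t : ℂ) (χ : 𝒞 → 𝒞 → ℤ)

instance : AddCommGroup (TwHall P t χ) := inferInstanceAs (AddCommGroup (IsoClass P →₀ ℂ))

instance : Module ℂ (TwHall P t χ) := inferInstanceAs (Module ℂ (IsoClass P →₀ ℂ))

/-- The basis consisting of the isomorphism classes of objects with the property `P`. -/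
def basis : Module.Basis (IsoClass P) ℂ (TwHall P t χ) :=
  Module.Basis.ofRepr (LinearEquiv.refl ℂ (IsoClass P →₀ ℂ))

/-- The basis vector `[A]` of an object `A` with the property `P`. -/
def cls (A : 𝒞) (hA : P A) : TwHall P t χ :=
  basis P t χ (Quotient.mk (isIsomorphicSetoid P.FullSubcategory) ⟨A, hA⟩)

/-- The product of two basis vectors:
`[A] * [C] = t ^ χ(A, C) • ∑_[B] (|Ext¹(A, C)_B| / |Hom(A, C)|) • [B]`.
The sum is finite whenever `Ext¹(A, C)` is finite; and if the objects with the property `P` are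
closed under extensions then it runs over all `[B]` with `Ext¹(A, C)_B` nonempty. -/
def basisMul (a c : IsoClass P) : TwHall P t χ :=
  t ^ χ a.rep c.rep • ∑ᶠ b : IsoClass P, hallNumber a.rep c.rep b.rep • basis P t χ b

/-- The multiplication, as the bilinear extension of the product of basis vectors. -/
def mulHom : TwHall P t χ →ₗ[ℂ] TwHall P t χ →ₗ[ℂ] TwHall P t χ :=
  (basis P t χ).constr ℂ (fun a => (basis P t χ).constr ℂ (fun c => basisMul P t χ a c))

instance : NonUnitalNonAssocRing (TwHall P t χ) where
  mul x y := mulHom P t χ x y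
  left_distrib x y z := map_add (mulHom P t χ x) y z
  right_distrib x y z := by
    change mulHom P t χ (x + y) z = mulHom P t χ x z + mulHom P t χ y z
    rw [map_add, LinearMap.add_apply]
  zero_mul x := by
    change mulHom P t χ 0 x = 0
    rw [map_zero, LinearMap.zero_apply]
  mul_zero x := map_zero (mulHom P t χ x)

/-- The unit is the class `[0]` of the zero object. -/
instance [P.ContainsZero] : One (TwHall P t χ) :=
  ⟨basis P t χ (Quotient.mk (isIsomorphicSetoid P.FullSubcategory) 0)⟩

lemma basis_mul_basis (a c : IsoClass P) :
    basis P t χ a * basis P t χ c = basisMul P t χ a c := by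
  change mulHom P t χ (basis P t χ a) (basis P t χ c) = _
  rw [mulHom, Module.Basis.constr_basis, Module.Basis.constr_basis]

end TwHall

end AbelianCategory

/-! ### Localization of an algebra at a set of elements -/

section Localization

variable (H : Type u) [NonUnitalNonAssocRing H] [Module ℂ H] [One H] (S : Set H)

/-- The relations defining the localization: the generators `inl x` depend linearly and
multiplicatively on `x : H`, the generator `inl 1` is the unit, and for `s ∈ S` the generator
`inr s` is a two-sided inverse of `inl s`. -/
inductive LocRel : FreeAlgebra ℂ (H ⊕ S) → FreeAlgebra ℂ (H ⊕ S) → Prop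
  | add (x y : H) : LocRel (FreeAlgebra.ι ℂ (Sum.inl (x + y)))
      (FreeAlgebra.ι ℂ (Sum.inl x) + FreeAlgebra.ι ℂ (Sum.inl y))
  | smul (c : ℂ) (x : H) : LocRel (FreeAlgebra.ι ℂ (Sum.inl (c • x)))
      (c • FreeAlgebra.ι ℂ (Sum.inl x))
  | mul (x y : H) : LocRel (FreeAlgebra.ι ℂ (Sum.inl (x * y)))
      (FreeAlgebra.ι ℂ (Sum.inl x) * FreeAlgebra.ι ℂ (Sum.inl y))
  | one : LocRel (FreeAlgebra.ι ℂ (Sum.inl (1 : H))) 1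
  | mul_inv (s : S) :
      LocRel (FreeAlgebra.ι ℂ (Sum.inl (s : H)) * FreeAlgebra.ι ℂ (Sum.inr s)) 1
  | inv_mul (s : S) :
      LocRel (FreeAlgebra.ι ℂ (Sum.inr s) * FreeAlgebra.ι ℂ (Sum.inl (s : H))) 1

/-- The localization `H[s⁻¹ | s ∈ S]` of a (not necessarily commutative) complex algebra `H`: the
universal unital associative complex algebra with a homomorphism from `H` that makes all the
elements of `S` invertible. -/
abbrev Loc : Type u := RingQuot (LocRel H S)

variable {H}

/-- The canonical map from `H` to its localization. -/
def Loc.of (x : H) : Loc H S :=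
  RingQuot.mkAlgHom ℂ (LocRel H S) (FreeAlgebra.ι ℂ (Sum.inl x))

/-- The inverse of an element of `S` in the localization. -/
def Loc.inv (s : S) : Loc H S :=
  RingQuot.mkAlgHom ℂ (LocRel H S) (FreeAlgebra.ι ℂ (Sum.inr s))

end Localization

/-! ### `ℤ/2`-graded complexes -/

section Complexes

variable (𝒜 : Type u) [Category.{v} 𝒜] [Abelian 𝒜]

/-- The abelian category `C₂(𝒜)` of `ℤ/2`-graded complexes `M₁ ⇄ M₀` in `𝒜`. -/
abbrev C2 : Type (max u v) := HomologicalComplex 𝒜 (ComplexShape.up (ZMod 2))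

variable {𝒜}

lemma rel_iff (i j : ZMod 2) : (ComplexShape.up (ZMod 2)).Rel i j ↔ i + 1 = j := Iff.rfl

/-- The `ℤ/2`-graded complex with the differentials `d₁ : M₁ ⟶ M₀` and `d₀ : M₀ ⟶ M₁`. -/
def C2.mk {M₁ M₀ : 𝒜} (d₁ : M₁ ⟶ M₀) (d₀ : M₀ ⟶ M₁) (h₁ : d₁ ≫ d₀ = 0) (h₀ : d₀ ≫ d₁ = 0) :
    C2 𝒜 where
  X := fun i : Fin 2 => match i with
    | 0 => M₀
    | 1 => M₁
  d := fun i j : Fin 2 => match i, j with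
    | 0, 0 => 0
    | 0, 1 => d₀
    | 1, 0 => d₁
    | 1, 1 => 0
  shape := fun i j : Fin 2 => match i, j with
    | 0, 0 => fun _ => rfl
    | 0, 1 => fun h => absurd ((rel_iff 0 1).2 (by decide)) h
    | 1, 0 => fun h => absurd ((rel_iff 1 0).2 (by decide)) h
    | 1, 1 => fun _ => rfl
  d_comp_d' := fun i j l : Fin 2 => match i, j, l with
    | 0, 0, _ => fun h _ => absurd ((rel_iff 0 0).1 h) (by decide)
    | 0, 1, 0 => fun _ _ => h₀
    | 0, 1, 1 => fun _ h => absurd ((rel_iff 1 1).1 h) (by decide)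
    | 1, 0, 0 => fun _ h => absurd ((rel_iff 0 0).1 h) (by decide)
    | 1, 0, 1 => fun _ _ => h₁
    | 1, 1, _ => fun h _ => absurd ((rel_iff 1 1).1 h) (by decide)

variable (𝒜) in
/-- The property of being a complex of projectives, which cuts out `C₂(𝒫)` inside `C₂(𝒜)`. -/
def isProj : ObjectProperty (C2 𝒜) := fun M => ∀ i, Projective (M.X i)

instance : (isProj 𝒜).ContainsZero where
  exists_zero := ⟨0, isZero_zero _, fun i =>
    ((HomologicalComplex.eval 𝒜 (ComplexShape.up (ZMod 2)) i).map_isZero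
      (isZero_zero _)).projective⟩

lemma isProj_mk {M₁ M₀ : 𝒜} (d₁ : M₁ ⟶ M₀) (d₀ : M₀ ⟶ M₁) (h₁ : d₁ ≫ d₀ = 0)
    (h₀ : d₀ ≫ d₁ = 0) (p₁ : Projective M₁) (p₀ : Projective M₀) :
    isProj 𝒜 (C2.mk d₁ d₀ h₁ h₀) :=
  fun i : Fin 2 => match i with
    | 0 => p₀
    | 1 => p₁

/-- The complex `K_P = (P ⇄ P)` with `d₁ = 1` and `d₀ = 0`. -/
def complexK (P : 𝒜) : C2 𝒜 := C2.mk (𝟙 P) (0 : P ⟶ P) comp_zero zero_comp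

/-- The complex `K_P^* = (P ⇄ P)` with `d₁ = 0` and `d₀ = 1`. -/
def complexKStar (P : 𝒜) : C2 𝒜 := C2.mk (0 : P ⟶ P) (𝟙 P) zero_comp comp_zero

lemma exactAt_mk_zero {M₁ M₀ : 𝒜} (d₁ : M₁ ⟶ M₀) (d₀ : M₀ ⟶ M₁) (h₁ : d₁ ≫ d₀ = 0)
    (h₀ : d₀ ≫ d₁ = 0) (h : (ShortComplex.mk d₁ d₀ h₁).Exact) :
    (C2.mk d₁ d₀ h₁ h₀).ExactAt (0 : ZMod 2) := by
  rw [HomologicalComplex.exactAt_iff' _ 1 0 1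
    (ComplexShape.prev_eq' _ ((rel_iff 1 0).2 (by decide)))
    (ComplexShape.next_eq' _ ((rel_iff 0 1).2 (by decide)))]
  exact h

lemma exactAt_mk_one {M₁ M₀ : 𝒜} (d₁ : M₁ ⟶ M₀) (d₀ : M₀ ⟶ M₁) (h₁ : d₁ ≫ d₀ = 0)
    (h₀ : d₀ ≫ d₁ = 0) (h : (ShortComplex.mk d₀ d₁ h₀).Exact) :
    (C2.mk d₁ d₀ h₁ h₀).ExactAt (1 : ZMod 2) := by
  rw [HomologicalComplex.exactAt_iff' _ 0 1 0
    (ComplexShape.prev_eq' _ ((rel_iff 0 1).2 (by decide)))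
    (ComplexShape.next_eq' _ ((rel_iff 1 0).2 (by decide)))]
  exact h

lemma acyclic_complexK (P : 𝒜) : (complexK P).Acyclic := fun i : Fin 2 => match i with
  | 0 => exactAt_mk_zero _ _ _ _ (((ShortComplex.mk (𝟙 P) (0 : P ⟶ P) comp_zero).exact_iff_epi
      rfl).2 (inferInstanceAs (Epi (𝟙 P))))
  | 1 => exactAt_mk_one _ _ _ _ (((ShortComplex.mk (0 : P ⟶ P) (𝟙 P) zero_comp).exact_iff_mono
      rfl).2 (inferInstanceAs (Mono (𝟙 P))))

lemma acyclic_complexKStar (P : 𝒜) : (complexKStar P).Acyclic := fun i : Fin 2 => match i with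
  | 0 => exactAt_mk_zero _ _ _ _ (((ShortComplex.mk (0 : P ⟶ P) (𝟙 P) zero_comp).exact_iff_mono
      rfl).2 (inferInstanceAs (Mono (𝟙 P))))
  | 1 => exactAt_mk_one _ _ _ _ (((ShortComplex.mk (𝟙 P) (0 : P ⟶ P) comp_zero).exact_iff_epi
      rfl).2 (inferInstanceAs (Epi (𝟙 P))))

end Complexes

/-! ### The twisted Ringel-Hall algebra and Bridgeland's localized Ringel-Hall algebra -/

section Bridgeland

variable (k : Type w) [Field k] (𝒜 : Type u) [Category.{v} 𝒜] [Abelian 𝒜] [Linear k 𝒜]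

/-- The positive square root `t = √q` of the number `q` of elements of `k`. -/
def sqrtCard : ℂ := ((√(Nat.card k : ℝ) : ℝ) : ℂ)

/-- The twisted Ringel-Hall algebra `H_tw(𝒜)`, with
`[A] * [C] = t ^ ⟨A, C⟩ • ∑_[B] (|Ext¹(A, C)_B| / |Hom(A, C)|) • [B]`. -/
abbrev HallTw : Type u := TwHall (⊤ : ObjectProperty 𝒜) (sqrtCard k) (euler k)

variable {𝒜} in
/-- The exponent `⟨M₀, N₀⟩ + ⟨M₁, N₁⟩` of the twist on complexes. -/
def eulerC2 (M N : C2 𝒜) : ℤ :=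
  euler k (M.X 0) (N.X 0) + euler k (M.X 1) (N.X 1)

/-- The twisted Ringel-Hall algebra `H_tw(C₂(𝒫))` of `ℤ/2`-graded complexes of projectives, where
extensions and morphisms are those of the abelian category `C₂(𝒜)`. -/
abbrev HallTwC2 : Type (max u v) := TwHall (isProj 𝒜) (sqrtCard k) (eulerC2 k)

/-- The set of the elements `[M]` of `H_tw(C₂(𝒫))` with `M` acyclic. -/
def acyclicSet : Set (HallTwC2 k 𝒜) :=
  {x | ∃ (M : C2 𝒜) (hM : isProj 𝒜 M), M.Acyclic ∧ x = TwHall.cls _ _ _ M hM}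

/-- Bridgeland's localized Ringel-Hall algebra
`DH(𝒜) = H_tw(C₂(𝒫))[[M]⁻¹ | H_*(M) = 0]`. -/
abbrev DH : Type (max u v) := Loc (HallTwC2 k 𝒜) (acyclicSet k 𝒜)

variable {𝒜}

/-- The element `[M]` of `DH(𝒜)`. -/
def DH.cls (M : C2 𝒜) (hM : isProj 𝒜 M) : DH k 𝒜 :=
  Loc.of (acyclicSet k 𝒜) (TwHall.cls _ _ _ M hM)

/-- The inverse `[M]⁻¹` in `DH(𝒜)` of the class of an acyclic complex `M`. -/
def DH.clsInv (M : C2 𝒜) (hM : isProj 𝒜 M) (hM' : M.Acyclic) : DH k 𝒜 :=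
  Loc.inv (acyclicSet k 𝒜) ⟨TwHall.cls _ _ _ M hM, M, hM, hM', rfl⟩

/-- The element `K_α = [K_P] * [K_Q]⁻¹` of `DH(𝒜)`, for `α = P̂ - Q̂` in `K(𝒜)`. -/
def DH.K (P Q : 𝒜) [hP : Projective P] [hQ : Projective Q] : DH k 𝒜 :=
  DH.cls k (complexK P) (isProj_mk _ _ _ _ hP hP) *
    DH.clsInv k (complexK Q) (isProj_mk _ _ _ _ hQ hQ) (acyclic_complexK Q)

/-- The element `K_α^* = [K_P^*] * [K_Q^*]⁻¹` of `DH(𝒜)`, for `α = P̂ - Q̂` in `K(𝒜)`. -/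
def DH.KStar (P Q : 𝒜) [hP : Projective P] [hQ : Projective Q] : DH k 𝒜 :=
  DH.cls k (complexKStar P) (isProj_mk _ _ _ _ hP hP) *
    DH.clsInv k (complexKStar Q) (isProj_mk _ _ _ _ hQ hQ) (acyclic_complexKStar Q)

/-! ### Minimal projective resolutions and the elements `E_A` -/

/-- `f : P ⟶ X` is a projective cover: `P` is projective and `f` is an essential epimorphism. -/
structure IsProjectiveCover {P X : 𝒜} (f : P ⟶ X) : Prop where
  projective : Projective P
  epi : Epi f
  essential : ∀ ⦃W : 𝒜⦄ (g : W ⟶ P), Epi (g ≫ f) → Epi g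

/-- A minimal projective resolution `0 ⟶ P₂ ⟶ P₁ ⟶ P₀ ⟶ A ⟶ 0`: the map `a₂` is a monomorphism, and
`P₀ ⟶ A`, `P₁ ⟶ ker a₀` and `P₂ ⟶ ker a₁` are projective covers (that the last two are epimorphisms
is the exactness at `P₀` and at `P₁`). -/
structure MinimalResolution (A : 𝒜) where
  {P₂ P₁ P₀ : 𝒜}
  a₂ : P₂ ⟶ P₁
  a₁ : P₁ ⟶ P₀
  a₀ : P₀ ⟶ A
  a₂_a₁ : a₂ ≫ a₁ = 0
  a₁_a₀ : a₁ ≫ a₀ = 0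
  mono : Mono a₂
  cover₀ : IsProjectiveCover a₀
  cover₁ : IsProjectiveCover (kernel.lift a₀ a₁ a₁_a₀)
  cover₂ : IsProjectiveCover (kernel.lift a₁ a₂ a₂_a₁)

namespace MinimalResolution

variable {A : 𝒜} (R : MinimalResolution A)

instance : Projective R.P₀ := R.cover₀.projective
instance : Projective R.P₁ := R.cover₁.projective
instance : Projective R.P₂ := R.cover₂.projective

/-- The complex `C_A = (P₁ ⇄ P₀ ⊕ P₂)` with `d₁ = (a₁, 0)` and `d₀ = (0, a₂)`. -/
def complexC : C2 𝒜 :=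
  C2.mk (biprod.lift R.a₁ (0 : R.P₁ ⟶ R.P₂)) (biprod.desc (0 : R.P₀ ⟶ R.P₁) R.a₂)
    (by simp) (by ext <;> simp [R.a₂_a₁])

lemma isProj_complexC : isProj 𝒜 R.complexC :=
  isProj_mk _ _ _ _ inferInstance inferInstance

/-- The element `E_A = t ^ ⟨P̂₁ - 2 P̂₂, Â⟩ • K_{-P̂₁} * K_{P̂₂} * K_{-P̂₂}^* * [C_A]`
of `DH(𝒜)`. -/
def E : DH k 𝒜 :=
  sqrtCard k ^ (euler k R.P₁ A - 2 * euler k R.P₂ A) •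
    (DH.K k 0 R.P₁ * DH.K k R.P₂ 0 * DH.KStar k 0 R.P₂ * DH.cls k R.complexC R.isProj_complexC)

end MinimalResolution

end Bridgeland

/-! ### Finitely generated right modules -/

section RightModules

/-- The category `mod B` of finitely generated right `B`-modules. -/
@[nolint unusedArguments]
def RMod (k : Type w) [Field k] (B : Type u) [Ring B] [Algebra k B] : Type (u + 1) :=
  FGModuleCat.{u} Bᵐᵒᵖ

variable (k : Type w) [Field k] (B : Type u) [Ring B] [Algebra k B]

instance : Category.{u} (RMod k B) := inferInstanceAs (Category.{u} (FGModuleCat.{u} Bᵐᵒᵖ))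

lemma isNoetherianRing_op [Module.Finite k B] : IsNoetherianRing Bᵐᵒᵖ :=
  haveI : Module.Finite k Bᵐᵒᵖ := Module.Finite.equiv (MulOpposite.opLinearEquiv k)
  IsNoetherianRing.of_finite k Bᵐᵒᵖ

instance [Module.Finite k B] : Abelian (RMod k B) :=
  haveI := isNoetherianRing_op k B
  inferInstanceAs (Abelian (FGModuleCat.{u} Bᵐᵒᵖ))

instance [Module.Finite k B] : Linear k (RMod k B) :=
  inferInstanceAs (Linear k (FGModuleCat.{u} Bᵐᵒᵖ))

end RightModules

end

end BridgelandHall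

/-! Both Hall products can be rewritten as sums over vector spaces of maps, and multiplicativity is
a comparison of the two sums. An extension of complexes `M` by `N` with `M` degreewise projective
splits in each degree, so it is `N ⊕ M` with its differential twisted by an odd cocycle of the
complex of homomorphisms. Every extension class comes from equally many cocycles, so `[M] * [N]` is
a power of `t` times the sum of `[cone h]` over all cocycles `h` (`hcls_mul_hcls`). In `𝒜`, a
presentation `0 ⟶ Ω ⟶ P₀ ⟶ A ⟶ 0` makes each extension of `A` by `C` a pushout along some `ζ : Ω ⟶
C`, and `[A] * [C]` is a power of `t` times the sum of the classes of these pushouts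
(`acls_mul_acls`).

The element `E_A` is generalized to `resCls`, defined for any projective resolution of length two.
Its normalization is such that adding a summand `K_Q` or `K_Q^*` to the folded complex has no
effect. Schanuel's lemma then shows that it depends only on `A` (`resCls_congr`).

A cocycle between the folded resolutions of `A` and `C` amounts to a map `ζ` together with elements
of three spaces of maps that do not depend on `ζ` (`cocycleParam_bijective`), and its cone is the
folded horseshoe resolution of the pushout along `ζ` (`coneResCocycle`). Hence the two products sum
the same elements with constant multiplicity, and the powers of `t` agree by additivity of `dim
Hom(P, -)` for projective `P` (`resCls_mul_resCls`).

Injectivity needs control of the localization, which could a priori collapse. In global dimension at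
most two an acyclic complex of projectives is a sum `K_P ⊕ K_Q^*` (`exists_iso_of_acyclic`). The
Hall algebra of complexes is associative; divide it by the left ideal generated by all `K_P - 1` and
`K_P^* - 1`. Since `K_P` and `K_P^*` pass `[M]` at the cost of opposite powers of `t`, left
multiplications by them on the quotient are mutually inverse, so the localization acts there
(`quotientRep`). Applied to the class of `1`, `E_A` gives a nonzero multiple of `[C_A]`. Even
homology, weighted by a suitable power of `t`, descends to the quotient and returns a nonzero
multiple of `[A]`.

Minimal resolutions exist because sets of morphisms are finite: some power of an endomorphism is
idempotent, and a projective with fewest endomorphisms among those mapping onto an object covers it.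
-/

namespace BridgelandHall

noncomputable section

attribute [local instance] CategoryTheory.HasExt.standard

/-! ### Extension classes and middle terms -/

section MiddleTerms

variable {𝒞 : Type u} [Category.{v} 𝒞] [Abelian 𝒞]

/-- Two extensions with the same class are isomorphic as extensions. -/
theorem exists_iso_of_extClass_eq {A C B B' : 𝒞} {f : C ⟶ B} {g : B ⟶ A} {h : f ≫ g = 0}
    (hS : (ShortComplex.mk f g h).ShortExact) {f' : C ⟶ B'} {g' : B' ⟶ A} {h' : f' ≫ g' = 0}
    (hS' : (ShortComplex.mk f' g' h').ShortExact) (e : hS.extClass = hS'.extClass) :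
    ∃ φ : B ≅ B', f ≫ φ.hom = f' ∧ φ.hom ≫ g' = g := by
  -- The common class pulls back to zero along `g`, so `g` lifts through `g'`.
  obtain ⟨u, hu⟩ : ∃ u : B ⟶ B', u ≫ g' = g := by
    obtain ⟨x, hx⟩ := Ext.covariant_sequence_exact₃ (X := B) hS' (Ext.mk₀ g) (zero_add 1)
      (by rw [← e]; exact hS.comp_extClass)
    obtain ⟨u, rfl⟩ := (Ext.mk₀_bijective _ _).2 x
    exact ⟨u, (Ext.mk₀_bijective _ _).1 (by simpa using hx)⟩
  haveI := hS'.mono_f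
  haveI := hS.mono_f
  haveI := hS.epi_g
  let v : C ⟶ C := hS'.exact.lift (f ≫ u) (by simp [hu, h])
  have hv : v ≫ f' = f ≫ u := hS'.exact.lift_f _ _
  have nat : hS.extClass.comp (Ext.mk₀ v) (add_zero 1) =
      (Ext.mk₀ (𝟙 A)).comp hS'.extClass (zero_add 1) :=
    ShortComplex.ShortExact.extClass_naturality hS hS'
      (ShortComplex.Hom.mk v u (𝟙 A) hv (by simp [hu]))
  -- The lift `u` induces `v` on `C`, not necessarily the identity. As `v - 𝟙 C` annihilates the
  -- class, it extends along `f` to some `w : B ⟶ C`, and subtracting `w ≫ f'` corrects `u`.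
  have hv' : hS.extClass.comp (Ext.mk₀ (v - 𝟙 C)) (add_zero 1) = 0 := by
    rw [sub_eq_add_neg, Ext.mk₀_add, Ext.comp_add, Ext.mk₀_neg, Ext.comp_neg]
    rw [nat]
    simp [e]
  obtain ⟨y, hy⟩ := Ext.contravariant_sequence_exact₁ hS _ (Ext.mk₀ (v - 𝟙 C)) (add_zero 1) hv'
  obtain ⟨w, rfl⟩ := (Ext.mk₀_bijective _ _).2 y
  have hw : f ≫ w = v - 𝟙 C := (Ext.mk₀_bijective _ _).1 (by simpa using hy)
  let u' : B ⟶ B' := u - w ≫ f'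
  have c₁ : f ≫ u' = f' := by
    simp only [u', Preadditive.comp_sub, ← Category.assoc, hw, Preadditive.sub_comp, hv]
    simp
  have c₂ : u' ≫ g' = g := by
    simp [u', Preadditive.sub_comp, hu, h']
  let φ : ShortComplex.mk f g h ⟶ ShortComplex.mk f' g' h' :=
    ShortComplex.Hom.mk (𝟙 C) u' (𝟙 A) (by simp [c₁]) (by simp [c₂])
  haveI : IsIso φ.τ₁ := inferInstanceAs (IsIso (𝟙 C))
  haveI : IsIso φ.τ₃ := inferInstanceAs (IsIso (𝟙 A))
  haveI : IsIso φ.τ₂ := ShortComplex.isIso₂_of_shortExact_of_isIso₁₃' φ hS hS' ‹_› ‹_›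
  exact ⟨asIso φ.τ₂, c₁, c₂⟩

theorem extClass_comp_mk₀_eq {A A' C C' B B' : 𝒞} {f : C ⟶ B} {g : B ⟶ A} {h : f ≫ g = 0}
    (hS : (ShortComplex.mk f g h).ShortExact) {f' : C' ⟶ B'} {g' : B' ⟶ A'} {h' : f' ≫ g' = 0}
    (hS' : (ShortComplex.mk f' g' h').ShortExact) (γ : C ⟶ C') (β : B ⟶ B') (α : A ⟶ A')
    (h₁ : f ≫ β = γ ≫ f') (h₂ : β ≫ g' = g ≫ α) :
    hS.extClass.comp (Ext.mk₀ γ) (add_zero 1) =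
      (Ext.mk₀ α).comp hS'.extClass (zero_add 1) :=
  ShortComplex.ShortExact.extClass_naturality hS hS' (ShortComplex.Hom.mk γ β α h₁.symm h₂)

/-- Naturality with identities at both ends: a mere morphism of middle terms suffices to identify
two classes. -/
theorem extClass_eq_of_hom {A C B B' : 𝒞} {f : C ⟶ B} {g : B ⟶ A} {h : f ≫ g = 0}
    (hS : (ShortComplex.mk f g h).ShortExact) {f' : C ⟶ B'} {g' : B' ⟶ A} {h' : f' ≫ g' = 0}
    (hS' : (ShortComplex.mk f' g' h').ShortExact) (φ : B ⟶ B') (h₁ : f ≫ φ = f')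
    (h₂ : φ ≫ g' = g) : hS.extClass = hS'.extClass := by
  have := extClass_comp_mk₀_eq hS hS' (𝟙 C) φ (𝟙 A) (by simp [h₁]) (by simp [h₂])
  rwa [Ext.comp_mk₀_id, Ext.mk₀_id_comp] at this

theorem extWithMiddle_mono {A C B B' : 𝒞} (β : B ≅ B') :
    extWithMiddle A C B ⊆ extWithMiddle A C B' := by
  rintro _ ⟨f, g, h, hS, rfl⟩
  have h' : (f ≫ β.hom) ≫ (β.inv ≫ g) = 0 := by simp [h]
  let φ : ShortComplex.mk f g h ≅ ShortComplex.mk (f ≫ β.hom) (β.inv ≫ g) h' :=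
    ShortComplex.isoMk (Iso.refl _) β (Iso.refl _) (by simp) (by simp)
  have hS' := ShortComplex.shortExact_of_iso φ hS
  exact ⟨_, _, h', hS', (extClass_eq_of_hom hS hS' β.hom rfl (by simp)).symm⟩

theorem nonempty_iso_of_mem_extWithMiddle {A C B B' : 𝒞} {ξ : Ext A C 1}
    (h : ξ ∈ extWithMiddle A C B) (h' : ξ ∈ extWithMiddle A C B') : Nonempty (B ≅ B') := by
  obtain ⟨f, g, h, hS, e⟩ := h
  obtain ⟨f', g', h', hS', e'⟩ := h'
  exact ⟨(exists_iso_of_extClass_eq hS hS' (e.trans e'.symm)).choose⟩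

/-- Transport of extension classes along isomorphisms of the outer terms. -/
def extCongr {A A' C C' : 𝒞} (α : A ≅ A') (γ : C ≅ C') : Ext A C 1 ≃ Ext A' C' 1 where
  toFun x := (Ext.mk₀ α.inv).comp (x.comp (Ext.mk₀ γ.hom) (add_zero 1)) (zero_add 1)
  invFun x := (Ext.mk₀ α.hom).comp (x.comp (Ext.mk₀ γ.inv) (add_zero 1)) (zero_add 1)
  left_inv x := by simp
  right_inv x := by simp

theorem extCongr_mem {A A' C C' B : 𝒞} (α : A ≅ A') (γ : C ≅ C') {ξ : Ext A C 1}
    (h : ξ ∈ extWithMiddle A C B) : extCongr α γ ξ ∈ extWithMiddle A' C' B := by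
  obtain ⟨f, g, h, hS, rfl⟩ := h
  have h' : (γ.inv ≫ f) ≫ (g ≫ α.hom) = 0 := by simp [reassoc_of% h]
  let φ : ShortComplex.mk f g h ≅ ShortComplex.mk (γ.inv ≫ f) (g ≫ α.hom) h' :=
    ShortComplex.isoMk γ (Iso.refl _) α (by simp) (by simp)
  have hS' := ShortComplex.shortExact_of_iso φ hS
  refine ⟨_, _, h', hS', ?_⟩
  have := extClass_comp_mk₀_eq hS hS' γ.hom (𝟙 B) α.hom (by simp) (by simp)
  change _ = (Ext.mk₀ α.inv).comp (hS.extClass.comp (Ext.mk₀ γ.hom) (add_zero 1)) (zero_add 1)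
  rw [this, Ext.mk₀_comp_mk₀_assoc]
  simp

theorem extCongr_mem_iff {A A' C C' B : 𝒞} (α : A ≅ A') (γ : C ≅ C') {ξ : Ext A C 1} :
    extCongr α γ ξ ∈ extWithMiddle A' C' B ↔ ξ ∈ extWithMiddle A C B := by
  refine ⟨fun h => ?_, extCongr_mem α γ⟩
  have := extCongr_mem α.symm γ.symm h
  rwa [show extCongr α.symm γ.symm (extCongr α γ ξ) = ξ from (extCongr α γ).symm_apply_apply ξ]
    at this

/-- Structure constants are defined through chosen representatives; this permits replacing them by
the given objects. -/
theorem hallNumber_congr {A A' C C' : 𝒞} (α : A ≅ A') (γ : C ≅ C') (B : 𝒞) :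
    hallNumber A C B = hallNumber A' C' B := by
  unfold hallNumber
  congr 2
  · exact Nat.card_congr ((extCongr α γ).subtypeEquiv fun ξ => (extCongr_mem_iff α γ).symm)
  · exact Nat.card_congr (α.homCongr γ)

theorem shortExact_pushout {Ω P A C : 𝒞} {i : Ω ⟶ P} {p : P ⟶ A}
    {w : i ≫ p = 0} (hS : (ShortComplex.mk i p w).ShortExact) (ζ : Ω ⟶ C) :
    ∃ (g : pushout i ζ ⟶ A) (w' : pushout.inr i ζ ≫ g = 0),
      pushout.inl i ζ ≫ g = p ∧ (ShortComplex.mk (pushout.inr i ζ) g w').ShortExact := by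
  have hi : Mono i := hS.mono_f
  have hp : Epi p := hS.epi_g
  obtain ⟨g, hg₁, hg₂⟩ : ∃ g : pushout i ζ ⟶ A, pushout.inl i ζ ≫ g = p ∧
      pushout.inr i ζ ≫ g = 0 :=
    ⟨pushout.desc p 0 (by rw [w, comp_zero]), pushout.inl_desc _ _ _, pushout.inr_desc _ _ _⟩
  have hge : Epi g := by
    rw [← hg₁] at hp
    exact epi_of_epi (pushout.inl i ζ) _
  refine ⟨g, hg₂, hg₁, ShortComplex.ShortExact.mk' ?_
    (inferInstanceAs (Mono (pushout.inr i ζ))) hge⟩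
  apply ShortComplex.exact_of_g_is_cokernel
  have aux : ∀ {T : 𝒞} (k : pushout i ζ ⟶ T), pushout.inr i ζ ≫ k = 0 →
      i ≫ pushout.inl i ζ ≫ k = 0 := by
    intro T k hk
    rw [pushout.condition_assoc, hk, comp_zero]
  refine CokernelCofork.IsColimit.ofπ _ _ (fun k hk => hS.exact.desc (pushout.inl i ζ ≫ k)
    (aux k hk)) (fun k hk => ?_) (fun k hk m hm => ?_)
  · have h₁ : p ≫ hS.exact.desc (pushout.inl i ζ ≫ k) (aux k hk) = pushout.inl i ζ ≫ k :=
      hS.exact.g_desc _ _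
    apply pushout.hom_ext
    · rw [← Category.assoc, hg₁, h₁]
    · rw [← Category.assoc, hg₂, zero_comp]
      exact hk.symm
  · have h₁ : p ≫ hS.exact.desc (pushout.inl i ζ ≫ k) (aux k hk) = pushout.inl i ζ ≫ k :=
      hS.exact.g_desc _ _
    rw [← cancel_epi p, h₁, ← hm, ← Category.assoc, hg₁]

/-- The pushout square is a morphism from the presentation to the pushed-out sequence, so naturality
identifies the image of `ζ` under the connecting map. -/
theorem extClass_comp_mem_extWithMiddle_pushout {Ω P A C : 𝒞} {i : Ω ⟶ P} {p : P ⟶ A}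
    {w : i ≫ p = 0} (hS : (ShortComplex.mk i p w).ShortExact) (ζ : Ω ⟶ C) :
    hS.extClass.comp (Ext.mk₀ ζ) (add_zero 1) ∈ extWithMiddle A C (pushout i ζ) := by
  obtain ⟨g, w', hg, hS'⟩ := shortExact_pushout hS ζ
  refine ⟨_, _, w', hS', ?_⟩
  have nat := extClass_comp_mk₀_eq hS hS' ζ (pushout.inl i ζ) (𝟙 A) pushout.condition
    (by rw [hg, Category.comp_id])
  rw [nat, Ext.mk₀_id_comp]

/-- Every extension of `A` by `C` is a pushout of a given projective presentation of `A`. -/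
theorem exists_extClass_comp_eq {Ω P A C : 𝒞} [Projective P] {i : Ω ⟶ P} {p : P ⟶ A}
    {w : i ≫ p = 0} (hS : (ShortComplex.mk i p w).ShortExact) (ξ : Ext A C 1) :
    ∃ ζ : Ω ⟶ C, hS.extClass.comp (Ext.mk₀ ζ) (add_zero 1) = ξ := by
  obtain ⟨x, hx⟩ := Ext.contravariant_sequence_exact₃ hS C ξ
    (Ext.eq_zero_of_projective (P := P) (n := 0) _) (add_zero 1)
  obtain ⟨ζ, rfl⟩ := (Ext.mk₀_bijective _ _).2 x
  exact ⟨ζ, hx⟩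

end MiddleTerms

/-! ### Hall products over parametrized families of extensions -/

section Classes

variable {𝒞 : Type u} [Category.{v} 𝒞] [Abelian 𝒞] {P : ObjectProperty 𝒞} {t : ℂ}
  {χ : 𝒞 → 𝒞 → ℤ}

/-- The isomorphism class of an object. -/
def isoClass (A : 𝒞) (hA : P A) : IsoClass P :=
  Quotient.mk (isIsomorphicSetoid P.FullSubcategory) ⟨A, hA⟩

theorem IsoClass.prop_rep (a : IsoClass P) : P a.rep := (Quotient.out a).property

theorem isoClass_eq_iff {A A' : 𝒞} {hA : P A} {hA' : P A'} :
    isoClass A hA = isoClass A' hA' ↔ Nonempty (A ≅ A') := by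
  refine Quotient.eq.trans ⟨?_, ?_⟩
  · rintro ⟨e⟩
    exact ⟨P.ι.mapIso e⟩
  · rintro ⟨e⟩
    exact ⟨P.fullyFaithfulι.preimageIso e⟩

theorem isoClass_rep (a : IsoClass P) : isoClass a.rep a.prop_rep = a := Quotient.out_eq a

theorem nonempty_rep_iso (A : 𝒞) (hA : P A) : Nonempty ((isoClass A hA).rep ≅ A) :=
  isoClass_eq_iff.1 (isoClass_rep (isoClass A hA))

namespace TwHall

theorem cls_eq_basis (A : 𝒞) (hA : P A) : cls P t χ A hA = basis P t χ (isoClass A hA) := rfl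

theorem basis_eq_cls (a : IsoClass P) : basis P t χ a = cls P t χ a.rep a.prop_rep := by
  rw [cls_eq_basis, isoClass_rep]

theorem cls_congr {A A' : 𝒞} (hA : P A) (hA' : P A') (e : A ≅ A') :
    cls P t χ A hA = cls P t χ A' hA' := by
  rw [cls_eq_basis, cls_eq_basis, isoClass_eq_iff.2 ⟨e⟩]

/-- The product of two classes as an average over a finite family of extensions in which every
extension class is represented equally often. -/
theorem cls_mul_cls {A C : 𝒞} (hA : P A) (hC : P C)
    (hχ : ∀ A' C', Nonempty (A' ≅ A) → Nonempty (C' ≅ C) → χ A' C' = χ A C)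
    {Z : Type*} [Finite Z] (L : Z → 𝒞) (hL : ∀ z, P (L z)) (π : Z → Ext A C 1)
    (hπ : ∀ z, π z ∈ extWithMiddle A C (L z)) (n : ℕ) (hn : n ≠ 0)
    (hfib : ∀ ξ, Nat.card {z // π z = ξ} = n) :
    cls P t χ A hA * cls P t χ C hC =
      (t ^ χ A C * ((n : ℂ) * (Nat.card (A ⟶ C) : ℂ))⁻¹) • ∑ᶠ z, cls P t χ (L z) (hL z) := by
  classical
  haveI := Fintype.ofFinite Z
  obtain ⟨α⟩ := nonempty_rep_iso A hA
  obtain ⟨γ⟩ := nonempty_rep_iso C hC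
  -- An extension class determines its middle term up to isomorphism, so the sets `Ext¹(A, C)_B`
  -- partition the parameters according to the class of `L z`.
  have hb : ∀ b : IsoClass P, ∀ z, isoClass (L z) (hL z) = b ↔ π z ∈ extWithMiddle A C b.rep := by
    intro b z
    constructor
    · rintro rfl
      obtain ⟨e⟩ := nonempty_rep_iso (L z) (hL z)
      exact extWithMiddle_mono e.symm (hπ z)
    · intro h
      obtain ⟨e⟩ := nonempty_iso_of_mem_extWithMiddle (hπ z) h
      rw [← isoClass_rep b]
      exact isoClass_eq_iff.2 ⟨e⟩
  have hcard : ∀ b : IsoClass P, (Nat.card {z // isoClass (L z) (hL z) = b}) =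
      n * Nat.card (extWithMiddle A C b.rep) := by
    intro b
    have e : {z // isoClass (L z) (hL z) = b} ≃
        Σ ξ : extWithMiddle A C b.rep, {z // π z = ξ} :=
      { toFun z := ⟨⟨π z, (hb b z).1 z.2⟩, z, rfl⟩
        invFun x := ⟨x.2.1, (hb b _).2 (by rw [x.2.2]; exact x.1.2)⟩
        left_inv z := rfl
        right_inv := by
          rintro ⟨⟨ξ, hξ⟩, z, hz⟩
          change π z = ξ at hz
          subst hz
          rfl }
    -- The fibres have `n ≠ 0` elements, so `π` is onto. Finiteness matters because `Nat.card` of an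
    -- infinite set is `0`.
    haveI : Finite (Ext A C 1) := Finite.of_surjective π fun ξ => by
      have : Nonempty {z // π z = ξ} := by
        by_contra hne
        rw [not_nonempty_iff] at hne
        exact hn (by rw [← hfib ξ]; exact Nat.card_of_isEmpty)
      exact ⟨this.some.1, this.some.2⟩
    haveI : Fintype (extWithMiddle A C b.rep) := Fintype.ofFinite _
    rw [Nat.card_congr e, Nat.card_sigma, Finset.sum_congr rfl fun ξ _ => hfib ξ.1]
    rw [Finset.sum_const, Finset.card_univ, Nat.card_eq_fintype_card, smul_eq_mul, mul_comm]
  rw [cls_eq_basis, cls_eq_basis, basis_mul_basis, basisMul,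
    hχ _ _ (nonempty_rep_iso A hA) (nonempty_rep_iso C hC), mul_smul]
  congr 1
  have key : (∑ᶠ z, cls P t χ (L z) (hL z)) = ∑ᶠ b : IsoClass P,
      ((Nat.card {z // isoClass (L z) (hL z) = b} : ℕ) : ℂ) • basis P t χ b := by
    rw [finsum_eq_sum_of_fintype]
    rw [finsum_eq_sum_of_support_subset (s := Finset.univ.image fun z => isoClass (L z) (hL z))]
    · rw [← Finset.sum_fiberwise_of_maps_to
        (g := fun z => isoClass (L z) (hL z)) (t := Finset.univ.image fun z =>
          isoClass (L z) (hL z)) (by intro z _; exact Finset.mem_image_of_mem _ (Finset.mem_univ z))]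
      refine Finset.sum_congr rfl fun b _ => ?_
      rw [Finset.sum_congr rfl (g := fun _ => basis P t χ b)]
      · rw [Finset.sum_const, Nat.card_eq_fintype_card, Fintype.card_subtype,
          ← Nat.cast_smul_eq_nsmul ℂ]
      · intro z hz
        rw [cls_eq_basis, (Finset.mem_filter.1 hz).2]
    · intro b hbs
      by_contra hne
      refine hbs ?_
      have : IsEmpty {z // isoClass (L z) (hL z) = b} := ⟨fun z => hne
        (by rw [Finset.coe_image]; exact ⟨z.1, by simp, z.2⟩)⟩
      simp [Nat.card_of_isEmpty]
  rw [key, smul_finsum]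
  refine finsum_congr fun b => ?_
  rw [hcard, smul_smul, hallNumber_congr α γ, hallNumber]
  congr 1
  have : (n : ℂ) ≠ 0 := by exact_mod_cast hn
  push_cast
  rw [mul_inv, div_eq_mul_inv]
  field_simp

end TwHall

end Classes

/-! ### Morphisms of `ℤ/2`-graded complexes -/

section ComplexMorphisms

variable {𝒜 : Type u} [Category.{v} 𝒜] [Abelian 𝒜]

theorem C2.hom_ext {M N : C2 𝒜} {f g : M ⟶ N} (h₀ : f.f 0 = g.f 0) (h₁ : f.f 1 = g.f 1) :
    f = g := by
  ext i
  revert i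
  -- `ZMod 2` unfolds to `Fin 2`, on which the two degrees can be matched.
  intro (i : Fin 2)
  match i with
  | 0 => exact h₀
  | 1 => exact h₁

/-- A morphism of `ℤ/2`-graded complexes from its two components. -/
def C2.homMk {M N : C2 𝒜} (f₁ : M.X 1 ⟶ N.X 1) (f₀ : M.X 0 ⟶ N.X 0)
    (c₁ : f₁ ≫ N.d 1 0 = M.d 1 0 ≫ f₀) (c₀ : f₀ ≫ N.d 0 1 = M.d 0 1 ≫ f₁) : M ⟶ N where
  f := fun i : Fin 2 => match i with
    | 0 => f₀
    | 1 => f₁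
  comm' := fun i j : Fin 2 => match i, j with
    | 0, 0 => fun h => absurd ((rel_iff 0 0).1 h) (by decide)
    | 0, 1 => fun _ => c₀
    | 1, 0 => fun _ => c₁
    | 1, 1 => fun h => absurd ((rel_iff 1 1).1 h) (by decide)

@[simp] theorem C2.homMk_f_zero {M N : C2 𝒜} (f₁ : M.X 1 ⟶ N.X 1) (f₀ : M.X 0 ⟶ N.X 0)
    (c₁ : f₁ ≫ N.d 1 0 = M.d 1 0 ≫ f₀) (c₀ : f₀ ≫ N.d 0 1 = M.d 0 1 ≫ f₁) :
    (C2.homMk f₁ f₀ c₁ c₀).f 0 = f₀ := rfl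

@[simp] theorem C2.homMk_f_one {M N : C2 𝒜} (f₁ : M.X 1 ⟶ N.X 1) (f₀ : M.X 0 ⟶ N.X 0)
    (c₁ : f₁ ≫ N.d 1 0 = M.d 1 0 ≫ f₀) (c₀ : f₀ ≫ N.d 0 1 = M.d 0 1 ≫ f₁) :
    (C2.homMk f₁ f₀ c₁ c₀).f 1 = f₁ := rfl

/-- An isomorphism of `ℤ/2`-graded complexes from its two components. -/
def C2.isoMk {M N : C2 𝒜} (f₁ : M.X 1 ≅ N.X 1) (f₀ : M.X 0 ≅ N.X 0)
    (c₁ : f₁.hom ≫ N.d 1 0 = M.d 1 0 ≫ f₀.hom) (c₀ : f₀.hom ≫ N.d 0 1 = M.d 0 1 ≫ f₁.hom) :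
    M ≅ N where
  hom := C2.homMk f₁.hom f₀.hom c₁ c₀
  inv := C2.homMk f₁.inv f₀.inv (by rw [Iso.inv_comp_eq, ← Category.assoc, c₁]; simp)
    (by rw [Iso.inv_comp_eq, ← Category.assoc, c₀]; simp)
  hom_inv_id := C2.hom_ext (by simp) (by simp)
  inv_hom_id := C2.hom_ext (by simp) (by simp)

theorem C2.shortExact {M N L : C2 𝒜} {f : N ⟶ L} {g : L ⟶ M} (w : f ≫ g = 0)
    (h₀ : ∃ w : f.f 0 ≫ g.f 0 = 0, (ShortComplex.mk (f.f 0) (g.f 0) w).ShortExact)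
    (h₁ : ∃ w : f.f 1 ≫ g.f 1 = 0, (ShortComplex.mk (f.f 1) (g.f 1) w).ShortExact) :
    (ShortComplex.mk f g w).ShortExact := by
  apply HomologicalComplex.shortExact_of_degreewise_shortExact
  intro (i : Fin 2)
  match i with
  | 0 => exact h₀.2
  | 1 => exact h₁.2

/-- The isomorphism between components of isomorphic complexes. -/
@[simps]
def C2.evalIso {M N : C2 𝒜} (a : M ≅ N) (i : ZMod 2) : M.X i ≅ N.X i where
  hom := a.hom.f i
  inv := a.inv.f i
  hom_inv_id := by rw [← HomologicalComplex.comp_f, a.hom_inv_id]; rfl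
  inv_hom_id := by rw [← HomologicalComplex.comp_f, a.inv_hom_id]; rfl

section Standard

variable {M₁ M₀ N₁ N₀ : 𝒜} {d₁ : M₁ ⟶ M₀} {d₀ : M₀ ⟶ M₁} {h₁ : d₁ ≫ d₀ = 0} {h₀ : d₀ ≫ d₁ = 0}
  {e₁ : N₁ ⟶ N₀} {e₀ : N₀ ⟶ N₁} {l₁ : e₁ ≫ e₀ = 0} {l₀ : e₀ ≫ e₁ = 0}

/-- A morphism into a complex in standard form. -/
def C2.homToMk {M : C2 𝒜} (f₁ : M.X 1 ⟶ N₁) (f₀ : M.X 0 ⟶ N₀)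
    (c₁ : f₁ ≫ e₁ = M.d 1 0 ≫ f₀) (c₀ : f₀ ≫ e₀ = M.d 0 1 ≫ f₁) : M ⟶ C2.mk e₁ e₀ l₁ l₀ :=
  C2.homMk (N := C2.mk e₁ e₀ l₁ l₀) f₁ f₀ c₁ c₀

/-- A morphism out of a complex in standard form. -/
def C2.homOfMk {N : C2 𝒜} (f₁ : M₁ ⟶ N.X 1) (f₀ : M₀ ⟶ N.X 0)
    (c₁ : f₁ ≫ N.d 1 0 = d₁ ≫ f₀) (c₀ : f₀ ≫ N.d 0 1 = d₀ ≫ f₁) : C2.mk d₁ d₀ h₁ h₀ ⟶ N :=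
  C2.homMk (M := C2.mk d₁ d₀ h₁ h₀) f₁ f₀ c₁ c₀

/-- A morphism between complexes in standard form. -/
def C2.mkHom (f₁ : M₁ ⟶ N₁) (f₀ : M₀ ⟶ N₀) (c₁ : f₁ ≫ e₁ = d₁ ≫ f₀) (c₀ : f₀ ≫ e₀ = d₀ ≫ f₁) :
    C2.mk d₁ d₀ h₁ h₀ ⟶ C2.mk e₁ e₀ l₁ l₀ :=
  C2.homMk (M := C2.mk d₁ d₀ h₁ h₀) (N := C2.mk e₁ e₀ l₁ l₀) f₁ f₀ c₁ c₀

/-- An isomorphism between complexes in standard form. -/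
def C2.mkIso (f₁ : M₁ ≅ N₁) (f₀ : M₀ ≅ N₀) (c₁ : f₁.hom ≫ e₁ = d₁ ≫ f₀.hom)
    (c₀ : f₀.hom ≫ e₀ = d₀ ≫ f₁.hom) : C2.mk d₁ d₀ h₁ h₀ ≅ C2.mk e₁ e₀ l₁ l₀ :=
  C2.isoMk (M := C2.mk d₁ d₀ h₁ h₀) (N := C2.mk e₁ e₀ l₁ l₀) f₁ f₀ c₁ c₀

/-- An isomorphism onto a complex in standard form. -/
def C2.isoToMk {M : C2 𝒜} (f₁ : M.X 1 ≅ N₁) (f₀ : M.X 0 ≅ N₀)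
    (c₁ : f₁.hom ≫ e₁ = M.d 1 0 ≫ f₀.hom) (c₀ : f₀.hom ≫ e₀ = M.d 0 1 ≫ f₁.hom) :
    M ≅ C2.mk e₁ e₀ l₁ l₀ :=
  C2.isoMk (N := C2.mk e₁ e₀ l₁ l₀) f₁ f₀ c₁ c₀

end Standard

end ComplexMorphisms

/-! ### Extensions of complexes as twisted differentials -/

section Cones

variable {𝒜 : Type u} [Category.{v} 𝒜] [Abelian 𝒜]

/-- The odd cocycles of the `ℤ/2`-graded complex of homomorphisms from `M` to `N`. -/
def cocycles (M N : C2 𝒜) : AddSubgroup ((M.X 0 ⟶ N.X 1) × (M.X 1 ⟶ N.X 0)) where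
  carrier := {h | h.2 ≫ N.d 0 1 + M.d 1 0 ≫ h.1 = 0 ∧ h.1 ≫ N.d 1 0 + M.d 0 1 ≫ h.2 = 0}
  zero_mem' := by simp
  add_mem' := by
    rintro ⟨a, b⟩ ⟨a', b'⟩ ⟨h₁, h₀⟩ ⟨h₁', h₀'⟩
    simp only [Set.mem_ofPred_eq, Prod.fst_add, Prod.snd_add, Preadditive.add_comp, Preadditive.comp_add] at *
    constructor
    · rw [add_add_add_comm, h₁, h₁', add_zero]
    · rw [add_add_add_comm, h₀, h₀', add_zero]
  neg_mem' := by
    rintro ⟨a, b⟩ ⟨h₁, h₀⟩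
    simp only [Set.mem_ofPred_eq, Prod.fst_neg, Prod.snd_neg, Preadditive.neg_comp, Preadditive.comp_neg] at *
    constructor
    · rw [← neg_add, h₁, neg_zero]
    · rw [← neg_add, h₀, neg_zero]

theorem cocycles_rel₁ {M N : C2 𝒜} (h : cocycles M N) :
    h.1.2 ≫ N.d 0 1 + M.d 1 0 ≫ h.1.1 = 0 := h.2.1

theorem cocycles_rel₀ {M N : C2 𝒜} (h : cocycles M N) :
    h.1.1 ≫ N.d 1 0 + M.d 0 1 ≫ h.1.2 = 0 := h.2.2

/-- The extension of `M` by `N` with the differential twisted by an odd cocycle. -/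
def cone {M N : C2 𝒜} (h : cocycles M N) : C2 𝒜 :=
  C2.mk (biprod.map (N.d 1 0) (M.d 1 0) + biprod.snd ≫ h.1.2 ≫ biprod.inl)
    (biprod.map (N.d 0 1) (M.d 0 1) + biprod.snd ≫ h.1.1 ≫ biprod.inl)
    (by have := cocycles_rel₁ h; ext <;> simp [← this])
    (by ext <;> simp [← cocycles_rel₀ h])

theorem isProj_cone {M N : C2 𝒜} (hM : isProj 𝒜 M) (hN : isProj 𝒜 N) (h : cocycles M N) :
    isProj 𝒜 (cone h) := by
  have := hM 0
  have := hM 1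
  have := hN 0
  have := hN 1
  exact isProj_mk _ _ _ _ inferInstance inferInstance

/-- The inclusion of the subobject in an extension of complexes. -/
def coneInl {M N : C2 𝒜} (h : cocycles M N) : N ⟶ cone h :=
  C2.homToMk biprod.inl biprod.inl (by simp) (by simp)

/-- The projection to the quotient in an extension of complexes. -/
def coneSnd {M N : C2 𝒜} (h : cocycles M N) : cone h ⟶ M :=
  C2.homOfMk biprod.snd biprod.snd (by simp) (by simp)

theorem coneInl_coneSnd {M N : C2 𝒜} (h : cocycles M N) : coneInl h ≫ coneSnd h = 0 :=
  C2.hom_ext (biprod.inl_snd) (biprod.inl_snd)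

theorem shortExact_cone {M N : C2 𝒜} (h : cocycles M N) :
    (ShortComplex.mk (coneInl h) (coneSnd h) (coneInl_coneSnd h)).ShortExact :=
  C2.shortExact _ ⟨biprod.inl_snd, (ShortComplex.Splitting.ofHasBinaryBiproduct _ _).shortExact⟩
    ⟨biprod.inl_snd, (ShortComplex.Splitting.ofHasBinaryBiproduct _ _).shortExact⟩

/-- The class of an odd cocycle. -/
def cocycleClass {M N : C2 𝒜} (h : cocycles M N) : Ext M N 1 := (shortExact_cone h).extClass

/-- The even part of the differential of the complex of homomorphisms. -/
def coboundary (M N : C2 𝒜) :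
    (M.X 0 ⟶ N.X 0) × (M.X 1 ⟶ N.X 1) →+ cocycles M N where
  toFun s := ⟨(s.1 ≫ N.d 0 1 - M.d 0 1 ≫ s.2, s.2 ≫ N.d 1 0 - M.d 1 0 ≫ s.1), by
    constructor <;> simp⟩
  map_zero' := by ext <;> simp
  map_add' s s' := by
    ext <;> simp only [Prod.fst_add, Prod.snd_add, Preadditive.add_comp, Preadditive.comp_add,
      AddSubgroup.coe_add] <;> abel

/-- An even map `s` whose coboundary is the difference gives the unipotent map `1 + s` between the
two twisted complexes, compatible with the inclusions and projections. -/
theorem cocycleClass_eq_of_sub_mem {M N : C2 𝒜} {h h' : cocycles M N}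
    (H : h - h' ∈ (coboundary M N).range) : cocycleClass h = cocycleClass h' := by
  obtain ⟨s, hs⟩ := H
  have hs₁ : h.1.1 - h'.1.1 = s.1 ≫ N.d 0 1 - M.d 0 1 ≫ s.2 :=
    (congrArg (fun x : cocycles M N => x.1.1) hs).symm
  have hs₂ : h.1.2 - h'.1.2 = s.2 ≫ N.d 1 0 - M.d 1 0 ≫ s.1 :=
    (congrArg (fun x : cocycles M N => x.1.2) hs).symm
  have e₁ : h.1.1 = h'.1.1 + (s.1 ≫ N.d 0 1 - M.d 0 1 ≫ s.2) := by rw [← hs₁]; abel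
  have e₂ : h.1.2 = h'.1.2 + (s.2 ≫ N.d 1 0 - M.d 1 0 ≫ s.1) := by rw [← hs₂]; abel
  let φ : cone h ⟶ cone h' := C2.mkHom (𝟙 _ + biprod.snd ≫ s.2 ≫ biprod.inl)
    (𝟙 _ + biprod.snd ≫ s.1 ≫ biprod.inl)
    (by ext <;> simp [e₂]; abel) (by ext <;> simp [e₁]; abel)
  refine extClass_eq_of_hom _ _ φ (C2.hom_ext ?_ ?_) (C2.hom_ext ?_ ?_)
  · change biprod.inl ≫ (𝟙 _ + biprod.snd ≫ s.1 ≫ biprod.inl) = biprod.inl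
    simp
  · change biprod.inl ≫ (𝟙 _ + biprod.snd ≫ s.2 ≫ biprod.inl) = biprod.inl
    simp
  · change (𝟙 _ + biprod.snd ≫ s.1 ≫ biprod.inl) ≫ biprod.snd = biprod.snd
    simp
  · change (𝟙 _ + biprod.snd ≫ s.2 ≫ biprod.inl) ≫ biprod.snd = biprod.snd
    simp

/-- Conversely, an isomorphism of extensions is unipotent in each degree; its off-diagonal entry is
the required even map, and compatibility with the differentials is the coboundary equation. -/
theorem sub_mem_of_cocycleClass_eq {M N : C2 𝒜} {h h' : cocycles M N}
    (H : cocycleClass h = cocycleClass h') : h - h' ∈ (coboundary M N).range := by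
  obtain ⟨φ, c₁, c₂⟩ := exists_iso_of_extClass_eq _ _ H
  let φ₀ : N.X 0 ⊞ M.X 0 ⟶ N.X 0 ⊞ M.X 0 := φ.hom.f 0
  let φ₁ : N.X 1 ⊞ M.X 1 ⟶ N.X 1 ⊞ M.X 1 := φ.hom.f 1
  have a₀ : biprod.inl ≫ φ₀ = biprod.inl := congrArg (fun f => f.f 0) c₁
  have a₁ : biprod.inl ≫ φ₁ = biprod.inl := congrArg (fun f => f.f 1) c₁
  have b₀ : φ₀ ≫ biprod.snd = biprod.snd := congrArg (fun f => f.f 0) c₂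
  have b₁ : φ₁ ≫ biprod.snd = biprod.snd := congrArg (fun f => f.f 1) c₂
  have k₁ : φ₁ ≫ (biprod.map (N.d 1 0) (M.d 1 0) + biprod.snd ≫ h'.1.2 ≫ biprod.inl) =
      (biprod.map (N.d 1 0) (M.d 1 0) + biprod.snd ≫ h.1.2 ≫ biprod.inl) ≫ φ₀ := φ.hom.comm 1 0
  have k₀ : φ₀ ≫ (biprod.map (N.d 0 1) (M.d 0 1) + biprod.snd ≫ h'.1.1 ≫ biprod.inl) =
      (biprod.map (N.d 0 1) (M.d 0 1) + biprod.snd ≫ h.1.1 ≫ biprod.inl) ≫ φ₁ := φ.hom.comm 0 1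
  let s : (M.X 0 ⟶ N.X 0) × (M.X 1 ⟶ N.X 1) :=
    (biprod.inr ≫ φ₀ ≫ biprod.fst, biprod.inr ≫ φ₁ ≫ biprod.fst)
  have r₁ := congrArg (fun f => biprod.inr ≫ f ≫ biprod.fst) k₁
  have r₀ := congrArg (fun f => biprod.inr ≫ f ≫ biprod.fst) k₀
  simp [reassoc_of% b₁, reassoc_of% a₀] at r₁
  simp [reassoc_of% b₀, reassoc_of% a₁] at r₀
  refine ⟨s, Subtype.ext (Prod.ext ?_ ?_)⟩
  · change s.1 ≫ N.d 0 1 - M.d 0 1 ≫ s.2 = h.1.1 - h'.1.1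
    rw [sub_eq_sub_iff_add_eq_add]
    simpa [s, add_comm] using r₀
  · change s.2 ≫ N.d 1 0 - M.d 1 0 ≫ s.1 = h.1.2 - h'.1.2
    rw [sub_eq_sub_iff_add_eq_add]
    simpa [s, add_comm] using r₁

theorem C2.shortExact_f {M N L : C2 𝒜} {f : N ⟶ L} {g : L ⟶ M} {w : f ≫ g = 0}
    (hS : (ShortComplex.mk f g w).ShortExact) (i : ZMod 2) :
    ∃ w : f.f i ≫ g.f i = 0, (ShortComplex.mk (f.f i) (g.f i) w).ShortExact :=
  ⟨by rw [← HomologicalComplex.comp_f, w]; rfl,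
    (HomologicalComplex.shortExact_iff_degreewise_shortExact _).1 hS i⟩

/-- Projectivity of the terms of `M` gives sections `σ₀`, `σ₁` in each degree. Their failure to
commute with the differentials takes values in `N` and is the cocycle. -/
theorem exists_cocycleClass_eq_extClass {M N L : C2 𝒜} (hM : isProj 𝒜 M) {f : N ⟶ L}
    {g : L ⟶ M} {w : f ≫ g = 0} (hS : (ShortComplex.mk f g w).ShortExact) :
    ∃ h : cocycles M N, cocycleClass h = hS.extClass := by
  obtain ⟨w₀, S₀⟩ := C2.shortExact_f hS 0
  obtain ⟨w₁, S₁⟩ := C2.shortExact_f hS 1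
  have := hM 0
  have := hM 1
  have mf₀ : Mono (f.f 0) := S₀.mono_f
  have mf₁ : Mono (f.f 1) := S₁.mono_f
  have eg₀ : Epi (g.f 0) := S₀.epi_g
  have eg₁ : Epi (g.f 1) := S₁.epi_g
  obtain ⟨σ₀, hσ₀⟩ : ∃ σ : M.X 0 ⟶ L.X 0, σ ≫ g.f 0 = 𝟙 _ :=
    ⟨Projective.factorThru (𝟙 _) (g.f 0), Projective.factorThru_comp _ _⟩
  obtain ⟨σ₁, hσ₁⟩ : ∃ σ : M.X 1 ⟶ L.X 1, σ ≫ g.f 1 = 𝟙 _ :=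
    ⟨Projective.factorThru (𝟙 _) (g.f 1), Projective.factorThru_comp _ _⟩
  obtain ⟨h₀, e₀⟩ : ∃ h : M.X 0 ⟶ N.X 1, h ≫ f.f 1 = σ₀ ≫ L.d 0 1 - M.d 0 1 ≫ σ₁ := by
    have c : (σ₀ ≫ L.d 0 1 - M.d 0 1 ≫ σ₁) ≫ g.f 1 = 0 := by
      have r : σ₀ ≫ L.d 0 1 ≫ g.f 1 = M.d 0 1 := by rw [← g.comm, reassoc_of% hσ₀]
      simp [hσ₁, r]
    exact ⟨S₁.exact.lift _ c, S₁.exact.lift_f _ c⟩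
  obtain ⟨h₁, e₁⟩ : ∃ h : M.X 1 ⟶ N.X 0, h ≫ f.f 0 = σ₁ ≫ L.d 1 0 - M.d 1 0 ≫ σ₀ := by
    have c : (σ₁ ≫ L.d 1 0 - M.d 1 0 ≫ σ₀) ≫ g.f 0 = 0 := by
      have r : σ₁ ≫ L.d 1 0 ≫ g.f 0 = M.d 1 0 := by rw [← g.comm, reassoc_of% hσ₁]
      simp [hσ₀, r]
    exact ⟨S₀.exact.lift _ c, S₀.exact.lift_f _ c⟩
  have e₀' : σ₀ ≫ L.d 0 1 = h₀ ≫ f.f 1 + M.d 0 1 ≫ σ₁ := by rw [e₀]; abel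
  have e₁' : σ₁ ≫ L.d 1 0 = h₁ ≫ f.f 0 + M.d 1 0 ≫ σ₀ := by rw [e₁]; abel
  let h : cocycles M N := ⟨(h₀, h₁), by
    constructor
    · rw [← cancel_mono (f.f 1)]
      have r : h₁ ≫ N.d 0 1 ≫ f.f 1 = -(M.d 1 0 ≫ σ₀ ≫ L.d 0 1) := by
        rw [← f.comm, reassoc_of% e₁]
        simp
      simp [e₀, r]
    · rw [← cancel_mono (f.f 0)]
      have r : h₀ ≫ N.d 1 0 ≫ f.f 0 = -(M.d 0 1 ≫ σ₁ ≫ L.d 1 0) := by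
        rw [← f.comm, reassoc_of% e₀]
        simp
      simp [e₁, r]⟩
  let φ : cone h ⟶ L := C2.homOfMk (biprod.desc (f.f 1) σ₁) (biprod.desc (f.f 0) σ₀)
    (by ext <;> simp [e₁', h]; abel) (by ext <;> simp [e₀', h]; abel)
  refine ⟨h, extClass_eq_of_hom _ _ φ (C2.hom_ext ?_ ?_) (C2.hom_ext ?_ ?_)⟩
  · exact biprod.inl_desc _ _
  · exact biprod.inl_desc _ _
  · change biprod.desc (f.f 0) σ₀ ≫ g.f 0 = biprod.snd
    ext <;> simp [w₀, hσ₀]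
  · change biprod.desc (f.f 1) σ₁ ≫ g.f 1 = biprod.snd
    ext <;> simp [w₁, hσ₁]

/-- A map from `K_P` is the same as a map from `P` into the degree one term, and epimorphisms of
complexes are epimorphisms in degree one. -/
instance projective_complexK (P : 𝒜) [Projective P] : Projective (complexK P) where
  factors {E X} f e _ := by
    have : Epi (e.f 1) := inferInstance
    let f₁ : P ⟶ X.X 1 := f.f 1
    let f₀ : P ⟶ X.X 0 := f.f 0
    have c : f₁ ≫ X.d 1 0 = f₀ := (f.comm 1 0).trans (Category.id_comp _)
    let u : P ⟶ E.X 1 := Projective.factorThru f₁ (e.f 1)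
    have hu : u ≫ e.f 1 = f₁ := Projective.factorThru_comp _ _
    refine ⟨C2.homOfMk u (u ≫ E.d 1 0) (by simp) (by simp), C2.hom_ext ?_ hu⟩
    change (u ≫ E.d 1 0) ≫ e.f 0 = f₀
    rw [Category.assoc, ← e.comm, reassoc_of% hu, c]

instance projective_complexKStar (P : 𝒜) [Projective P] : Projective (complexKStar P) where
  factors {E X} f e _ := by
    have : Epi (e.f 0) := inferInstance
    let f₁ : P ⟶ X.X 1 := f.f 1
    let f₀ : P ⟶ X.X 0 := f.f 0
    have c : f₀ ≫ X.d 0 1 = f₁ := (f.comm 0 1).trans (Category.id_comp _)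
    let u : P ⟶ E.X 0 := Projective.factorThru f₀ (e.f 0)
    have hu : u ≫ e.f 0 = f₀ := Projective.factorThru_comp _ _
    refine ⟨C2.homOfMk (u ≫ E.d 0 1) u (by simp) (by simp), C2.hom_ext hu ?_⟩
    change (u ≫ E.d 0 1) ≫ e.f 1 = f₁
    rw [Category.assoc, ← e.comm, reassoc_of% hu, c]

/-- `K_{M₁}` hits `M` in degree one and `K_{M₀}^*` in degree zero. The resulting projective
presentation realizes every element of `Ext¹` out of `M` by an actual short exact sequence. -/
theorem exists_epi_of_isProj {M : C2 𝒜} (hM : isProj 𝒜 M) :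
    ∃ (Q : C2 𝒜) (_ : Projective Q) (p : Q ⟶ M), Epi p := by
  have := hM 0
  have := hM 1
  let a : complexK (M.X 1) ⟶ M := C2.homOfMk (𝟙 _) (M.d 1 0) (by simp) (by simp)
  let b : complexKStar (M.X 0) ⟶ M := C2.homOfMk (M.d 0 1) (𝟙 _) (by simp) (by simp)
  refine ⟨complexK (M.X 1) ⊞ complexKStar (M.X 0), inferInstance, biprod.desc a b, ?_⟩
  have h₀ : Epi ((biprod.desc a b).f 0) := by
    have : Epi ((biprod.inr : _ ⟶ complexK (M.X 1) ⊞ complexKStar (M.X 0)).f 0 ≫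
        (biprod.desc a b).f 0) := by
      rw [← HomologicalComplex.comp_f, biprod.inr_desc]
      exact inferInstanceAs (Epi (𝟙 (M.X 0)))
    exact epi_of_epi ((biprod.inr : _ ⟶ complexK (M.X 1) ⊞ complexKStar (M.X 0)).f 0) _
  have h₁ : Epi ((biprod.desc a b).f 1) := by
    have : Epi ((biprod.inl : _ ⟶ complexK (M.X 1) ⊞ complexKStar (M.X 0)).f 1 ≫
        (biprod.desc a b).f 1) := by
      rw [← HomologicalComplex.comp_f, biprod.inl_desc]
      exact inferInstanceAs (Epi (𝟙 (M.X 1)))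
    exact epi_of_epi ((biprod.inl : _ ⟶ complexK (M.X 1) ⊞ complexKStar (M.X 0)).f 1) _
  have : ∀ i : Fin 2, Epi ((biprod.desc a b).f (i : ZMod 2)) := fun i => match i with
    | 0 => h₀
    | 1 => h₁
  have : ∀ i : ZMod 2, Epi ((biprod.desc a b).f i) := this
  exact HomologicalComplex.epi_of_epi_f _ this

theorem cocycleClass_surjective {M N : C2 𝒜} (hM : isProj 𝒜 M) :
    Function.Surjective (cocycleClass (M := M) (N := N)) := by
  intro ξ
  obtain ⟨Q, _, p, _⟩ := exists_epi_of_isProj hM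
  have hS : (ShortComplex.mk (kernel.ι p) p (kernel.condition p)).ShortExact :=
    ShortComplex.ShortExact.mk' (ShortComplex.exact_of_f_is_kernel _ (kernelIsKernel p))
      (inferInstanceAs (Mono (kernel.ι p))) ‹_›
  obtain ⟨ζ, rfl⟩ := exists_extClass_comp_eq hS ξ
  obtain ⟨f, g, w, hS', e⟩ := extClass_comp_mem_extWithMiddle_pushout hS ζ
  rw [← e]
  exact exists_cocycleClass_eq_extClass hM hS'

end Cones

/-! ### Counting cocycles: the product of two complexes of projectives -/

section HallProduct

variable (k : Type w) [Field k] {𝒜 : Type u} [Category.{v} 𝒜] [Abelian 𝒜] [Linear k 𝒜]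

/-- The dimension of a space of morphisms. -/
def hd (X Y : 𝒜) : ℤ := Module.finrank k (X ⟶ Y)

theorem euler_eq_hd (P X : 𝒜) [Projective P] : euler k P X = hd k P X := by
  unfold euler
  rw [finsum_eq_single _ 0]
  · rw [pow_zero, one_mul, hd, (Ext.linearEquiv₀ (R := k) (X := P) (Y := X)).finrank_eq]
  · intro n hn
    obtain ⟨m, rfl⟩ := Nat.exists_eq_succ_of_ne_zero hn
    have := Ext.subsingleton_of_projective P X m
    rw [Module.finrank_zero_of_subsingleton]
    simp

theorem eulerC2_eq_hd {M : C2 𝒜} (hM : isProj 𝒜 M) (N : C2 𝒜) :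
    eulerC2 k M N = hd k (M.X 0) (N.X 0) + hd k (M.X 1) (N.X 1) := by
  have := hM 0
  have := hM 1
  rw [eulerC2, euler_eq_hd, euler_eq_hd]

theorem hd_congr {X X' Y Y' : 𝒜} (e : X ≅ X') (e' : Y ≅ Y') : hd k X Y = hd k X' Y' := by
  unfold hd
  exact congrArg _ ((Linear.homCongr k e e').finrank_eq)

variable [Finite k]

theorem sqrtCard_ne_zero : sqrtCard k ≠ 0 := by
  unfold sqrtCard
  have : 0 < Nat.card k := Nat.card_pos
  norm_cast
  positivity

theorem sqrtCard_sq : sqrtCard k ^ 2 = Nat.card k := by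
  unfold sqrtCard
  norm_cast
  rw [Real.sq_sqrt (by positivity)]

variable [hfin : ∀ X Y : 𝒜, Module.Finite k (X ⟶ Y)]

include hfin in
theorem finite_hom (X Y : 𝒜) : Finite (X ⟶ Y) := Module.finite_of_finite k

include hfin in
theorem natCard_hom (X Y : 𝒜) : (Nat.card (X ⟶ Y) : ℂ) = sqrtCard k ^ (2 * hd k X Y) := by
  rw [Module.natCard_eq_pow_finrank (K := k), zpow_mul, hd, zpow_natCast]
  push_cast
  rw [← sqrtCard_sq]
  norm_cast

include hfin in
theorem finite_cocycles (M N : C2 𝒜) : Finite (cocycles M N) := by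
  have := finite_hom k (M.X 0) (N.X 1)
  have := finite_hom k (M.X 1) (N.X 0)
  infer_instance

/-- The closed even elements of the complex of homomorphisms are the morphisms of complexes. -/
def kerCoboundaryEquiv (M N : C2 𝒜) : (coboundary M N).ker ≃ (M ⟶ N) where
  toFun s := C2.homMk s.1.2 s.1.1
    (sub_eq_zero.1 (congrArg (fun x : cocycles M N => x.1.2) s.2))
    (sub_eq_zero.1 (congrArg (fun x : cocycles M N => x.1.1) s.2))
  invFun f := ⟨(f.f 0, f.f 1), Subtype.ext (Prod.ext (sub_eq_zero.2 (f.comm 0 1))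
    (sub_eq_zero.2 (f.comm 1 0)))⟩
  left_inv _ := rfl
  right_inv _ := C2.hom_ext rfl rfl

-- Rank-nullity for the coboundary map, whose kernel is the set of morphisms of complexes. The left
-- side is exactly the denominator in the product formula.
include hfin in
theorem natCard_range_coboundary (M N : C2 𝒜) :
    (Nat.card (coboundary M N).range : ℂ) * Nat.card (M ⟶ N) =
      sqrtCard k ^ (2 * (hd k (M.X 0) (N.X 0) + hd k (M.X 1) (N.X 1))) := by
  rw [← Nat.card_congr (kerCoboundaryEquiv M N), mul_add,
    zpow_add₀ (sqrtCard_ne_zero k), ← natCard_hom, ← natCard_hom]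
  norm_cast
  rw [← Nat.card_prod (M.X 0 ⟶ N.X 0), AddSubgroup.card_eq_card_quotient_mul_card_addSubgroup
    (coboundary M N).ker,
    Nat.card_congr (QuotientAddGroup.quotientKerEquivRange (coboundary M N)).toEquiv]

variable (𝒜) in
/-- The class of a complex of projectives in the twisted Hall algebra. -/
abbrev hcls {M : C2 𝒜} (hM : isProj 𝒜 M) : HallTwC2 k 𝒜 :=
  TwHall.cls (isProj 𝒜) (sqrtCard k) (eulerC2 k) M hM

/-- The product of two classes of complexes of projectives as a sum over odd cocycles. -/
theorem hcls_mul_hcls {M N : C2 𝒜} (hM : isProj 𝒜 M) (hN : isProj 𝒜 N) :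
    hcls k 𝒜 hM * hcls k 𝒜 hN =
      (sqrtCard k ^ (hd k (M.X 0) (N.X 0) + hd k (M.X 1) (N.X 1)))⁻¹ •
        ∑ᶠ h : cocycles M N, hcls k 𝒜 (isProj_cone hM hN h) := by
  have := finite_cocycles k M N
  have ht := sqrtCard_ne_zero k
  rw [TwHall.cls_mul_cls hM hN (Z := cocycles M N) ?_ (fun h => cone h) (isProj_cone hM hN)
    cocycleClass ?_ (Nat.card (coboundary M N).range) Nat.card_pos.ne' ?_]
  · congr 1
    -- The twist contributes exponent `χ` and the denominator `-2χ`, leaving `-χ`.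
    rw [natCard_range_coboundary k, eulerC2_eq_hd k hM, ← zpow_neg, ← zpow_neg, ← zpow_add₀ ht]
    congr 1
    ring
  · rintro A' C' ⟨a⟩ ⟨c⟩
    have hA' : isProj 𝒜 A' := fun i => Projective.of_iso
      (C2.evalIso a.symm i) (hM i)
    rw [eulerC2_eq_hd k hM, eulerC2_eq_hd k hA',
      hd_congr k (C2.evalIso a 0) (C2.evalIso c 0), hd_congr k (C2.evalIso a 1) (C2.evalIso c 1)]
  · exact fun h => ⟨_, _, _, shortExact_cone h, rfl⟩
  · intro ξ
    -- Each fibre is a coset of the group of coboundaries.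
    obtain ⟨h₀, rfl⟩ := cocycleClass_surjective hM ξ
    refine Nat.card_congr
      { toFun h := ⟨h.1 - h₀, sub_mem_of_cocycleClass_eq h.2⟩
        invFun s := ⟨s.1 + h₀, cocycleClass_eq_of_sub_mem (by
          rw [add_sub_cancel_right]; exact s.2)⟩
        left_inv h := by simp
        right_inv s := by simp }

end HallProduct

/-! ### Bilinearity and reduction to classes of objects -/

section Scalars

variable {𝒞 : Type u} [Category.{v} 𝒞] [Abelian 𝒞] (P : ObjectProperty 𝒞) (t : ℂ)
  (χ : 𝒞 → 𝒞 → ℤ)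

instance : IsScalarTower ℂ (TwHall P t χ) (TwHall P t χ) where
  smul_assoc c x y := by
    change TwHall.mulHom P t χ (c • x) y = c • TwHall.mulHom P t χ x y
    rw [map_smul, LinearMap.smul_apply]

instance : SMulCommClass ℂ (TwHall P t χ) (TwHall P t χ) where
  smul_comm c x y := by
    change c • TwHall.mulHom P t χ x y = TwHall.mulHom P t χ x (c • y)
    rw [map_smul]

variable {P t χ} in
/-- To prove a property of all elements of a Hall algebra, it is enough to prove it for classes of
objects. -/
theorem TwHall.induction {p : TwHall P t χ → Prop} (zero : p 0)
    (add : ∀ x y, p x → p y → p (x + y)) (smul : ∀ (c : ℂ) x, p x → p (c • x))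
    (cls : ∀ A hA, p (TwHall.cls P t χ A hA)) (x : TwHall P t χ) : p x := by
  have hx : x ∈ Submodule.span ℂ (Set.range (TwHall.basis P t χ)) := by
    rw [Module.Basis.span_eq]
    trivial
  induction hx using Submodule.span_induction with
  | mem x h =>
    obtain ⟨a, rfl⟩ := h
    rw [basis_eq_cls]
    exact cls _ _
  | zero => exact zero
  | add x y _ _ hx hy => exact add x y hx hy
  | smul c x _ hx => exact smul c x hx

end Scalars

/-! ### Associativity and unit in the Hall algebra of complexes -/

section Associativity

variable (k : Type w) [Field k] [Finite k] {𝒜 : Type u} [Category.{v} 𝒜] [Abelian 𝒜] [Linear k 𝒜]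
  [hfin : ∀ X Y : 𝒜, Module.Finite k (X ⟶ Y)]

omit [Finite k] in
include hfin in
theorem hd_biprod_left (X X' Y : 𝒜) : hd k (X ⊞ X') Y = hd k X Y + hd k X' Y := by
  let e : (X ⊞ X' ⟶ Y) ≃ₗ[k] (X ⟶ Y) × (X' ⟶ Y) :=
    { toFun f := (biprod.inl ≫ f, biprod.inr ≫ f)
      invFun f := biprod.desc f.1 f.2
      left_inv f := by ext <;> simp
      right_inv f := by simp
      map_add' f g := by simp
      map_smul' c f := by simp }
  rw [hd, e.finrank_eq, Module.finrank_prod]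
  rfl

omit [Finite k] in
include hfin in
theorem hd_biprod_right (X Y Y' : 𝒜) : hd k X (Y ⊞ Y') = hd k X Y + hd k X Y' := by
  let e : (X ⟶ Y ⊞ Y') ≃ₗ[k] (X ⟶ Y) × (X ⟶ Y') :=
    { toFun f := (f ≫ biprod.fst, f ≫ biprod.snd)
      invFun f := biprod.lift f.1 f.2
      left_inv f := by ext <;> simp
      right_inv f := by simp
      map_add' f g := by simp
      map_smul' c f := by simp }
  rw [hd, e.finrank_eq, Module.finrank_prod]
  rfl

section Triples

omit k

variable (L M N : C2 𝒜)

variable {L M N} in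
/-- An odd cocycle on an extension of complexes. -/
def cocycleOfCone (h : cocycles L M) (G₀ : M.X 0 ⊞ L.X 0 ⟶ N.X 1) (G₁ : M.X 1 ⊞ L.X 1 ⟶ N.X 0)
    (r₁ : G₁ ≫ N.d 0 1 + (biprod.map (M.d 1 0) (L.d 1 0) +
      biprod.snd ≫ h.1.2 ≫ biprod.inl) ≫ G₀ = 0)
    (r₀ : G₀ ≫ N.d 1 0 + (biprod.map (M.d 0 1) (L.d 0 1) +
      biprod.snd ≫ h.1.1 ≫ biprod.inl) ≫ G₁ = 0) : cocycles (cone h) N :=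
  ⟨(G₀, G₁), r₁, r₀⟩

variable {L M N} in
/-- An odd cocycle with values in an extension of complexes. -/
def cocycleToCone (g : cocycles M N) (H₀ : L.X 0 ⟶ N.X 1 ⊞ M.X 1) (H₁ : L.X 1 ⟶ N.X 0 ⊞ M.X 0)
    (r₁ : H₁ ≫ (biprod.map (N.d 0 1) (M.d 0 1) + biprod.snd ≫ g.1.1 ≫ biprod.inl) +
      L.d 1 0 ≫ H₀ = 0)
    (r₀ : H₀ ≫ (biprod.map (N.d 1 0) (M.d 1 0) + biprod.snd ≫ g.1.2 ≫ biprod.inl) +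
      L.d 0 1 ≫ H₁ = 0) : cocycles L (cone g) :=
  ⟨(H₀, H₁), r₁, r₀⟩

/-- The strictly upper triangular twists of the differential of the sum of three complexes. -/
def Triples : Type v :=
  {x : cocycles L M × cocycles M N × ((L.X 0 ⟶ N.X 1) × (L.X 1 ⟶ N.X 0)) //
    x.2.2.2 ≫ N.d 0 1 + x.1.1.2 ≫ x.2.1.1.1 + L.d 1 0 ≫ x.2.2.1 = 0 ∧
    x.2.2.1 ≫ N.d 1 0 + x.1.1.1 ≫ x.2.1.1.2 + L.d 0 1 ≫ x.2.2.2 = 0}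

/-- Successive extensions bracketed to the left are triangular twists. -/
def sigmaConeLeftEquiv : (Σ h : cocycles L M, cocycles (cone h) N) ≃ Triples L M N where
  toFun x :=
    let h := x.1
    let G₀ : M.X 0 ⊞ L.X 0 ⟶ N.X 1 := x.2.1.1
    let G₁ : M.X 1 ⊞ L.X 1 ⟶ N.X 0 := x.2.1.2
    have r₁ : G₁ ≫ N.d 0 1 + (biprod.map (M.d 1 0) (L.d 1 0) +
      biprod.snd ≫ h.1.2 ≫ biprod.inl) ≫ G₀ = 0 := cocycles_rel₁ x.2
    have r₀ : G₀ ≫ N.d 1 0 + (biprod.map (M.d 0 1) (L.d 0 1) +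
      biprod.snd ≫ h.1.1 ≫ biprod.inl) ≫ G₁ = 0 := cocycles_rel₀ x.2
    ⟨(h, ⟨(biprod.inl ≫ G₀, biprod.inl ≫ G₁),
      by simpa using congrArg (fun f => biprod.inl ≫ f) r₁,
      by simpa using congrArg (fun f => biprod.inl ≫ f) r₀⟩,
      (biprod.inr ≫ G₀, biprod.inr ≫ G₁)),
      by
        have := congrArg (fun f => biprod.inr ≫ f) r₁
        simp at this
        simp only [Category.assoc]
        rw [← this]
        abel,
      by
        have := congrArg (fun f => biprod.inr ≫ f) r₀
        simp at this
        simp only [Category.assoc]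
        rw [← this]
        abel⟩
  invFun x := ⟨x.1.1, cocycleOfCone x.1.1 (biprod.desc x.1.2.1.1.1 x.1.2.2.1)
    (biprod.desc x.1.2.1.1.2 x.1.2.2.2)
    (by
      ext
      · simpa using cocycles_rel₁ x.1.2.1
      · rw [Limits.comp_zero]
        refine Eq.trans ?_ x.2.1
        simp
        abel)
    (by
      ext
      · simpa using cocycles_rel₀ x.1.2.1
      · rw [Limits.comp_zero]
        refine Eq.trans ?_ x.2.2
        simp
        abel)⟩
  left_inv x := by
    refine Sigma.ext rfl (heq_of_eq (Subtype.ext (Prod.ext ?_ ?_)))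
    · exact biprod.hom_ext' _ _ (biprod.inl_desc _ _) (biprod.inr_desc _ _)
    · exact biprod.hom_ext' _ _ (biprod.inl_desc _ _) (biprod.inr_desc _ _)
  right_inv x := by
    refine Subtype.ext (Prod.ext rfl (Prod.ext (Subtype.ext (Prod.ext ?_ ?_)) (Prod.ext ?_ ?_)))
    exacts [biprod.inl_desc _ _, biprod.inl_desc _ _, biprod.inr_desc _ _, biprod.inr_desc _ _]

/-- Successive extensions bracketed to the right are triangular twists. -/
def sigmaConeRightEquiv : (Σ g : cocycles M N, cocycles L (cone g)) ≃ Triples L M N where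
  toFun x :=
    let g := x.1
    let H₀ : L.X 0 ⟶ N.X 1 ⊞ M.X 1 := x.2.1.1
    let H₁ : L.X 1 ⟶ N.X 0 ⊞ M.X 0 := x.2.1.2
    have r₁ : H₁ ≫ (biprod.map (N.d 0 1) (M.d 0 1) + biprod.snd ≫ g.1.1 ≫ biprod.inl) +
      L.d 1 0 ≫ H₀ = 0 := cocycles_rel₁ x.2
    have r₀ : H₀ ≫ (biprod.map (N.d 1 0) (M.d 1 0) + biprod.snd ≫ g.1.2 ≫ biprod.inl) +
      L.d 0 1 ≫ H₁ = 0 := cocycles_rel₀ x.2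
    ⟨(⟨(H₀ ≫ biprod.snd, H₁ ≫ biprod.snd),
      by simpa using congrArg (fun f => f ≫ biprod.snd) r₁,
      by simpa using congrArg (fun f => f ≫ biprod.snd) r₀⟩, g,
      (H₀ ≫ biprod.fst, H₁ ≫ biprod.fst)),
      by simpa using congrArg (fun f => f ≫ biprod.fst) r₁,
      by simpa using congrArg (fun f => f ≫ biprod.fst) r₀⟩
  invFun x := ⟨x.1.2.1, cocycleToCone x.1.2.1 (biprod.lift x.1.2.2.1 x.1.1.1.1)
    (biprod.lift x.1.2.2.2 x.1.1.1.2)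
    (by
      ext
      · simpa using x.2.1
      · simpa using cocycles_rel₁ x.1.1)
    (by
      ext
      · simpa using x.2.2
      · simpa using cocycles_rel₀ x.1.1)⟩
  left_inv x := by
    refine Sigma.ext rfl (heq_of_eq (Subtype.ext (Prod.ext ?_ ?_)))
    · exact biprod.hom_ext _ _ (biprod.lift_fst _ _) (biprod.lift_snd _ _)
    · exact biprod.hom_ext _ _ (biprod.lift_fst _ _) (biprod.lift_snd _ _)
  right_inv x := by
    refine Subtype.ext (Prod.ext (Subtype.ext (Prod.ext ?_ ?_)) (Prod.ext rfl (Prod.ext ?_ ?_)))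
    exacts [biprod.lift_snd _ _, biprod.lift_snd _ _, biprod.lift_fst _ _, biprod.lift_fst _ _]

/-- The total complexes of a triangular twist for the two bracketings are isomorphic. -/
def coneAssoc (x : Triples L M N) : cone ((sigmaConeLeftEquiv L M N).symm x).2 ≅
    cone ((sigmaConeRightEquiv L M N).symm x).2 :=
  C2.mkIso (biprod.associator (N.X 1) (M.X 1) (L.X 1)).symm
    (biprod.associator (N.X 0) (M.X 0) (L.X 0)).symm
    (by
      have key : (biprod.associator (N.X 1) (M.X 1) (L.X 1)).inv ≫
          (biprod.map (biprod.map (N.d 1 0) (M.d 1 0) +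
            biprod.snd ≫ x.1.2.1.1.2 ≫ biprod.inl) (L.d 1 0) +
            biprod.snd ≫ biprod.lift x.1.2.2.2 x.1.1.1.2 ≫ biprod.inl) =
          (biprod.map (N.d 1 0) (biprod.map (M.d 1 0) (L.d 1 0) +
            biprod.snd ≫ x.1.1.1.2 ≫ biprod.inl) +
            biprod.snd ≫ biprod.desc x.1.2.1.1.2 x.1.2.2.2 ≫ biprod.inl) ≫
          (biprod.associator (N.X 0) (M.X 0) (L.X 0)).inv := by
        ext <;> simp
      exact key)
    (by
      have key : (biprod.associator (N.X 0) (M.X 0) (L.X 0)).inv ≫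
          (biprod.map (biprod.map (N.d 0 1) (M.d 0 1) +
            biprod.snd ≫ x.1.2.1.1.1 ≫ biprod.inl) (L.d 0 1) +
            biprod.snd ≫ biprod.lift x.1.2.2.1 x.1.1.1.1 ≫ biprod.inl) =
          (biprod.map (N.d 0 1) (biprod.map (M.d 0 1) (L.d 0 1) +
            biprod.snd ≫ x.1.1.1.1 ≫ biprod.inl) +
            biprod.snd ≫ biprod.desc x.1.2.1.1.1 x.1.2.2.1 ≫ biprod.inl) ≫
          (biprod.associator (N.X 1) (M.X 1) (L.X 1)).inv := by
        ext <;> simp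
      exact key)

end Triples

/-- Both bracketings sum over the strictly upper triangular twists of the differential on `N ⊕ M ⊕
L`, with isomorphic total complexes by `coneAssoc`; the exponents agree because `hd` is additive in
direct sums. -/
theorem hcls_mul_assoc {L M N : C2 𝒜} (hL : isProj 𝒜 L) (hM : isProj 𝒜 M) (hN : isProj 𝒜 N) :
    hcls k 𝒜 hL * hcls k 𝒜 hM * hcls k 𝒜 hN = hcls k 𝒜 hL * (hcls k 𝒜 hM * hcls k 𝒜 hN) := by
  have := finite_cocycles k L M
  have := finite_cocycles k M N
  have := fun h : cocycles L M => finite_cocycles k (cone h) N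
  have := fun g : cocycles M N => finite_cocycles k L (cone g)
  have := Fintype.ofFinite (cocycles L M)
  have := Fintype.ofFinite (cocycles M N)
  have := fun h : cocycles L M => Fintype.ofFinite (cocycles (cone h) N)
  have := fun g : cocycles M N => Fintype.ofFinite (cocycles L (cone g))
  have ht := sqrtCard_ne_zero k
  have left : ∀ h : cocycles L M, hcls k 𝒜 (isProj_cone hL hM h) * hcls k 𝒜 hN =
      (sqrtCard k ^ (hd k (M.X 0) (N.X 0) + hd k (L.X 0) (N.X 0) +
        (hd k (M.X 1) (N.X 1) + hd k (L.X 1) (N.X 1))))⁻¹ •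
      ∑ G : cocycles (cone h) N, hcls k 𝒜 (isProj_cone (isProj_cone hL hM h) hN G) := by
    intro h
    rw [hcls_mul_hcls, finsum_eq_sum_of_fintype, ← hd_biprod_left, ← hd_biprod_left]
    rfl
  have right : ∀ g : cocycles M N, hcls k 𝒜 hL * hcls k 𝒜 (isProj_cone hM hN g) =
      (sqrtCard k ^ (hd k (L.X 0) (N.X 0) + hd k (L.X 0) (M.X 0) +
        (hd k (L.X 1) (N.X 1) + hd k (L.X 1) (M.X 1))))⁻¹ •
      ∑ H : cocycles L (cone g), hcls k 𝒜 (isProj_cone hL (isProj_cone hM hN g) H) := by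
    intro g
    rw [hcls_mul_hcls, finsum_eq_sum_of_fintype, ← hd_biprod_right, ← hd_biprod_right]
    rfl
  rw [hcls_mul_hcls k hL hM, hcls_mul_hcls k hM hN, finsum_eq_sum_of_fintype,
    finsum_eq_sum_of_fintype, smul_mul_assoc, mul_smul_comm, Finset.sum_mul, Finset.mul_sum,
    Finset.sum_congr rfl fun h _ => left h, Finset.sum_congr rfl fun g _ => right g,
    ← Finset.smul_sum, ← Finset.smul_sum, smul_smul, smul_smul, Finset.sum_sigma',
    Finset.sum_sigma']
  congr 1
  · rw [← mul_inv, ← mul_inv, ← zpow_add₀ ht, ← zpow_add₀ ht]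
    congr 2
    ring
  · rw [Finset.univ_sigma_univ, Finset.univ_sigma_univ]
    refine Fintype.sum_equiv ((sigmaConeLeftEquiv L M N).trans (sigmaConeRightEquiv L M N).symm)
      _ _ fun x => ?_
    obtain ⟨y, rfl⟩ := (sigmaConeLeftEquiv L M N).symm.surjective x
    rw [Equiv.trans_apply, Equiv.apply_symm_apply]
    exact TwHall.cls_congr _ _ (coneAssoc L M N y)

theorem hall_mul_assoc (x y z : HallTwC2 k 𝒜) : x * y * z = x * (y * z) := by
  induction x using TwHall.induction with
  | zero => simp
  | add x x' hx hx' => simp only [add_mul, hx, hx']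
  | smul c x hx => simp only [smul_mul_assoc, hx]
  | cls A hA =>
    induction y using TwHall.induction with
    | zero => simp
    | add x x' hx hx' => simp only [add_mul, mul_add, hx, hx']
    | smul c x hx => simp only [smul_mul_assoc, mul_smul_comm, hx]
    | cls B hB =>
      induction z using TwHall.induction with
      | zero => simp
      | add x x' hx hx' => simp only [mul_add, hx, hx']
      | smul c x hx => simp only [mul_smul_comm, hx]
      | cls C hC => exact hcls_mul_assoc k hA hB hC

/-- The direct sum of two complexes. -/
def dsum (M N : C2 𝒜) : C2 𝒜 :=
  C2.mk (biprod.map (M.d 1 0) (N.d 1 0)) (biprod.map (M.d 0 1) (N.d 0 1))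
    (by ext <;> simp) (by ext <;> simp)

theorem isProj_dsum {M N : C2 𝒜} (hM : isProj 𝒜 M) (hN : isProj 𝒜 N) : isProj 𝒜 (dsum M N) := by
  have := hM 0
  have := hM 1
  have := hN 0
  have := hN 1
  exact isProj_mk _ _ _ _ inferInstance inferInstance

/-- A trivial twist gives a direct sum. -/
def coneIsoDsum {M N : C2 𝒜} (h : cocycles M N) (s₀ : M.X 0 ⟶ N.X 0) (s₁ : M.X 1 ⟶ N.X 1)
    (e₁ : h.1.1 = s₀ ≫ N.d 0 1 - M.d 0 1 ≫ s₁) (e₂ : h.1.2 = s₁ ≫ N.d 1 0 - M.d 1 0 ≫ s₀) :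
    cone h ≅ dsum N M :=
  C2.mkIso
    { hom := 𝟙 _ + biprod.snd ≫ s₁ ≫ biprod.inl
      inv := 𝟙 _ - biprod.snd ≫ s₁ ≫ biprod.inl
      hom_inv_id := by ext <;> simp
      inv_hom_id := by ext <;> simp }
    { hom := 𝟙 _ + biprod.snd ≫ s₀ ≫ biprod.inl
      inv := 𝟙 _ - biprod.snd ≫ s₀ ≫ biprod.inl
      hom_inv_id := by ext <;> simp
      inv_hom_id := by ext <;> simp }
    (by ext <;> simp [e₂])
    (by ext <;> simp [e₁])

/-- Direct sums of complexes commute. -/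
def dsumComm (M N : C2 𝒜) : dsum M N ≅ dsum N M :=
  C2.mkIso (biprod.braiding _ _) (biprod.braiding _ _) (by ext <;> simp) (by ext <;> simp)

/-- A zero summand can be dropped. -/
def dsumZero (M : C2 𝒜) {Z : C2 𝒜} (h₀ : IsZero (Z.X 0)) (h₁ : IsZero (Z.X 1)) : dsum M Z ≅ M :=
  (C2.isoToMk
    { hom := biprod.inl
      inv := biprod.fst
      hom_inv_id := by simp
      inv_hom_id := by
        ext
        · simp
        · simp
        · exact h₁.eq_of_src _ _
        · exact h₁.eq_of_src _ _ }
    { hom := biprod.inl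
      inv := biprod.fst
      hom_inv_id := by simp
      inv_hom_id := by
        ext
        · simp
        · simp
        · exact h₀.eq_of_src _ _
        · exact h₀.eq_of_src _ _ }
    (by simp) (by simp)).symm

/-- Used for products with contractible complexes, where all cocycles are coboundaries and only the
number of cocycles has to be found. -/
theorem hcls_mul_hcls_of_split {M N L : C2 𝒜} (hM : isProj 𝒜 M) (hN : isProj 𝒜 N)
    (hL : isProj 𝒜 L) (e : ∀ h : cocycles M N, Nonempty (cone h ≅ L)) :
    hcls k 𝒜 hM * hcls k 𝒜 hN =
      ((sqrtCard k ^ (hd k (M.X 0) (N.X 0) + hd k (M.X 1) (N.X 1)))⁻¹ *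
        (Nat.card (cocycles M N) : ℂ)) • hcls k 𝒜 hL := by
  have := finite_cocycles k M N
  have := Fintype.ofFinite (cocycles M N)
  rw [hcls_mul_hcls k hM hN, finsum_eq_sum_of_fintype,
    Finset.sum_congr rfl fun h _ => TwHall.cls_congr _ hL (e h).some, Finset.sum_const,
    Finset.card_univ, ← Nat.card_eq_fintype_card, ← Nat.cast_smul_eq_nsmul ℂ, smul_smul]

omit [Finite k] hfin in
theorem hd_zero_left {X : 𝒜} (hX : IsZero X) (Y : 𝒜) : hd k X Y = 0 := by
  have : Subsingleton (X ⟶ Y) := ⟨fun f g => hX.eq_of_src f g⟩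
  rw [hd, Module.finrank_zero_of_subsingleton]
  rfl

omit [Finite k] hfin in
theorem hd_zero_right (X : 𝒜) {Y : 𝒜} (hY : IsZero Y) : hd k X Y = 0 := by
  have : Subsingleton (X ⟶ Y) := ⟨fun f g => hY.eq_of_tgt f g⟩
  rw [hd, Module.finrank_zero_of_subsingleton]
  rfl

theorem hcls_zero_mul {Z N : C2 𝒜} (hZ : isProj 𝒜 Z) (hN : isProj 𝒜 N) (h₀ : IsZero (Z.X 0))
    (h₁ : IsZero (Z.X 1)) : hcls k 𝒜 hZ * hcls k 𝒜 hN = hcls k 𝒜 hN := by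
  have : Subsingleton (cocycles Z N) := ⟨fun a b => Subtype.ext
    (Prod.ext (h₀.eq_of_src _ _) (h₁.eq_of_src _ _))⟩
  rw [hcls_mul_hcls_of_split k hZ hN hN fun h => ⟨coneIsoDsum h 0 0 (h₀.eq_of_src _ _)
    (h₁.eq_of_src _ _) ≪≫ dsumZero N h₀ h₁⟩, hd_zero_left k h₀, hd_zero_left k h₁]
  simp

theorem hcls_mul_zero {Z N : C2 𝒜} (hZ : isProj 𝒜 Z) (hN : isProj 𝒜 N) (h₀ : IsZero (Z.X 0))
    (h₁ : IsZero (Z.X 1)) : hcls k 𝒜 hN * hcls k 𝒜 hZ = hcls k 𝒜 hN := by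
  have : Subsingleton (cocycles N Z) := ⟨fun a b => Subtype.ext
    (Prod.ext (h₁.eq_of_tgt _ _) (h₀.eq_of_tgt _ _))⟩
  rw [hcls_mul_hcls_of_split k hN hZ hN fun h => ⟨coneIsoDsum h 0 0 (h₁.eq_of_tgt _ _)
    (h₀.eq_of_tgt _ _) ≪≫ dsumComm _ _ ≪≫ dsumZero N h₀ h₁⟩, hd_zero_right k _ h₀,
    hd_zero_right k _ h₁]
  simp

omit [Finite k] hfin in
theorem hall_one_eq {Z : C2 𝒜} (hZ : isProj 𝒜 Z) (h : IsZero Z) :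
    (1 : HallTwC2 k 𝒜) = hcls k 𝒜 hZ := by
  have h0 : IsZero (0 : (isProj 𝒜).FullSubcategory) := isZero_zero _
  have h0' : IsZero (0 : (isProj 𝒜).FullSubcategory).obj := by
    rw [IsZero.iff_id_eq_zero] at h0 ⊢
    exact congrArg (isProj 𝒜).ι.map h0
  exact TwHall.cls_congr (0 : (isProj 𝒜).FullSubcategory).property hZ (h0'.iso h)

omit [Finite k] [Linear k 𝒜] hfin in
theorem isZero_X {Z : C2 𝒜} (h : IsZero Z) (i : ZMod 2) : IsZero (Z.X i) :=
  (HomologicalComplex.eval 𝒜 (ComplexShape.up (ZMod 2)) i).map_isZero h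

omit [Finite k] [Linear k 𝒜] hfin in
theorem C2.isZero {Z : C2 𝒜} (h₀ : IsZero (Z.X 0)) (h₁ : IsZero (Z.X 1)) : IsZero Z := by
  rw [IsZero.iff_id_eq_zero]
  exact C2.hom_ext (h₀.eq_of_src _ _) (h₁.eq_of_src _ _)

theorem hall_one_mul (x : HallTwC2 k 𝒜) : 1 * x = x := by
  have hz : IsZero (0 : C2 𝒜) := isZero_zero _
  have hZ : isProj 𝒜 0 := fun i => (isZero_X hz i).projective
  induction x using TwHall.induction with
  | zero => simp
  | add x x' hx hx' => simp only [mul_add, hx, hx']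
  | smul c x hx => simp only [mul_smul_comm, hx]
  | cls A hA =>
    rw [hall_one_eq k hZ hz]
    exact hcls_zero_mul k hZ hA (isZero_X hz 0) (isZero_X hz 1)

theorem hall_mul_one (x : HallTwC2 k 𝒜) : x * 1 = x := by
  have hz : IsZero (0 : C2 𝒜) := isZero_zero _
  have hZ : isProj 𝒜 0 := fun i => (isZero_X hz i).projective
  induction x using TwHall.induction with
  | zero => simp
  | add x x' hx hx' => simp only [add_mul, hx, hx']
  | smul c x hx => simp only [smul_mul_assoc, hx]
  | cls A hA =>
    rw [hall_one_eq k hZ hz]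
    exact hcls_mul_zero k hZ hA (isZero_X hz 0) (isZero_X hz 1)

end Associativity

/-! ### Products with the contractible complexes `K_P` and `K_P^*` -/

section AcyclicProducts

variable (k : Type w) [Field k] [Finite k] {𝒜 : Type u} [Category.{v} 𝒜] [Abelian 𝒜] [Linear k 𝒜]
  [hfin : ∀ X Y : 𝒜, Module.Finite k (X ⟶ Y)]

omit [Finite k] [Linear k 𝒜] hfin in
theorem isProj_complexK (P : 𝒜) [hP : Projective P] : isProj 𝒜 (complexK P) :=
  isProj_mk _ _ _ _ hP hP

omit [Finite k] [Linear k 𝒜] hfin in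
theorem isProj_complexKStar (P : 𝒜) [hP : Projective P] : isProj 𝒜 (complexKStar P) :=
  isProj_mk _ _ _ _ hP hP

section Cocycles

omit k

variable (P : 𝒜) (N : C2 𝒜)

theorem complexK_cocycle_rel (h : cocycles (complexK P) N) :
    (show P ⟶ N.X 1 from h.1.1) = -((show P ⟶ N.X 0 from h.1.2) ≫ N.d 0 1) := by
  have := cocycles_rel₁ h
  change (show P ⟶ N.X 0 from h.1.2) ≫ N.d 0 1 + 𝟙 P ≫ (show P ⟶ N.X 1 from h.1.1) = 0 at this
  rw [Category.id_comp] at this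
  exact eq_neg_of_add_eq_zero_right this

theorem cocycle_complexK_rel (h : cocycles N (complexK P)) :
    (show N.X 0 ⟶ P from h.1.1) = -(N.d 0 1 ≫ (show N.X 1 ⟶ P from h.1.2)) := by
  have := cocycles_rel₀ h
  change (show N.X 0 ⟶ P from h.1.1) ≫ 𝟙 P + N.d 0 1 ≫ (show N.X 1 ⟶ P from h.1.2) = 0 at this
  rw [Category.comp_id] at this
  exact eq_neg_of_add_eq_zero_left this

theorem complexKStar_cocycle_rel (h : cocycles (complexKStar P) N) :
    (show P ⟶ N.X 0 from h.1.2) = -((show P ⟶ N.X 1 from h.1.1) ≫ N.d 1 0) := by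
  have := cocycles_rel₀ h
  change (show P ⟶ N.X 1 from h.1.1) ≫ N.d 1 0 + 𝟙 P ≫ (show P ⟶ N.X 0 from h.1.2) = 0 at this
  rw [Category.id_comp] at this
  exact eq_neg_of_add_eq_zero_right this

theorem cocycle_complexKStar_rel (h : cocycles N (complexKStar P)) :
    (show N.X 1 ⟶ P from h.1.2) = -(N.d 1 0 ≫ (show N.X 0 ⟶ P from h.1.1)) := by
  have := cocycles_rel₁ h
  change (show N.X 1 ⟶ P from h.1.2) ≫ 𝟙 P + N.d 1 0 ≫ (show N.X 0 ⟶ P from h.1.1) = 0 at this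
  rw [Category.comp_id] at this
  exact eq_neg_of_add_eq_zero_left this

/-- Odd cocycles from `K_P` are determined by one component. -/
def complexKCocycleEquiv : cocycles (complexK P) N ≃ (P ⟶ N.X 0) where
  toFun h := h.1.2
  invFun f := ⟨((show P ⟶ N.X 1 from -(f ≫ N.d 0 1)), f),
    (show f ≫ N.d 0 1 + 𝟙 P ≫ (-(f ≫ N.d 0 1)) = 0 by simp),
    (show (-(f ≫ N.d 0 1)) ≫ N.d 1 0 + (0 : P ⟶ P) ≫ f = 0 by simp)⟩
  left_inv h := Subtype.ext (Prod.ext (complexK_cocycle_rel P N h).symm rfl)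
  right_inv _ := rfl

/-- Odd cocycles with values in `K_P` are determined by one component. -/
def cocycleComplexKEquiv : cocycles N (complexK P) ≃ (N.X 1 ⟶ P) where
  toFun h := h.1.2
  invFun f := ⟨((show N.X 0 ⟶ P from -(N.d 0 1 ≫ f)), f),
    (show f ≫ (0 : P ⟶ P) + N.d 1 0 ≫ (-(N.d 0 1 ≫ f)) = 0 by simp),
    (show (-(N.d 0 1 ≫ f)) ≫ 𝟙 P + N.d 0 1 ≫ f = 0 by simp)⟩
  left_inv h := Subtype.ext (Prod.ext (cocycle_complexK_rel P N h).symm rfl)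
  right_inv _ := rfl

/-- Odd cocycles from `K_P^*` are determined by one component. -/
def complexKStarCocycleEquiv : cocycles (complexKStar P) N ≃ (P ⟶ N.X 1) where
  toFun h := h.1.1
  invFun f := ⟨(f, (show P ⟶ N.X 0 from -(f ≫ N.d 1 0))),
    (show (-(f ≫ N.d 1 0)) ≫ N.d 0 1 + (0 : P ⟶ P) ≫ f = 0 by simp),
    (show f ≫ N.d 1 0 + 𝟙 P ≫ (-(f ≫ N.d 1 0)) = 0 by simp)⟩
  left_inv h := Subtype.ext (Prod.ext rfl (complexKStar_cocycle_rel P N h).symm)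
  right_inv _ := rfl

/-- Odd cocycles with values in `K_P^*` are determined by one component. -/
def cocycleComplexKStarEquiv : cocycles N (complexKStar P) ≃ (N.X 0 ⟶ P) where
  toFun h := h.1.1
  invFun f := ⟨(f, (show N.X 1 ⟶ P from -(N.d 1 0 ≫ f))),
    (show (-(N.d 1 0 ≫ f)) ≫ 𝟙 P + N.d 1 0 ≫ f = 0 by simp),
    (show f ≫ (0 : P ⟶ P) + N.d 0 1 ≫ (-(N.d 1 0 ≫ f)) = 0 by simp)⟩
  left_inv h := Subtype.ext (Prod.ext rfl (cocycle_complexKStar_rel P N h).symm)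
  right_inv _ := rfl

end Cocycles

variable (P : 𝒜) [Projective P] {N : C2 𝒜} (hN : isProj 𝒜 N)

/-- A cocycle out of `K_P` is given freely by a map `P ⟶ N₀` and is always a coboundary, so every
extension splits. The exponent is `2 hd(P, N₀)` from the count minus `hd(P, N₀) + hd(P, N₁)` from
the product formula. The three companion statements are analogous. -/
theorem hcls_complexK_mul : hcls k 𝒜 (isProj_complexK P) * hcls k 𝒜 hN =
    sqrtCard k ^ (hd k P (N.X 0) - hd k P (N.X 1)) •
      hcls k 𝒜 (isProj_dsum (isProj_complexK P) hN) := by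
  have ht := sqrtCard_ne_zero k
  rw [hcls_mul_hcls_of_split k (isProj_complexK P) hN (isProj_dsum (isProj_complexK P) hN),
    Nat.card_congr (complexKCocycleEquiv P N), natCard_hom k, ← zpow_neg, ← zpow_add₀ ht]
  · congr 2
    change -(hd k P (N.X 0) + hd k P (N.X 1)) + _ = _
    ring
  · intro h
    refine ⟨coneIsoDsum h (show P ⟶ N.X 0 from -h.1.2) (0 : P ⟶ N.X 1) ?_ ?_ ≪≫ dsumComm _ _⟩
    · refine (complexK_cocycle_rel P N h).trans ?_
      have key : ∀ x : P ⟶ N.X 0, -(x ≫ N.d 0 1) = (-x) ≫ N.d 0 1 - (0 : P ⟶ P) ≫ 0 :=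
        fun x => by simp
      exact key _
    · have key : ∀ x : P ⟶ N.X 0, x = (0 : P ⟶ N.X 1) ≫ N.d 1 0 - 𝟙 P ≫ (-x) :=
        fun x => by simp
      exact key _

theorem mul_hcls_complexK : hcls k 𝒜 hN * hcls k 𝒜 (isProj_complexK P) =
    sqrtCard k ^ (hd k (N.X 1) P - hd k (N.X 0) P) •
      hcls k 𝒜 (isProj_dsum (isProj_complexK P) hN) := by
  have ht := sqrtCard_ne_zero k
  rw [hcls_mul_hcls_of_split k hN (isProj_complexK P) (isProj_dsum (isProj_complexK P) hN),
    Nat.card_congr (cocycleComplexKEquiv P N), natCard_hom k, ← zpow_neg, ← zpow_add₀ ht]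
  · congr 2
    change -(hd k (N.X 0) P + hd k (N.X 1) P) + _ = _
    ring
  · intro h
    refine ⟨coneIsoDsum h (0 : N.X 0 ⟶ P) (show N.X 1 ⟶ P from h.1.2) ?_ ?_⟩
    · refine (cocycle_complexK_rel P N h).trans ?_
      change _ = (0 : N.X 0 ⟶ P) ≫ (0 : P ⟶ P) - N.d 0 1 ≫ (show N.X 1 ⟶ P from h.1.2)
      simp
    · have key : ∀ x : N.X 1 ⟶ P, x = x ≫ 𝟙 P - N.d 1 0 ≫ (0 : N.X 0 ⟶ P) :=
        fun x => by simp
      exact key _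

theorem hcls_complexKStar_mul : hcls k 𝒜 (isProj_complexKStar P) * hcls k 𝒜 hN =
    sqrtCard k ^ (hd k P (N.X 1) - hd k P (N.X 0)) •
      hcls k 𝒜 (isProj_dsum (isProj_complexKStar P) hN) := by
  have ht := sqrtCard_ne_zero k
  rw [hcls_mul_hcls_of_split k (isProj_complexKStar P) hN
    (isProj_dsum (isProj_complexKStar P) hN),
    Nat.card_congr (complexKStarCocycleEquiv P N), natCard_hom k, ← zpow_neg, ← zpow_add₀ ht]
  · congr 2
    change -(hd k P (N.X 0) + hd k P (N.X 1)) + _ = _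
    ring
  · intro h
    refine ⟨coneIsoDsum h (0 : P ⟶ N.X 0) (show P ⟶ N.X 1 from -h.1.1) ?_ ?_ ≪≫ dsumComm _ _⟩
    · have key : ∀ x : P ⟶ N.X 1, x = (0 : P ⟶ N.X 0) ≫ N.d 0 1 - 𝟙 P ≫ (-x) :=
        fun x => by simp
      exact key _
    · refine (complexKStar_cocycle_rel P N h).trans ?_
      have key : ∀ x : P ⟶ N.X 1, -(x ≫ N.d 1 0) = (-x) ≫ N.d 1 0 - (0 : P ⟶ P) ≫ 0 :=
        fun x => by simp
      exact key _

theorem mul_hcls_complexKStar : hcls k 𝒜 hN * hcls k 𝒜 (isProj_complexKStar P) =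
    sqrtCard k ^ (hd k (N.X 0) P - hd k (N.X 1) P) •
      hcls k 𝒜 (isProj_dsum (isProj_complexKStar P) hN) := by
  have ht := sqrtCard_ne_zero k
  rw [hcls_mul_hcls_of_split k hN (isProj_complexKStar P)
    (isProj_dsum (isProj_complexKStar P) hN),
    Nat.card_congr (cocycleComplexKStarEquiv P N), natCard_hom k, ← zpow_neg, ← zpow_add₀ ht]
  · congr 2
    change -(hd k (N.X 0) P + hd k (N.X 1) P) + _ = _
    ring
  · intro h
    refine ⟨coneIsoDsum h (show N.X 0 ⟶ P from h.1.1) (0 : N.X 1 ⟶ P) ?_ ?_⟩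
    · have key : ∀ x : N.X 0 ⟶ P, x = x ≫ 𝟙 P - N.d 0 1 ≫ (0 : N.X 1 ⟶ P) :=
        fun x => by simp
      exact key _
    · refine (cocycle_complexKStar_rel P N h).trans ?_
      change _ = (0 : N.X 1 ⟶ P) ≫ (0 : P ⟶ P) - N.d 1 0 ≫ (show N.X 0 ⟶ P from h.1.1)
      simp

end AcyclicProducts

/-! ### Maps into the localization -/

section LocMaps

variable {H : Type u} [NonUnitalNonAssocRing H] [Module ℂ H] [One H] (S : Set H)

theorem Loc.of_add (x y : H) : Loc.of S (x + y) = Loc.of S x + Loc.of S y := by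
  unfold Loc.of
  rw [← map_add]
  exact RingQuot.mkAlgHom_rel ℂ (LocRel.add x y)

theorem Loc.of_smul (c : ℂ) (x : H) : Loc.of S (c • x) = c • Loc.of S x := by
  unfold Loc.of
  rw [← map_smul]
  exact RingQuot.mkAlgHom_rel ℂ (LocRel.smul c x)

theorem Loc.of_mul (x y : H) : Loc.of S (x * y) = Loc.of S x * Loc.of S y := by
  unfold Loc.of
  rw [← map_mul]
  exact RingQuot.mkAlgHom_rel ℂ (LocRel.mul x y)

theorem Loc.of_one : Loc.of S 1 = 1 := by
  unfold Loc.of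
  rw [← map_one (RingQuot.mkAlgHom ℂ (LocRel H S))]
  exact RingQuot.mkAlgHom_rel ℂ LocRel.one

theorem Loc.of_mul_inv (s : S) : Loc.of S s * Loc.inv S s = 1 := by
  unfold Loc.of Loc.inv
  rw [← map_one (RingQuot.mkAlgHom ℂ (LocRel H S)), ← map_mul]
  exact RingQuot.mkAlgHom_rel ℂ (LocRel.mul_inv s)

theorem Loc.inv_mul_of (s : S) : Loc.inv S s * Loc.of S s = 1 := by
  unfold Loc.of Loc.inv
  rw [← map_one (RingQuot.mkAlgHom ℂ (LocRel H S)), ← map_mul]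
  exact RingQuot.mkAlgHom_rel ℂ (LocRel.inv_mul s)

/-- The canonical map to the localization as a linear map. -/
def Loc.ofLinear : H →ₗ[ℂ] Loc H S where
  toFun := Loc.of S
  map_add' := Loc.of_add S
  map_smul' := Loc.of_smul S

end LocMaps

/-! ### The commutative group of the `K_P` and `K_P^*`, and normalized classes -/

section Torus

variable (k : Type w) [Field k] [Finite k] {𝒜 : Type u} [Category.{v} 𝒜] [Abelian 𝒜] [Linear k 𝒜]
  [hfin : ∀ X Y : 𝒜, Module.Finite k (X ⟶ Y)]

omit [Finite k] hfin in
theorem DH.cls_congr {M N : C2 𝒜} (hM : isProj 𝒜 M) (hN : isProj 𝒜 N) (e : M ≅ N) :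
    DH.cls k M hM = DH.cls k N hN :=
  congrArg _ (TwHall.cls_congr hM hN e)

/-- The class of `K_P` as a unit of the localized Hall algebra. -/
def unitK (P : 𝒜) [Projective P] : (DH k 𝒜)ˣ where
  val := DH.cls k (complexK P) (isProj_complexK P)
  inv := DH.clsInv k (complexK P) (isProj_complexK P) (acyclic_complexK P)
  val_inv := Loc.of_mul_inv (acyclicSet k 𝒜) ⟨_, _, isProj_complexK P, acyclic_complexK P, rfl⟩
  inv_val := Loc.inv_mul_of (acyclicSet k 𝒜) ⟨_, _, isProj_complexK P, acyclic_complexK P, rfl⟩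

/-- The class of `K_P^*` as a unit of the localized Hall algebra. -/
def unitKStar (P : 𝒜) [Projective P] : (DH k 𝒜)ˣ where
  val := DH.cls k (complexKStar P) (isProj_complexKStar P)
  inv := DH.clsInv k (complexKStar P) (isProj_complexKStar P) (acyclic_complexKStar P)
  val_inv := Loc.of_mul_inv (acyclicSet k 𝒜)
    ⟨_, _, isProj_complexKStar P, acyclic_complexKStar P, rfl⟩
  inv_val := Loc.inv_mul_of (acyclicSet k 𝒜)
    ⟨_, _, isProj_complexKStar P, acyclic_complexKStar P, rfl⟩

section

variable (P : 𝒜) [Projective P] {N : C2 𝒜} (hN : isProj 𝒜 N)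

theorem DH.complexK_mul : DH.cls k (complexK P) (isProj_complexK P) * DH.cls k N hN =
    sqrtCard k ^ (hd k P (N.X 0) - hd k P (N.X 1)) •
      DH.cls k _ (isProj_dsum (isProj_complexK P) hN) := by
  unfold DH.cls
  rw [← Loc.of_mul, hcls_complexK_mul, Loc.of_smul]

theorem DH.mul_complexK : DH.cls k N hN * DH.cls k (complexK P) (isProj_complexK P) =
    sqrtCard k ^ (hd k (N.X 1) P - hd k (N.X 0) P) •
      DH.cls k _ (isProj_dsum (isProj_complexK P) hN) := by
  unfold DH.cls
  rw [← Loc.of_mul, mul_hcls_complexK, Loc.of_smul]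

theorem DH.complexKStar_mul : DH.cls k (complexKStar P) (isProj_complexKStar P) * DH.cls k N hN =
    sqrtCard k ^ (hd k P (N.X 1) - hd k P (N.X 0)) •
      DH.cls k _ (isProj_dsum (isProj_complexKStar P) hN) := by
  unfold DH.cls
  rw [← Loc.of_mul, hcls_complexKStar_mul, Loc.of_smul]

theorem DH.mul_complexKStar : DH.cls k N hN * DH.cls k (complexKStar P) (isProj_complexKStar P) =
    sqrtCard k ^ (hd k (N.X 0) P - hd k (N.X 1) P) •
      DH.cls k _ (isProj_dsum (isProj_complexKStar P) hN) := by
  unfold DH.cls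
  rw [← Loc.of_mul, mul_hcls_complexKStar, Loc.of_smul]

end

variable (𝒜) in
/-- The classes of the complexes `K_P` and `K_P^*`. -/
def torusGenerators : Set (Additive (DH k 𝒜)ˣ) :=
  {x | ∃ (P : 𝒜) (_ : Projective P), x = Additive.ofMul (unitK k P) ∨
    x = Additive.ofMul (unitKStar k P)}

/-- Generators have the same object in both degrees, so all exponents vanish and either order of
multiplication gives the class of the direct sum. -/
theorem commute_generators (x : Additive (DH k 𝒜)ˣ) (hx : x ∈ torusGenerators k 𝒜)
    (y : Additive (DH k 𝒜)ˣ) (hy : y ∈ torusGenerators k 𝒜) : x + y = y + x := by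
  have key : ∀ a b : (DH k 𝒜)ˣ, (a : DH k 𝒜) * b = b * a →
      Additive.ofMul a + Additive.ofMul b = Additive.ofMul b + Additive.ofMul a :=
    fun a b h => congrArg Additive.ofMul (Units.ext h)
  obtain ⟨P, _, rfl | rfl⟩ := hx <;> obtain ⟨Q, _, rfl | rfl⟩ := hy <;> apply key
  · refine (DH.complexK_mul k P _).trans ((DH.mul_complexK k P _).trans ?_).symm
    congr 2
    change hd k Q P - hd k Q P = hd k P Q - hd k P Q
    ring
  · refine (DH.complexK_mul k P _).trans ((DH.mul_complexK k P _).trans ?_).symm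
    congr 2
    change hd k Q P - hd k Q P = hd k P Q - hd k P Q
    ring
  · refine (DH.complexKStar_mul k P _).trans ((DH.mul_complexKStar k P _).trans ?_).symm
    congr 2
    change hd k Q P - hd k Q P = hd k P Q - hd k P Q
    ring
  · refine (DH.complexKStar_mul k P _).trans ((DH.mul_complexKStar k P _).trans ?_).symm
    congr 2
    change hd k Q P - hd k Q P = hd k P Q - hd k P Q
    ring

variable (𝒜) in
/-- The commutative group generated by the classes `K_P` and `K_P^*`, written additively. -/
def Torus : Type (max u v) := AddSubgroup.closure (torusGenerators k 𝒜)

/-- Additive notation reduces identities between monomials in the `K_P`, `K_P^*` and their inverses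
to identities in an abelian group. -/
instance : AddCommGroup (Torus k 𝒜) :=
  AddSubgroup.closureAddCommGroupOfComm (commute_generators k)

variable {k} in
/-- The element of the localized Hall algebra given by an element of the torus. -/
def Torus.exp (a : Torus k 𝒜) : DH k 𝒜 := ((Additive.toMul a.1 : (DH k 𝒜)ˣ) : DH k 𝒜)

theorem Torus.exp_add (a b : Torus k 𝒜) : (a + b).exp = a.exp * b.exp := rfl

theorem Torus.exp_zero : (0 : Torus k 𝒜).exp = 1 := rfl

theorem Torus.exp_neg_mul (a : Torus k 𝒜) : (-a).exp * a.exp = 1 := by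
  rw [← exp_add, neg_add_cancel, exp_zero]

theorem Torus.exp_mul_neg (a : Torus k 𝒜) : a.exp * (-a).exp = 1 := by
  rw [← exp_add, add_neg_cancel, exp_zero]

/-- The class of `K_P` in the torus. -/
def torusK (P : 𝒜) [Projective P] : Torus k 𝒜 :=
  ⟨Additive.ofMul (unitK k P), AddSubgroup.subset_closure ⟨P, inferInstance, Or.inl rfl⟩⟩

/-- The class of `K_P^*` in the torus. -/
def torusKStar (P : 𝒜) [Projective P] : Torus k 𝒜 :=
  ⟨Additive.ofMul (unitKStar k P), AddSubgroup.subset_closure ⟨P, inferInstance, Or.inr rfl⟩⟩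

theorem exp_torusK (P : 𝒜) [Projective P] :
    (torusK k P).exp = DH.cls k (complexK P) (isProj_complexK P) := rfl

theorem exp_torusKStar (P : 𝒜) [Projective P] :
    (torusKStar k P).exp = DH.cls k (complexKStar P) (isProj_complexKStar P) := rfl

variable {k} in
theorem Torus.exp_injective : Function.Injective (Torus.exp (k := k) (𝒜 := 𝒜)) := by
  intro a b h
  exact Subtype.ext (Units.ext h)

omit [Finite k] [Linear k 𝒜] hfin in
/-- Isomorphic objects give isomorphic complexes `K_P`. -/
def complexKCongr {P Q : 𝒜} (e : P ≅ Q) : complexK P ≅ complexK Q :=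
  C2.mkIso e e (by simp) (by simp)

/-- Isomorphic objects give isomorphic complexes `K_P^*`. -/
def complexKStarCongr {P Q : 𝒜} (e : P ≅ Q) : complexKStar P ≅ complexKStar Q :=
  C2.mkIso e e (by simp) (by simp)

/-- The complex `K` of a direct sum. -/
def complexKBiprod (P Q : 𝒜) : complexK (P ⊞ Q) ≅ dsum (complexK P) (complexK Q) :=
  C2.mkIso (Iso.refl (P ⊞ Q)) (Iso.refl (P ⊞ Q))
    (show 𝟙 (P ⊞ Q) ≫ biprod.map (𝟙 P) (𝟙 Q) = 𝟙 (P ⊞ Q) ≫ 𝟙 (P ⊞ Q) by ext <;> simp)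
    (show 𝟙 (P ⊞ Q) ≫ biprod.map (0 : P ⟶ P) (0 : Q ⟶ Q) = (0 : P ⊞ Q ⟶ P ⊞ Q) ≫ 𝟙 (P ⊞ Q) by
      ext <;> simp)

/-- The complex `K^*` of a direct sum. -/
def complexKStarBiprod (P Q : 𝒜) :
    complexKStar (P ⊞ Q) ≅ dsum (complexKStar P) (complexKStar Q) :=
  C2.mkIso (Iso.refl (P ⊞ Q)) (Iso.refl (P ⊞ Q))
    (show 𝟙 (P ⊞ Q) ≫ biprod.map (0 : P ⟶ P) (0 : Q ⟶ Q) = (0 : P ⊞ Q ⟶ P ⊞ Q) ≫ 𝟙 (P ⊞ Q) by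
      ext <;> simp)
    (show 𝟙 (P ⊞ Q) ≫ biprod.map (𝟙 P) (𝟙 Q) = 𝟙 (P ⊞ Q) ≫ 𝟙 (P ⊞ Q) by ext <;> simp)

theorem torusK_congr {P Q : 𝒜} [Projective P] [Projective Q] (e : P ≅ Q) :
    torusK k P = torusK k Q :=
  Torus.exp_injective (DH.cls_congr k _ _ (complexKCongr e))

theorem torusKStar_congr {P Q : 𝒜} [Projective P] [Projective Q] (e : P ≅ Q) :
    torusKStar k P = torusKStar k Q :=
  Torus.exp_injective (DH.cls_congr k _ _ (complexKStarCongr e))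

theorem torusK_biprod (P Q : 𝒜) [Projective P] [Projective Q] :
    torusK k (P ⊞ Q) = torusK k P + torusK k Q := by
  apply Torus.exp_injective
  rw [Torus.exp_add, exp_torusK, exp_torusK, exp_torusK, DH.complexK_mul]
  change _ = sqrtCard k ^ (hd k P Q - hd k P Q) • _
  rw [sub_self, zpow_zero, one_smul]
  exact DH.cls_congr k _ _ (complexKBiprod P Q)

theorem torusKStar_biprod (P Q : 𝒜) [Projective P] [Projective Q] :
    torusKStar k (P ⊞ Q) = torusKStar k P + torusKStar k Q := by
  apply Torus.exp_injective
  rw [Torus.exp_add, exp_torusKStar, exp_torusKStar, exp_torusKStar, DH.complexKStar_mul]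
  change _ = sqrtCard k ^ (hd k P Q - hd k P Q) • _
  rw [sub_self, zpow_zero, one_smul]
  exact DH.cls_congr k _ _ (complexKStarBiprod P Q)

omit [Finite k] hfin in
theorem DH.cls_eq_one {Z : C2 𝒜} (hZ : isProj 𝒜 Z) (h : IsZero Z) : DH.cls k Z hZ = 1 :=
  (congrArg (Loc.of _) (hall_one_eq k hZ h).symm).trans (Loc.of_one _)

theorem torusK_zero {P : 𝒜} [Projective P] (h : IsZero P) : torusK k P = 0 :=
  Torus.exp_injective (DH.cls_eq_one k _ (C2.isZero h h))

theorem torusKStar_zero {P : 𝒜} [Projective P] (h : IsZero P) : torusKStar k P = 0 :=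
  Torus.exp_injective (DH.cls_eq_one k _ (C2.isZero h h))

variable {k} in
/-- The element `a` of the torus commutes with `m` up to the power `t ^ n`. -/
def Skew (n : ℤ) (a : Torus k 𝒜) (m : DH k 𝒜) : Prop :=
  m * a.exp = sqrtCard k ^ n • (a.exp * m)

variable {k}

theorem Skew.add {n n' : ℤ} {a a' : Torus k 𝒜} {m : DH k 𝒜} (h : Skew n a m) (h' : Skew n' a' m) :
    Skew (n + n') (a + a') m := by
  unfold Skew at *
  rw [Torus.exp_add, ← mul_assoc, h, smul_mul_assoc, mul_assoc, h', mul_smul_comm, smul_smul,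
    ← zpow_add₀ (sqrtCard_ne_zero k), mul_assoc]

theorem Skew.neg {n : ℤ} {a : Torus k 𝒜} {m : DH k 𝒜} (h : Skew n a m) : Skew (-n) (-a) m := by
  unfold Skew at *
  have h₁ : m = sqrtCard k ^ n • (a.exp * m * (-a).exp) := by
    rw [← smul_mul_assoc, ← h, mul_assoc, Torus.exp_mul_neg, mul_one]
  have h₂ : (-a).exp * m = sqrtCard k ^ n • (m * (-a).exp) := by
    conv_lhs => rw [h₁]
    rw [mul_smul_comm, ← mul_assoc, ← mul_assoc, Torus.exp_neg_mul, one_mul]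
  rw [h₂, smul_smul, ← zpow_add₀ (sqrtCard_ne_zero k), neg_add_cancel, zpow_zero, one_smul]

theorem Skew.sub {n n' : ℤ} {a a' : Torus k 𝒜} {m : DH k 𝒜} (h : Skew n a m) (h' : Skew n' a' m) :
    Skew (n - n') (a - a') m := by
  rw [sub_eq_add_neg, sub_eq_add_neg]
  exact h.add h'.neg

variable (k)

theorem skew_torusK (P : 𝒜) [Projective P] {N : C2 𝒜} (hN : isProj 𝒜 N) :
    Skew (hd k (N.X 1) P - hd k (N.X 0) P - (hd k P (N.X 0) - hd k P (N.X 1)))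
      (torusK k P) (DH.cls k N hN) := by
  unfold Skew
  rw [exp_torusK, DH.complexK_mul, DH.mul_complexK, smul_smul, ← zpow_add₀ (sqrtCard_ne_zero k)]
  congr 2
  ring

theorem skew_torusKStar (P : 𝒜) [Projective P] {N : C2 𝒜} (hN : isProj 𝒜 N) :
    Skew (hd k (N.X 0) P - hd k (N.X 1) P - (hd k P (N.X 1) - hd k P (N.X 0)))
      (torusKStar k P) (DH.cls k N hN) := by
  unfold Skew
  rw [exp_torusKStar, DH.complexKStar_mul, DH.mul_complexKStar, smul_smul,
    ← zpow_add₀ (sqrtCard_ne_zero k)]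
  congr 2
  ring

theorem DH.cls_dsum_complexK (P : 𝒜) [Projective P] {N : C2 𝒜} (hN : isProj 𝒜 N) :
    DH.cls k _ (isProj_dsum (isProj_complexK P) hN) =
      sqrtCard k ^ (hd k P (N.X 1) - hd k P (N.X 0)) • ((torusK k P).exp * DH.cls k N hN) := by
  rw [exp_torusK, DH.complexK_mul, smul_smul, ← zpow_add₀ (sqrtCard_ne_zero k)]
  simp

theorem DH.cls_dsum_complexKStar (P : 𝒜) [Projective P] {N : C2 𝒜} (hN : isProj 𝒜 N) :
    DH.cls k _ (isProj_dsum (isProj_complexKStar P) hN) =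
      sqrtCard k ^ (hd k P (N.X 0) - hd k P (N.X 1)) •
        ((torusKStar k P).exp * DH.cls k N hN) := by
  rw [exp_torusKStar, DH.complexKStar_mul, smul_smul, ← zpow_add₀ (sqrtCard_ne_zero k)]
  simp

/-- The class of a complex of projectives normalized by elements of the torus. -/
def normCls {M : C2 𝒜} (hM : isProj 𝒜 M) (B : 𝒜) [hB : Projective B] : DH k 𝒜 :=
  haveI := hM 1
  sqrtCard k ^ (hd k (M.X 1) (M.X 0) - hd k (M.X 1) (M.X 1) -
      2 * (hd k B (M.X 0) - hd k B (M.X 1))) •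
    ((-torusK k (M.X 1) + torusK k B - torusKStar k B).exp * DH.cls k M hM)

theorem normCls_congr {M M' : C2 𝒜} (hM : isProj 𝒜 M) (hM' : isProj 𝒜 M') (e : M ≅ M')
    {B B' : 𝒜} [Projective B] [Projective B'] (e' : B ≅ B') :
    normCls k hM B = normCls k hM' B' := by
  have : Projective (M.X 1) := hM 1
  have : Projective (M'.X 1) := hM' 1
  unfold normCls
  rw [hd_congr k (C2.evalIso e 1) (C2.evalIso e 0), hd_congr k (C2.evalIso e 1) (C2.evalIso e 1),
    hd_congr k e' (C2.evalIso e 0), hd_congr k e' (C2.evalIso e 1), torusK_congr k e',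
    torusKStar_congr k e', torusK_congr k (C2.evalIso e 1), DH.cls_congr k hM hM' e]

/-- The factor `K_P` split off from the class cancels against the enlarged `K_{-M₁}`. The power of
`t` from splitting cancels against the change in `hd(M₁, M₀) - hd(M₁, M₁)`; the terms with `B` do
not change, since `P` is added in both degrees. -/
theorem normCls_dsum_complexK (P : 𝒜) [Projective P] {N : C2 𝒜} (hN : isProj 𝒜 N)
    (B : 𝒜) [Projective B] :
    normCls k (isProj_dsum (isProj_complexK P) hN) B = normCls k hN B := by
  have : Projective (N.X 1) := hN 1
  unfold normCls
  have : Projective ((dsum (complexK P) N).X 1) := isProj_dsum (isProj_complexK P) hN 1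
  have e₁ : torusK k ((dsum (complexK P) N).X 1) = torusK k P + torusK k (N.X 1) :=
    torusK_biprod k P (N.X 1)
  have d : ∀ X : 𝒜, hd k X ((dsum (complexK P) N).X 0) = hd k X P + hd k X (N.X 0) :=
    fun X => hd_biprod_right k X P (N.X 0)
  have d' : ∀ X : 𝒜, hd k X ((dsum (complexK P) N).X 1) = hd k X P + hd k X (N.X 1) :=
    fun X => hd_biprod_right k X P (N.X 1)
  have d'' : ∀ X : 𝒜, hd k ((dsum (complexK P) N).X 1) X = hd k P X + hd k (N.X 1) X :=
    fun X => hd_biprod_left k P (N.X 1) X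
  rw [DH.cls_dsum_complexK k P hN, e₁, mul_smul_comm, smul_smul, ← mul_assoc, ← Torus.exp_add,
    ← zpow_add₀ (sqrtCard_ne_zero k)]
  simp only [d, d', d'']
  refine congrArg₂ (fun (n : ℤ) (a : Torus k 𝒜) => sqrtCard k ^ n • (a.exp * DH.cls k N hN)) ?_ ?_
  · ring
  · abel

/-- This explains the factors `K_B`, `K_{-B}^*` and the coefficient `2`. Enlarging `B` by `P`
compensates `K_{-P}` coming from `M₁` and `K_P^*` coming from the class. With `d = hd(P, N₀) - hd(P,
N₁)`, the exponent changes by `d` from splitting, by `d` from the `M₁` terms and by `-2d` from the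
`B` terms. -/
theorem normCls_dsum_complexKStar (P : 𝒜) [Projective P] {N : C2 𝒜} (hN : isProj 𝒜 N)
    (B : 𝒜) [Projective B] :
    normCls k (isProj_dsum (isProj_complexKStar P) hN) (P ⊞ B) = normCls k hN B := by
  have : Projective (N.X 1) := hN 1
  unfold normCls
  have : Projective ((dsum (complexKStar P) N).X 1) := isProj_dsum (isProj_complexKStar P) hN 1
  have e₁ : torusK k ((dsum (complexKStar P) N).X 1) = torusK k P + torusK k (N.X 1) :=
    torusK_biprod k P (N.X 1)
  have d : ∀ X : 𝒜, hd k X ((dsum (complexKStar P) N).X 0) = hd k X P + hd k X (N.X 0) :=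
    fun X => hd_biprod_right k X P (N.X 0)
  have d' : ∀ X : 𝒜, hd k X ((dsum (complexKStar P) N).X 1) = hd k X P + hd k X (N.X 1) :=
    fun X => hd_biprod_right k X P (N.X 1)
  have d'' : ∀ X : 𝒜, hd k ((dsum (complexKStar P) N).X 1) X = hd k P X + hd k (N.X 1) X :=
    fun X => hd_biprod_left k P (N.X 1) X
  rw [DH.cls_dsum_complexKStar k P hN, e₁, mul_smul_comm, smul_smul, ← mul_assoc, ← Torus.exp_add,
    ← zpow_add₀ (sqrtCard_ne_zero k), torusK_biprod, torusKStar_biprod]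
  simp only [d, d', d'', hd_biprod_left]
  refine congrArg₂ (fun (n : ℤ) (a : Torus k 𝒜) => sqrtCard k ^ n • (a.exp * DH.cls k N hN)) ?_ ?_
  · ring
  · abel

end Torus

/-! ### Short exact sequences and Schanuel's lemma -/

section ShortExactSequences

variable {𝒜 : Type u} [Category.{v} 𝒜] [Abelian 𝒜]

theorem shortExact_of_lift {X Y Z : 𝒜} (f : X ⟶ Y) (g : Y ⟶ Z) (w : f ≫ g = 0) [Mono f] [Epi g]
    (h : ∀ ⦃T : 𝒜⦄ (x : T ⟶ Y), x ≫ g = 0 → ∃ y, y ≫ f = x) :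
    (ShortComplex.mk f g w).ShortExact where
  exact := by
    apply ShortComplex.exact_of_f_is_kernel
    exact KernelFork.IsLimit.ofι' f w fun x hx => ⟨(h x hx).choose, (h x hx).choose_spec⟩

theorem exists_lift_of_shortExact {X Y Z : 𝒜} {f : X ⟶ Y} {g : Y ⟶ Z} {w : f ≫ g = 0}
    (hS : (ShortComplex.mk f g w).ShortExact) {T : 𝒜} (x : T ⟶ Y) (hx : x ≫ g = 0) :
    ∃ y, y ≫ f = x := by
  have : Mono f := hS.mono_f
  have : Mono (ShortComplex.mk f g w).f := hS.mono_f
  exact ⟨hS.exact.lift x hx, hS.exact.lift_f x hx⟩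

theorem exists_iso_left {X Y Z X' Y' Z' : 𝒜} {f : X ⟶ Y} {g : Y ⟶ Z} {w : f ≫ g = 0}
    (hS : (ShortComplex.mk f g w).ShortExact) {f' : X' ⟶ Y'} {g' : Y' ⟶ Z'} {w' : f' ≫ g' = 0}
    (hS' : (ShortComplex.mk f' g' w').ShortExact) (b : Y ≅ Y') (c : Z ≅ Z')
    (h : b.hom ≫ g' = g ≫ c.hom) : ∃ a : X ≅ X', a.hom ≫ f' = f ≫ b.hom := by
  have : Mono f := hS.mono_f
  have : Mono f' := hS'.mono_f
  obtain ⟨l, hl⟩ := exists_lift_of_shortExact hS' (f ≫ b.hom) (by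
    rw [Category.assoc, h, reassoc_of% w, zero_comp])
  obtain ⟨m, hm⟩ := exists_lift_of_shortExact hS (f' ≫ b.inv) (by
    rw [Category.assoc, ← cancel_mono c.hom, Category.assoc, Category.assoc, ← h,
      b.inv_hom_id_assoc, w', zero_comp])
  refine ⟨⟨l, m, ?_, ?_⟩, hl⟩
  · rw [← cancel_mono f, Category.assoc, hm, reassoc_of% hl]; simp
  · rw [← cancel_mono f', Category.assoc, hl, reassoc_of% hm]; simp

theorem shortExact_map_id_desc {X Y Z : 𝒜} {f : X ⟶ Y} {g : Y ⟶ Z} {w : f ≫ g = 0}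
    (hS : (ShortComplex.mk f g w).ShortExact) (Q : 𝒜) :
    ∃ w', (ShortComplex.mk (biprod.map (𝟙 Q) f) (biprod.desc (0 : Q ⟶ Z) g) w').ShortExact := by
  have : Mono f := hS.mono_f
  have : Epi g := hS.epi_g
  have : Epi (biprod.desc (0 : Q ⟶ Z) g) := epi_of_epi_fac (biprod.inr_desc (0 : Q ⟶ Z) g)
  refine ⟨by ext <;> simp [w], shortExact_of_lift _ _ _ fun T x hx => ?_⟩
  obtain ⟨y, hy⟩ := exists_lift_of_shortExact hS (x ≫ biprod.snd) (by
    rw [← hx, Category.assoc]; congr 1; ext <;> simp)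
  exact ⟨biprod.lift (x ≫ biprod.fst) y, by ext <;> simp [hy]⟩

theorem shortExact_inr_map_id {X Y Z : 𝒜} {f : X ⟶ Y} {g : Y ⟶ Z} {w : f ≫ g = 0}
    (hS : (ShortComplex.mk f g w).ShortExact) (Q : 𝒜) :
    ∃ w', (ShortComplex.mk (f ≫ biprod.inr) (biprod.map (𝟙 Q) g) w').ShortExact := by
  have : Mono f := hS.mono_f
  have : Epi g := hS.epi_g
  refine ⟨by simp [reassoc_of% w], shortExact_of_lift _ _ _ fun T x hx => ?_⟩
  have hx₁ : x ≫ biprod.fst = 0 := by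
    have := hx =≫ biprod.fst
    simpa using this
  have hx₂ : (x ≫ biprod.snd) ≫ g = 0 := by
    have := hx =≫ biprod.snd
    simpa using this
  obtain ⟨y, hy⟩ := exists_lift_of_shortExact hS (x ≫ biprod.snd) hx₂
  exact ⟨y, by ext <;> simp [hy, hx₁]⟩

/-- The automorphism `(x, y) ↦ (x, y + u x)` of a direct sum. -/
@[simps]
def shear {X Y : 𝒜} (u : X ⟶ Y) : X ⊞ Y ≅ X ⊞ Y where
  hom := 𝟙 _ + biprod.fst ≫ u ≫ biprod.inr
  inv := 𝟙 _ - biprod.fst ≫ u ≫ biprod.inr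
  hom_inv_id := by ext <;> simp
  inv_hom_id := by ext <;> simp

/-- Schanuel's lemma: two epimorphisms from projectives become isomorphic after adding the
sources. -/
theorem exists_iso_of_projective_epi {P P' X : 𝒜} [Projective P] [Projective P'] (p : P ⟶ X)
    (p' : P' ⟶ X) [Epi p] [Epi p'] :
    ∃ Φ : P' ⊞ P ≅ P ⊞ P', Φ.hom ≫ biprod.desc 0 p' = biprod.desc 0 p := by
  -- With lifts `u` of `p'` through `p` and `v` of `p` through `p'`, this sends `(x', x)` to `(y, x'
  -- + v y)` for `y = x - u x'`, and `p' (x' + v y) = p' x' + p x - p' x' = p x`.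
  refine ⟨(shear (-Projective.factorThru p' p)) ≪≫ biprod.braiding P' P ≪≫
    shear (Projective.factorThru p p'), ?_⟩
  ext <;> simp

end ShortExactSequences

/-! ### Projective resolutions of length two and their folded complexes -/

section Resolutions

variable {𝒜 : Type u} [Category.{v} 𝒜] [Abelian 𝒜]

/-- A projective resolution of length two, `0 ⟶ P₂ ⟶ P₁ ⟶ P₀ ⟶ A ⟶ 0`, given by the short exact
sequences `0 ⟶ P₂ ⟶ P₁ ⟶ Ω ⟶ 0` and `0 ⟶ Ω ⟶ P₀ ⟶ A ⟶ 0`. -/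
structure Res (A : 𝒜) where
  {P₂ P₁ P₀ Ω : 𝒜}
  proj₂ : Projective P₂
  proj₁ : Projective P₁
  proj₀ : Projective P₀
  i : P₂ ⟶ P₁
  π : P₁ ⟶ Ω
  ι : Ω ⟶ P₀
  ε : P₀ ⟶ A
  i_π : i ≫ π = 0
  ι_ε : ι ≫ ε = 0
  exact₁ : (ShortComplex.mk i π i_π).ShortExact
  exact₀ : (ShortComplex.mk ι ε ι_ε).ShortExact

namespace Res

variable {A : 𝒜} (T : Res A)

instance : Projective T.P₂ := T.proj₂
instance : Projective T.P₁ := T.proj₁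
instance : Projective T.P₀ := T.proj₀
instance : Mono T.i := T.exact₁.mono_f
instance : Mono T.ι := T.exact₀.mono_f
instance : Epi T.π := T.exact₁.epi_g
instance : Epi T.ε := T.exact₀.epi_g

/-- The `ℤ/2`-graded complex of a resolution. -/
def fold : C2 𝒜 :=
  C2.mk (biprod.lift (T.π ≫ T.ι) (0 : T.P₁ ⟶ T.P₂)) (biprod.desc (0 : T.P₀ ⟶ T.P₁) T.i)
    (by simp) (by ext <;> simp [reassoc_of% T.i_π])

theorem isProj_fold : isProj 𝒜 T.fold := isProj_mk _ _ _ _ inferInstance inferInstance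

/-- The resolution with `Q` added to `P₂` and to `P₁`. -/
def addStar (Q : 𝒜) [Projective Q] : Res A where
  P₂ := Q ⊞ T.P₂
  P₁ := Q ⊞ T.P₁
  P₀ := T.P₀
  Ω := T.Ω
  proj₂ := inferInstance
  proj₁ := inferInstance
  proj₀ := inferInstance
  i := biprod.map (𝟙 Q) T.i
  π := biprod.desc 0 T.π
  ι := T.ι
  ε := T.ε
  i_π := (shortExact_map_id_desc T.exact₁ Q).1
  ι_ε := T.ι_ε
  exact₁ := (shortExact_map_id_desc T.exact₁ Q).2
  exact₀ := T.exact₀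

/-- The resolution with `Q` added to `P₁` and to `P₀`. -/
def addK (Q : 𝒜) [Projective Q] : Res A where
  P₂ := T.P₂
  P₁ := Q ⊞ T.P₁
  P₀ := Q ⊞ T.P₀
  Ω := Q ⊞ T.Ω
  proj₂ := inferInstance
  proj₁ := inferInstance
  proj₀ := inferInstance
  i := T.i ≫ biprod.inr
  π := biprod.map (𝟙 Q) T.π
  ι := biprod.map (𝟙 Q) T.ι
  ε := biprod.desc 0 T.ε
  i_π := (shortExact_inr_map_id T.exact₁ Q).1
  ι_ε := (shortExact_map_id_desc T.exact₀ Q).1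
  exact₁ := (shortExact_inr_map_id T.exact₁ Q).2
  exact₀ := (shortExact_map_id_desc T.exact₀ Q).2

/-- The complex of a resolution with `Q` added to `P₂` and to `P₁`. -/
def foldAddStar (Q : 𝒜) [Projective Q] :
    dsum (complexKStar Q) T.fold ≅ (T.addStar Q).fold :=
  C2.mkIso (M₁ := Q ⊞ T.P₁) (M₀ := Q ⊞ (T.P₀ ⊞ T.P₂)) (N₁ := Q ⊞ T.P₁)
    (N₀ := T.P₀ ⊞ (Q ⊞ T.P₂)) (Iso.refl _)
    { hom := biprod.desc (biprod.inl ≫ biprod.inr) (biprod.map (𝟙 _) biprod.inr)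
      inv := biprod.desc (biprod.inl ≫ biprod.inr) (biprod.map (𝟙 _) biprod.inr)
      hom_inv_id := by ext <;> simp
      inv_hom_id := by ext <;> simp }
    (show 𝟙 (Q ⊞ T.P₁) ≫ biprod.lift (biprod.desc 0 T.π ≫ T.ι) 0 =
      biprod.map (0 : Q ⟶ Q) (biprod.lift (T.π ≫ T.ι) (0 : T.P₁ ⟶ T.P₂)) ≫
        biprod.desc (biprod.inl ≫ biprod.inr) (biprod.map (𝟙 _) biprod.inr) by ext <;> simp)
    (show biprod.desc (biprod.inl ≫ biprod.inr) (biprod.map (𝟙 _) biprod.inr) ≫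
      biprod.desc (0 : T.P₀ ⟶ Q ⊞ T.P₁) (biprod.map (𝟙 Q) T.i) =
        biprod.map (𝟙 Q) (biprod.desc (0 : T.P₀ ⟶ T.P₁) T.i) ≫ 𝟙 (Q ⊞ T.P₁) by ext <;> simp)

/-- The complex of a resolution with `Q` added to `P₁` and to `P₀`. -/
def foldAddK (Q : 𝒜) [Projective Q] : dsum (complexK Q) T.fold ≅ (T.addK Q).fold :=
  C2.mkIso (M₁ := Q ⊞ T.P₁) (M₀ := Q ⊞ (T.P₀ ⊞ T.P₂)) (N₁ := Q ⊞ T.P₁)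
    (N₀ := (Q ⊞ T.P₀) ⊞ T.P₂) (Iso.refl _) (biprod.associator _ _ _).symm
    (show 𝟙 (Q ⊞ T.P₁) ≫
      biprod.lift (biprod.map (𝟙 Q) T.π ≫ biprod.map (𝟙 Q) T.ι) (0 : Q ⊞ T.P₁ ⟶ T.P₂) =
      biprod.map (𝟙 Q) (biprod.lift (T.π ≫ T.ι) (0 : T.P₁ ⟶ T.P₂)) ≫
        (biprod.associator _ _ _).inv by ext <;> simp)
    (show (biprod.associator _ _ _).inv ≫
      biprod.desc (0 : Q ⊞ T.P₀ ⟶ Q ⊞ T.P₁) (T.i ≫ biprod.inr) =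
        biprod.map (0 : Q ⟶ Q) (biprod.desc (0 : T.P₀ ⟶ T.P₁) T.i) ≫ 𝟙 (Q ⊞ T.P₁) by
      ext <;> simp)

/-- The complexes of isomorphic resolutions are isomorphic. -/
def foldCongr {A' : 𝒜} {T : Res A} {T' : Res A'} (e₂ : T.P₂ ≅ T'.P₂) (e₁ : T.P₁ ≅ T'.P₁)
    (e₀ : T.P₀ ≅ T'.P₀) (c₂ : e₂.hom ≫ T'.i = T.i ≫ e₁.hom)
    (c₁ : e₁.hom ≫ T'.π ≫ T'.ι = T.π ≫ T.ι ≫ e₀.hom) : T.fold ≅ T'.fold :=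
  C2.mkIso e₁ (biprod.mapIso e₀ e₂) (by ext <;> simp [c₁]) (by ext <;> simp [c₂])

end Res

end Resolutions

/-! ### Independence of the resolution -/

section ResolutionClasses

variable (k : Type w) [Field k] [Finite k] {𝒜 : Type u} [Category.{v} 𝒜] [Abelian 𝒜] [Linear k 𝒜]
  [hfin : ∀ X Y : 𝒜, Module.Finite k (X ⟶ Y)]

/-- The normalized class of the complex of a resolution. -/
def resCls {A : 𝒜} (T : Res A) : DH k 𝒜 := normCls k T.isProj_fold T.P₂

theorem resCls_addStar {A : 𝒜} (T : Res A) (Q : 𝒜) [Projective Q] :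
    resCls k (T.addStar Q) = resCls k T := by
  rw [resCls, resCls, ← normCls_dsum_complexKStar k Q T.isProj_fold]
  exact (normCls_congr k _ _ (T.foldAddStar Q) (Iso.refl (Q ⊞ T.P₂))).symm

theorem resCls_addK {A : 𝒜} (T : Res A) (Q : 𝒜) [Projective Q] :
    resCls k (T.addK Q) = resCls k T := by
  rw [resCls, resCls, ← normCls_dsum_complexK k Q T.isProj_fold]
  exact (normCls_congr k _ _ (T.foldAddK Q) (Iso.refl T.P₂)).symm

/-- Two resolutions that agree from the first syzygy on become isomorphic after adding `P₁'` resp.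
`P₁` to the terms in degrees two and one, which does not affect the class. The general case is
reduced to this one by the same argument one step lower. -/
theorem resCls_eq_of_iso_zero {A A' : 𝒜} (T : Res A) (T' : Res A') (e : T.P₀ ≅ T'.P₀)
    (e' : T.Ω ≅ T'.Ω) (h : e'.hom ≫ T'.ι = T.ι ≫ e.hom) : resCls k T = resCls k T' := by
  obtain ⟨Φ, hΦ⟩ := exists_iso_of_projective_epi (T.π ≫ e'.hom) T'.π
  have c : Φ.hom ≫ (T'.addStar T.P₁).π = (T.addStar T'.P₁).π ≫ e'.hom := by
    refine hΦ.trans ?_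
    change _ = biprod.desc 0 T.π ≫ e'.hom
    ext <;> simp
  obtain ⟨a, ha⟩ := exists_iso_left (T.addStar T'.P₁).exact₁ (T'.addStar T.P₁).exact₁ Φ e' c
  rw [← resCls_addStar k T T'.P₁, ← resCls_addStar k T' T.P₁]
  refine normCls_congr k _ _ (Res.foldCongr a Φ e ha ?_) a
  exact ((Category.assoc _ _ _).symm.trans (congrArg (· ≫ T'.ι) c)).trans
    ((Category.assoc _ _ _).trans (congrArg ((T.addStar T'.P₁).π ≫ ·) h))

/-- The class of a resolution depends only on the isomorphism class of the resolved object. -/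
theorem resCls_congr {A A' : 𝒜} (T : Res A) (T' : Res A') (e : A ≅ A') :
    resCls k T = resCls k T' := by
  obtain ⟨Φ, hΦ⟩ := exists_iso_of_projective_epi (T.ε ≫ e.hom) T'.ε
  have c : Φ.hom ≫ (T'.addK T.P₀).ε = (T.addK T'.P₀).ε ≫ e.hom := by
    refine hΦ.trans ?_
    change _ = biprod.desc 0 T.ε ≫ e.hom
    ext <;> simp
  obtain ⟨a, ha⟩ := exists_iso_left (T.addK T'.P₀).exact₀ (T'.addK T.P₀).exact₀ Φ e c
  rw [← resCls_addK k T T'.P₀, ← resCls_addK k T' T.P₀]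
  exact resCls_eq_of_iso_zero k _ _ Φ a ha

/-- Homomorphisms from a projective are additive on short exact sequences. -/
theorem hd_shortExact {P : 𝒜} [Projective P] {X Y Z : 𝒜} {f : X ⟶ Y} {g : Y ⟶ Z} {w : f ≫ g = 0}
    (hS : (ShortComplex.mk f g w).ShortExact) : hd k P Y = hd k P X + hd k P Z := by
  have : Mono f := hS.mono_f
  have : Epi g := hS.epi_g
  have h := (Linear.rightComp k P g).finrank_range_add_finrank_ker
  have hr : LinearMap.range (Linear.rightComp k P g) = ⊤ := by
    rw [LinearMap.range_eq_top]
    exact fun x => ⟨Projective.factorThru x g, Projective.factorThru_comp x g⟩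
  have hk : LinearMap.ker (Linear.rightComp k P g) = LinearMap.range (Linear.rightComp k P f) := by
    ext x
    constructor
    · intro hx
      obtain ⟨y, hy⟩ := exists_lift_of_shortExact hS x hx
      exact ⟨y, hy⟩
    · rintro ⟨y, rfl⟩
      change (y ≫ f) ≫ g = 0
      rw [Category.assoc, w, comp_zero]
  have hi : Function.Injective (Linear.rightComp k P f) := fun x y hxy => by
    rwa [← cancel_mono f]
  rw [hr, finrank_top, hk, LinearMap.finrank_range_of_inj hi] at h
  unfold hd
  omega

theorem hd_res {P : 𝒜} [Projective P] {A : 𝒜} (T : Res A) :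
    hd k P A = hd k P T.P₀ - hd k P T.P₁ + hd k P T.P₂ := by
  have h₁ := hd_shortExact k (P := P) T.exact₁
  have h₀ := hd_shortExact k (P := P) T.exact₀
  omega

/-- The resolution underlying a minimal resolution. -/
def MinimalResolution.toRes {A : 𝒜} (R : MinimalResolution A) : Res A where
  P₂ := R.P₂
  P₁ := R.P₁
  P₀ := R.P₀
  Ω := kernel R.a₀
  proj₂ := inferInstance
  proj₁ := inferInstance
  proj₀ := inferInstance
  i := R.a₂
  π := kernel.lift R.a₀ R.a₁ R.a₁_a₀
  ι := kernel.ι R.a₀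
  ε := R.a₀
  i_π := by ext; simp [R.a₂_a₁]
  ι_ε := kernel.condition _
  exact₁ := by
    have := R.mono
    have := R.cover₁.epi
    have := R.cover₂.epi
    have : IsIso (kernel.lift R.a₁ R.a₂ R.a₂_a₁) := by
      have : Mono (kernel.lift R.a₁ R.a₂ R.a₂_a₁) :=
        mono_of_mono_fac (kernel.lift_ι R.a₁ R.a₂ R.a₂_a₁)
      exact isIso_of_mono_of_epi _
    refine shortExact_of_lift _ _ _ fun T x hx => ⟨kernel.lift R.a₁ x ?_ ≫
      inv (kernel.lift R.a₁ R.a₂ R.a₂_a₁), ?_⟩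
    · have := hx =≫ kernel.ι R.a₀
      simpa using this
    · have e : inv (kernel.lift R.a₁ R.a₂ R.a₂_a₁) ≫ R.a₂ = kernel.ι R.a₁ := by simp
      rw [Category.assoc, e, kernel.lift_ι]
  exact₀ := by
    have := R.cover₀.epi
    exact shortExact_of_lift _ _ _ fun T x hx => ⟨kernel.lift R.a₀ x hx, kernel.lift_ι _ _ _⟩

/-- For projective `P`, `⟨P, A⟩ = hd(P, P₀) - hd(P, P₁) + hd(P, P₂)` is the difference of the
dimensions of maps to the even and odd terms of `C_A`. This turns the exponent of `E_A` into that of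
`normCls`. -/
theorem MinimalResolution.E_eq {A : 𝒜} (R : MinimalResolution A) : R.E k = resCls k R.toRes := by
  have hz : Projective (0 : 𝒜) := (isZero_zero 𝒜).projective
  have h₁ : DH.K k (0 : 𝒜) R.P₁ = (-torusK k R.P₁).exp := by
    change (torusK k (0 : 𝒜)).exp * (-torusK k R.P₁).exp = _
    rw [torusK_zero k (isZero_zero 𝒜), Torus.exp_zero, one_mul]
  have h₂ : DH.K k R.P₂ (0 : 𝒜) = (torusK k R.P₂).exp := by
    change (torusK k R.P₂).exp * (-torusK k (0 : 𝒜)).exp = _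
    rw [torusK_zero k (isZero_zero 𝒜), neg_zero, Torus.exp_zero, mul_one]
  have h₃ : DH.KStar k (0 : 𝒜) R.P₂ = (-torusKStar k R.P₂).exp := by
    change (torusKStar k (0 : 𝒜)).exp * (-torusKStar k R.P₂).exp = _
    rw [torusKStar_zero k (isZero_zero 𝒜), Torus.exp_zero, one_mul]
  have e : ∀ (P : 𝒜) [Projective P], euler k P A - 0 = hd k P (R.P₀ ⊞ R.P₂) - hd k P R.P₁ := by
    intro P _
    rw [euler_eq_hd, hd_res k R.toRes, hd_biprod_right]
    change hd k P R.P₀ - hd k P R.P₁ + hd k P R.P₂ - 0 = _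
    ring
  rw [MinimalResolution.E, h₁, h₂, h₃, ← Torus.exp_add, ← Torus.exp_add, ← sub_eq_add_neg]
  have e₁ := e R.P₁
  have e₂ := e R.P₂
  rw [sub_zero] at e₁ e₂
  rw [e₁, e₂]
  exact normCls_congr k R.isProj_complexC R.toRes.isProj_fold
    (C2.mkIso (Iso.refl R.P₁) (Iso.refl (R.P₀ ⊞ R.P₂))
      (show 𝟙 R.P₁ ≫ biprod.lift (kernel.lift R.a₀ R.a₁ R.a₁_a₀ ≫ kernel.ι R.a₀)
        (0 : R.P₁ ⟶ R.P₂) = biprod.lift R.a₁ 0 ≫ 𝟙 (R.P₀ ⊞ R.P₂) by ext <;> simp)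
      (show 𝟙 (R.P₀ ⊞ R.P₂) ≫ biprod.desc 0 R.a₂ = biprod.desc 0 R.a₂ ≫ 𝟙 R.P₁ by
        ext <;> simp))
    (Iso.refl R.P₂)

end ResolutionClasses

/-- Transport of a resolution along an isomorphism. -/
def Res.ofIso {𝒜 : Type u} [Category.{v} 𝒜] [Abelian 𝒜] {A A' : 𝒜} (T : Res A) (e : A ≅ A') :
    Res A' where
  P₂ := T.P₂
  P₁ := T.P₁
  P₀ := T.P₀
  Ω := T.Ω
  proj₂ := inferInstance
  proj₁ := inferInstance
  proj₀ := inferInstance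
  i := T.i
  π := T.π
  ι := T.ι
  ε := T.ε ≫ e.hom
  i_π := T.i_π
  ι_ε := by rw [reassoc_of% T.ι_ε, zero_comp]
  exact₁ := T.exact₁
  exact₀ := ShortComplex.shortExact_of_iso (S₁ := ShortComplex.mk T.ι T.ε T.ι_ε)
    (ShortComplex.isoMk (Iso.refl _) (Iso.refl _) e (by simp) (by simp)) T.exact₀

/-! ### The Euler form and products in `𝒜` through resolutions -/

section EulerForm

variable (k : Type w) [Field k] {𝒜 : Type u} [Category.{v} 𝒜] [Abelian 𝒜] [Linear k 𝒜]

section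

variable {Ω P A : 𝒜} {i : Ω ⟶ P} {p : P ⟶ A} {w : i ≫ p = 0}
  (hS : (ShortComplex.mk i p w).ShortExact) (C : 𝒜)

include hS in
theorem range_leftComp_eq_ker : LinearMap.range (Linear.leftComp k C p) =
    LinearMap.ker (Linear.leftComp k C i) := by
  have : Epi (ShortComplex.mk i p w).g := hS.epi_g
  ext x
  constructor
  · rintro ⟨y, rfl⟩
    change i ≫ p ≫ y = 0
    rw [reassoc_of% w, zero_comp]
  · intro hx
    exact ⟨hS.exact.desc x hx, hS.exact.g_desc x hx⟩

include hS in
theorem leftComp_injective : Function.Injective (Linear.leftComp k C p) := by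
  have : Epi p := hS.epi_g
  intro x y h
  exact (cancel_epi p).1 h

/-- The connecting homomorphism `Hom(Ω, C) ⟶ Ext¹(A, C)`. -/
def connecting : (Ω ⟶ C) →ₗ[k] Ext A C 1 :=
  (Ext.precompOfLinear hS.extClass k C (add_zero 1)).comp
    (Ext.linearEquiv₀ (R := k) (X := Ω) (Y := C)).symm.toLinearMap

theorem connecting_surjective [Projective P] : Function.Surjective (connecting k hS C) :=
  exists_extClass_comp_eq hS

theorem ker_connecting : LinearMap.ker (connecting k hS C) =
    LinearMap.range (Linear.leftComp k C i) := by
  ext ζ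
  constructor
  · intro h
    obtain ⟨y, hy⟩ := Ext.contravariant_sequence_exact₁ hS C (Ext.mk₀ ζ) (add_zero 1) h
    obtain ⟨x, rfl⟩ := (Ext.mk₀_bijective _ _).2 y
    rw [Ext.mk₀_comp_mk₀] at hy
    exact ⟨x, (Ext.mk₀_bijective _ _).1 hy⟩
  · rintro ⟨x, rfl⟩
    change hS.extClass.comp (Ext.mk₀ (i ≫ x)) (add_zero 1) = 0
    rw [← Ext.mk₀_comp_mk₀]
    exact hS.extClass_comp_assoc _

-- Dimension shifting: the long exact sequence, with the higher `Ext` of the projective `P`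
-- vanishing.
include hS in
theorem finrank_ext_succ [Projective P] (n : ℕ) :
    Module.finrank k (Ext A C (n + 2)) = Module.finrank k (Ext Ω C (n + 1)) := by
  refine (LinearEquiv.finrank_eq (LinearEquiv.ofBijective
    (Ext.precompOfLinear hS.extClass k C (show 1 + (n + 1) = n + 2 by omega)) ⟨?_, ?_⟩)).symm
  · rw [← LinearMap.ker_eq_bot, LinearMap.ker_eq_bot']
    intro x hx
    obtain ⟨y, rfl⟩ := Ext.contravariant_sequence_exact₁ hS C x (by omega) hx
    rw [Ext.eq_zero_of_projective y, Ext.comp_zero]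
  · intro x
    exact Ext.contravariant_sequence_exact₃ hS C x (Ext.eq_zero_of_projective (P := P) _)
      (by omega)

end

variable [hfin : ∀ X Y : 𝒜, Module.Finite k (X ⟶ Y)]

section

variable {Ω P A : 𝒜} {i : Ω ⟶ P} {p : P ⟶ A} {w : i ≫ p = 0}
  (hS : (ShortComplex.mk i p w).ShortExact) (C : 𝒜)

-- The maps `Ω ⟶ C` extending to `P` are those inducing the split extension, so this dimension gives
-- the number of times each class in `Ext¹(A, C)` is hit.
include hS in
theorem finrank_range_leftComp :
    (Module.finrank k (LinearMap.range (Linear.leftComp k C i)) : ℤ) = hd k P C - hd k A C := by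
  have h := (Linear.leftComp k C i).finrank_range_add_finrank_ker
  rw [← range_leftComp_eq_ker k hS C,
    LinearMap.finrank_range_of_inj (leftComp_injective k hS C)] at h
  unfold hd
  omega

include hS in
theorem finrank_ext_one [Projective P] :
    (Module.finrank k (Ext A C 1) : ℤ) = hd k Ω C - hd k P C + hd k A C := by
  have h := (connecting k hS C).finrank_range_add_finrank_ker
  rw [ker_connecting, LinearMap.range_eq_top.2 (connecting_surjective k hS C), finrank_top] at h
  have h' := finrank_range_leftComp k hS C
  have : hd k Ω C = Module.finrank k (Ω ⟶ C) := rfl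
  omega

end

/-- The Euler form in terms of a projective resolution of the first argument. -/
theorem euler_eq_of_res {A : 𝒜} (S : Res A) (C : 𝒜) :
    euler k A C = hd k S.P₀ C - hd k S.P₁ C + hd k S.P₂ C := by
  have h₁ := finrank_ext_one k S.exact₀ C
  have h₂ := finrank_ext_succ k S.exact₀ C 0
  have h₂' := finrank_ext_one k S.exact₁ C
  have h₃ : ∀ n, Module.finrank k (Ext A C (n + 3)) = 0 := by
    intro n
    have := Ext.subsingleton_of_projective S.P₂ C n
    rw [finrank_ext_succ k S.exact₀ C (n + 1), finrank_ext_succ k S.exact₁ C n,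
      Module.finrank_zero_of_subsingleton]
  have h₀ : Module.finrank k (Ext A C 0) = hd k A C := by
    rw [hd, (Ext.linearEquiv₀ (R := k) (X := A) (Y := C)).finrank_eq]
  unfold euler
  rw [finsum_eq_sum_of_support_subset (s := Finset.range 3)]
  · simp only [Finset.sum_range_succ, Finset.sum_range_zero]
    rw [h₀, h₁, h₂, h₂']
    ring
  · intro n hn
    by_contra h
    obtain ⟨m, rfl⟩ : ∃ m, n = m + 3 := ⟨n - 3, by simp at h; omega⟩
    exact hn (by simp [h₃])

variable [Finite k]

variable (𝒜) in
/-- The class of an object in the twisted Hall algebra. -/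
abbrev acls (A : 𝒜) : HallTw k 𝒜 := TwHall.cls ⊤ (sqrtCard k) (euler k) A trivial

/-- The product in the twisted Hall algebra in terms of projective resolutions. -/
theorem acls_mul_acls {A C : 𝒜} (hres : ∀ X : 𝒜, Nonempty (Res X)) (S : Res A) :
    acls k 𝒜 A * acls k 𝒜 C =
      sqrtCard k ^ (euler k A C - 2 * hd k S.P₀ C) •
        ∑ᶠ ζ : S.Ω ⟶ C, acls k 𝒜 (pushout S.ι ζ) := by
  have := finite_hom k S.Ω C
  have ht := sqrtCard_ne_zero k
  have hcard : (Nat.card (LinearMap.range (Linear.leftComp k C S.ι)) : ℂ) =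
      sqrtCard k ^ (2 * (hd k S.P₀ C - hd k A C)) := by
    rw [Module.natCard_eq_pow_finrank (K := k), zpow_mul, ← finrank_range_leftComp k S.exact₀,
      zpow_natCast]
    push_cast
    rw [← sqrtCard_sq]
    norm_cast
  have hfinr : Finite (LinearMap.range (Linear.leftComp k C S.ι)) := inferInstance
  rw [TwHall.cls_mul_cls trivial trivial ?_ (fun ζ : S.Ω ⟶ C => pushout S.ι ζ) (fun _ => trivial)
    (connecting k S.exact₀ C) (extClass_comp_mem_extWithMiddle_pushout S.exact₀)
    (Nat.card (LinearMap.range (Linear.leftComp k C S.ι))) Nat.card_pos.ne' ?_]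
  · congr 1
    -- The multiplicity `t ^ (2 (hd(P₀, C) - hd(A, C)))` times `|Hom(A, C)|` is `t ^ (2 hd(P₀, C))`.
    rw [hcard, natCard_hom k, ← zpow_add₀ ht, ← zpow_neg, ← zpow_add₀ ht]
    congr 1
    ring
  · rintro A' C' ⟨a⟩ ⟨c⟩
    obtain ⟨S'⟩ := hres A'
    rw [euler_eq_of_res k (S'.ofIso a), euler_eq_of_res k S', hd_congr k (Iso.refl S'.P₀) c,
      hd_congr k (Iso.refl S'.P₁) c, hd_congr k (Iso.refl S'.P₂) c]
    rfl
  · intro ξ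
    obtain ⟨ζ₀, rfl⟩ := connecting_surjective k S.exact₀ C ξ
    rw [← ker_connecting k S.exact₀ C]
    exact Nat.card_congr
      { toFun ζ := ⟨ζ.1 - ζ₀, by rw [LinearMap.mem_ker, map_sub, ζ.2, sub_self]⟩
        invFun x := ⟨x.1 + ζ₀, by rw [map_add, LinearMap.mem_ker.1 x.2, zero_add]⟩
        left_inv ζ := by simp
        right_inv x := by simp }

end EulerForm

/-! ### Horseshoe resolutions and the parametrization of cocycles -/

section Horseshoe

variable {𝒜 : Type u} [Category.{v} 𝒜] [Abelian 𝒜]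

/-- It is enough to lift a projective cover of the kernel, in the weak sense of any epimorphism from
a projective. This licenses a chase with elements defined on projectives. -/
theorem epi_kernelLift_of_projective [EnoughProjectives 𝒜] {X Y Z : 𝒜} (f : X ⟶ Y) (g : Y ⟶ Z)
    (w : f ≫ g = 0) (h : ∀ ⦃T : 𝒜⦄ [Projective T] (x : T ⟶ Y), x ≫ g = 0 → ∃ y, y ≫ f = x) :
    Epi (kernel.lift g f w) := by
  obtain ⟨y, hy⟩ := h (Projective.π (kernel g) ≫ kernel.ι g) (by simp)
  have : y ≫ kernel.lift g f w = Projective.π (kernel g) := by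
    rw [← cancel_mono (kernel.ι g), Category.assoc, kernel.lift_ι, hy]
  exact epi_of_epi_fac this

variable {A C : 𝒜} (S : Res A) (T : Res C) {ζ : S.Ω ⟶ C} {z : S.P₁ ⟶ T.P₀} {y : S.P₂ ⟶ T.P₁}

/-- The first differential of the resolution of an extension. -/
def horseshoeDiff (z : S.P₁ ⟶ T.P₀) : T.P₁ ⊞ S.P₁ ⟶ T.P₀ ⊞ S.P₀ :=
  biprod.desc (T.π ≫ T.ι ≫ biprod.inl) (z ≫ biprod.inl + S.π ≫ S.ι ≫ biprod.inr)

/-- The second differential of the resolution of an extension. -/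
def horseshoeInc (y : S.P₂ ⟶ T.P₁) : T.P₂ ⊞ S.P₂ ⟶ T.P₁ ⊞ S.P₁ :=
  biprod.desc (T.i ≫ biprod.inl) (y ≫ biprod.inl + S.i ≫ biprod.inr)

/-- The augmentation of the resolution of an extension. -/
def horseshoeAug (ζ : S.Ω ⟶ C) : T.P₀ ⊞ S.P₀ ⟶ pushout S.ι ζ :=
  biprod.desc (T.ε ≫ pushout.inr S.ι ζ) (pushout.inl S.ι ζ)

theorem horseshoeInc_diff (hy : y ≫ T.π ≫ T.ι + S.i ≫ z = 0) :
    horseshoeInc S T y ≫ horseshoeDiff S T z = 0 := by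
  unfold horseshoeInc horseshoeDiff
  ext
  · simp [reassoc_of% T.i_π]
  · simp [reassoc_of% T.i_π]
  · simpa using hy
  · simp [reassoc_of% S.i_π]

theorem horseshoeDiff_aug (hz : z ≫ T.ε = -(S.π ≫ ζ)) :
    horseshoeDiff S T z ≫ horseshoeAug S T ζ = 0 := by
  unfold horseshoeDiff horseshoeAug
  ext
  · simp [reassoc_of% T.ι_ε]
  · simp [reassoc_of% hz, pushout.condition]

instance : Mono (horseshoeInc S T y) := by
  apply Preadditive.mono_of_cancel_zero
  intro X g hg
  have h₂ : g ≫ biprod.snd = 0 := by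
    rw [← cancel_mono S.i, zero_comp, ← zero_comp (f := biprod.snd), ← hg]
    simp only [Category.assoc]
    congr 1
    unfold horseshoeInc
    ext <;> simp
  have h₁ : g ≫ biprod.fst = 0 := by
    have e : g ≫ biprod.fst ≫ T.i = 0 := by
      have : biprod.fst ≫ T.i = horseshoeInc S T y ≫ biprod.fst - biprod.snd ≫ y := by
        unfold horseshoeInc
        ext <;> simp
      rw [this, Preadditive.comp_sub, reassoc_of% hg, reassoc_of% h₂]
      simp
    rw [← cancel_mono T.i, zero_comp, Category.assoc, e]
  ext <;> simp [h₁, h₂]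

instance : Epi (horseshoeAug S T ζ) := by
  apply Preadditive.epi_of_cancel_zero
  intro X g hg
  have h₁ := biprod.inl ≫= hg
  have h₂ := biprod.inr ≫= hg
  simp only [horseshoeAug, biprod.inl_desc_assoc, biprod.inr_desc_assoc, comp_zero,
    Category.assoc] at h₁ h₂
  apply pushout.hom_ext
  · rw [h₂, comp_zero]
  · rw [← cancel_epi T.ε, h₁, comp_zero, comp_zero]

/-- The horseshoe lemma. -/
def horseshoe [EnoughProjectives 𝒜] (hz : z ≫ T.ε = -(S.π ≫ ζ))
    (hy : y ≫ T.π ≫ T.ι + S.i ≫ z = 0) : Res (pushout S.ι ζ) where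
  P₂ := T.P₂ ⊞ S.P₂
  P₁ := T.P₁ ⊞ S.P₁
  P₀ := T.P₀ ⊞ S.P₀
  Ω := kernel (horseshoeAug S T ζ)
  proj₂ := inferInstance
  proj₁ := inferInstance
  proj₀ := inferInstance
  i := horseshoeInc S T y
  π := kernel.lift _ (horseshoeDiff S T z) (horseshoeDiff_aug S T hz)
  ι := kernel.ι _
  ε := horseshoeAug S T ζ
  i_π := by
    rw [← cancel_mono (kernel.ι _), Category.assoc, kernel.lift_ι, zero_comp]
    exact horseshoeInc_diff S T hy
  ι_ε := kernel.condition _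
  exact₁ := by
    -- The component of `x` in `S.P₀` dies in `A`, so it lifts to `s'` with values in `S.P₁`. After
    -- subtracting `s' ≫ z`, the component in `T.P₀` dies in `C`, because `C` embeds in the pushout,
    -- and hence lifts to `T.P₁`.
    have := epi_kernelLift_of_projective _ _ (horseshoeDiff_aug S T hz) (by
      intro X _ x hx
      obtain ⟨g, w', hg, hS'⟩ := shortExact_pushout S.exact₀ ζ
      have : Mono (pushout.inr S.ι ζ) := hS'.mono_f
      have hp : (x ≫ biprod.snd) ≫ S.ε = 0 := by
        have h := hx =≫ g
        rw [zero_comp, Category.assoc] at h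
        rw [← h, Category.assoc]
        congr 1
        unfold horseshoeAug
        ext <;> simp [hg, w']
      obtain ⟨s, hs⟩ := exists_lift_of_shortExact S.exact₀ _ hp
      obtain ⟨s', rfl⟩ : ∃ s', s' ≫ S.π = s :=
        ⟨Projective.factorThru s S.π, Projective.factorThru_comp s S.π⟩
      have hq : (x ≫ biprod.fst - s' ≫ z) ≫ T.ε = 0 := by
        rw [← cancel_mono (pushout.inr S.ι ζ), zero_comp, Preadditive.sub_comp,
          Preadditive.sub_comp, Category.assoc s', hz, Preadditive.comp_neg, Preadditive.neg_comp,
          sub_neg_eq_add, Category.assoc, Category.assoc, Category.assoc, Category.assoc,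
          ← pushout.condition]
        rw [Category.assoc] at hs
        rw [reassoc_of% hs, ← Preadditive.comp_add, ← hx]
        congr 1
        unfold horseshoeAug
        ext <;> simp
      obtain ⟨r, hr⟩ := exists_lift_of_shortExact T.exact₀ _ hq
      obtain ⟨r', rfl⟩ : ∃ r', r' ≫ T.π = r :=
        ⟨Projective.factorThru r T.π, Projective.factorThru_comp r T.π⟩
      refine ⟨biprod.lift r' s', ?_⟩
      rw [Category.assoc] at hs hr
      unfold horseshoeDiff
      ext
      · simp [hr]
      · simp [hs])
    refine shortExact_of_lift _ _ _ fun X x hx => ?_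
    have hx' : x ≫ horseshoeDiff S T z = 0 := by
      have := hx =≫ kernel.ι _
      simpa using this
    have h₁ : (x ≫ biprod.snd) ≫ S.π = 0 := by
      rw [← cancel_mono S.ι, zero_comp, ← zero_comp (f := biprod.snd), ← hx']
      simp only [Category.assoc]
      congr 1
      unfold horseshoeDiff
      ext <;> simp
    obtain ⟨s, hs⟩ := exists_lift_of_shortExact S.exact₁ _ h₁
    have h₂ : (x ≫ biprod.fst - s ≫ y) ≫ T.π = 0 := by
      have e : y ≫ T.π ≫ T.ι = -(S.i ≫ z) := eq_neg_of_add_eq_zero_left hy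
      rw [← cancel_mono T.ι, zero_comp, Category.assoc, Preadditive.sub_comp, Category.assoc,
        Category.assoc, e, Preadditive.comp_neg, sub_neg_eq_add, reassoc_of% hs,
        ← Preadditive.comp_add, ← zero_comp (f := biprod.fst), ← hx', Category.assoc]
      congr 1
      unfold horseshoeDiff
      ext <;> simp
    obtain ⟨r, hr⟩ := exists_lift_of_shortExact T.exact₁ _ h₂
    refine ⟨biprod.lift r s, ?_⟩
    unfold horseshoeInc
    ext
    · simp [hr]
    · simp [hs]
  exact₀ := shortExact_of_lift _ _ _ fun T x hx => ⟨kernel.lift _ x hx, kernel.lift_ι _ _ _⟩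

/-- The odd cocycle given by a chain map up to sign and a map `P₀ ⟶ Q₂`. -/
def resCocycle (x : S.P₀ ⟶ T.P₂) (hy : y ≫ T.π ≫ T.ι + S.i ≫ z = 0) :
    cocycles S.fold T.fold :=
  ⟨(show S.P₀ ⊞ S.P₂ ⟶ T.P₁ from biprod.desc (x ≫ T.i) y,
    show S.P₁ ⟶ T.P₀ ⊞ T.P₂ from biprod.lift z (-(S.π ≫ S.ι ≫ x))),
    show biprod.lift z (-(S.π ≫ S.ι ≫ x)) ≫ biprod.desc (0 : T.P₀ ⟶ T.P₁) T.i +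
      biprod.lift (S.π ≫ S.ι) (0 : S.P₁ ⟶ S.P₂) ≫ biprod.desc (x ≫ T.i) y = 0 by simp,
    show biprod.desc (x ≫ T.i) y ≫ biprod.lift (T.π ≫ T.ι) (0 : T.P₁ ⟶ T.P₂) +
      biprod.desc (0 : S.P₀ ⟶ S.P₁) S.i ≫ biprod.lift z (-(S.π ≫ S.ι ≫ x)) = 0 by
      ext <;> simp [reassoc_of% T.i_π, reassoc_of% S.i_π, hy]⟩

/-- The extension of complexes given by a cocycle is the complex of the resolution of an
extension. -/
def coneResCocycle [EnoughProjectives 𝒜] (x : S.P₀ ⟶ T.P₂) (hz : z ≫ T.ε = -(S.π ≫ ζ))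
    (hy : y ≫ T.π ≫ T.ι + S.i ≫ z = 0) :
    cone (resCocycle S T x hy) ≅ (horseshoe S T hz hy).fold :=
  C2.mkIso (M₁ := T.P₁ ⊞ S.P₁) (N₁ := T.P₁ ⊞ S.P₁) (M₀ := (T.P₀ ⊞ T.P₂) ⊞ (S.P₀ ⊞ S.P₂))
    (N₀ := (T.P₀ ⊞ S.P₀) ⊞ (T.P₂ ⊞ S.P₂)) (Iso.refl _)
    -- The part of the cocycle given by `x` is the coboundary of `x : P₀ ⟶ Q₂`, and it is absorbed
    -- by this change of coordinates.
    { hom := biprod.lift (biprod.map biprod.fst biprod.fst)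
        (biprod.map biprod.snd biprod.snd + biprod.snd ≫ biprod.fst ≫ x ≫ biprod.inl)
      inv := biprod.lift (biprod.map biprod.fst biprod.fst)
        (biprod.map biprod.snd biprod.snd) -
          biprod.fst ≫ biprod.snd ≫ x ≫ biprod.inr ≫ biprod.inl
      hom_inv_id := by ext <;> simp
      inv_hom_id := by ext <;> simp }
    (show 𝟙 (T.P₁ ⊞ S.P₁) ≫ biprod.lift (kernel.lift _ (horseshoeDiff S T z)
        (horseshoeDiff_aug S T hz) ≫ kernel.ι _) (0 : T.P₁ ⊞ S.P₁ ⟶ T.P₂ ⊞ S.P₂) =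
      (biprod.map (biprod.lift (T.π ≫ T.ι) (0 : T.P₁ ⟶ T.P₂))
        (biprod.lift (S.π ≫ S.ι) (0 : S.P₁ ⟶ S.P₂)) +
          (biprod.snd : T.P₁ ⊞ S.P₁ ⟶ S.P₁) ≫ biprod.lift z (-(S.π ≫ S.ι ≫ x)) ≫
            (biprod.inl : T.P₀ ⊞ T.P₂ ⟶ (T.P₀ ⊞ T.P₂) ⊞ (S.P₀ ⊞ S.P₂))) ≫
        biprod.lift (biprod.map biprod.fst biprod.fst)
          (biprod.map biprod.snd biprod.snd + biprod.snd ≫ biprod.fst ≫ x ≫ biprod.inl) by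
      rw [kernel.lift_ι, horseshoeDiff]
      ext <;> simp)
    (show biprod.lift (biprod.map biprod.fst biprod.fst)
        (biprod.map biprod.snd biprod.snd + biprod.snd ≫ biprod.fst ≫ x ≫ biprod.inl) ≫
        biprod.desc (0 : T.P₀ ⊞ S.P₀ ⟶ T.P₁ ⊞ S.P₁) (horseshoeInc S T y) =
      (biprod.map (biprod.desc (0 : T.P₀ ⟶ T.P₁) T.i) (biprod.desc (0 : S.P₀ ⟶ S.P₁) S.i) +
        (biprod.snd : (T.P₀ ⊞ T.P₂) ⊞ (S.P₀ ⊞ S.P₂) ⟶ S.P₀ ⊞ S.P₂) ≫ biprod.desc (x ≫ T.i) y ≫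
          (biprod.inl : T.P₁ ⟶ T.P₁ ⊞ S.P₁)) ≫ 𝟙 (T.P₁ ⊞ S.P₁) by
      rw [horseshoeInc]
      ext <;> simp)

/-- A choice of the component `P₁ ⟶ Q₀` of a cocycle. -/
def cocycleLift₁ (a : (S.Ω ⟶ C) × (S.P₁ ⟶ T.Ω)) : S.P₁ ⟶ T.P₀ :=
  Projective.factorThru (-(S.π ≫ a.1)) T.ε + a.2 ≫ T.ι

theorem cocycleLift₁_ε (a : (S.Ω ⟶ C) × (S.P₁ ⟶ T.Ω)) :
    cocycleLift₁ S T a ≫ T.ε = -(S.π ≫ a.1) := by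
  simp [cocycleLift₁, T.ι_ε]

theorem exists_cocycleLift₂ (a : (S.Ω ⟶ C) × (S.P₁ ⟶ T.Ω)) :
    ∃ y : S.P₂ ⟶ T.P₁, y ≫ T.π ≫ T.ι + S.i ≫ cocycleLift₁ S T a = 0 := by
  obtain ⟨l, hl⟩ := exists_lift_of_shortExact T.exact₀ (S.i ≫ cocycleLift₁ S T a) (by
    rw [Category.assoc, cocycleLift₁_ε, Preadditive.comp_neg, reassoc_of% S.i_π, zero_comp,
      neg_zero])
  refine ⟨Projective.factorThru (-l) T.π, ?_⟩
  rw [← Category.assoc, Projective.factorThru_comp, Preadditive.neg_comp, hl, neg_add_cancel]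

/-- A choice of the component `P₂ ⟶ Q₁` of a cocycle. -/
def cocycleLift₂ (a : (S.Ω ⟶ C) × (S.P₁ ⟶ T.Ω)) (b : S.P₂ ⟶ T.P₂) : S.P₂ ⟶ T.P₁ :=
  (exists_cocycleLift₂ S T a).choose + b ≫ T.i

theorem cocycleLift₂_comp (a : (S.Ω ⟶ C) × (S.P₁ ⟶ T.Ω)) (b : S.P₂ ⟶ T.P₂) :
    cocycleLift₂ S T a b ≫ T.π ≫ T.ι + S.i ≫ cocycleLift₁ S T a = 0 := by
  rw [cocycleLift₂, Preadditive.add_comp, Category.assoc, reassoc_of% T.i_π, zero_comp, comp_zero,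
    add_zero, (exists_cocycleLift₂ S T a).choose_spec]

/-- The parametrization of the odd cocycles between the complexes of two resolutions. -/
def cocycleParam (a : ((S.Ω ⟶ C) × (S.P₁ ⟶ T.Ω)) × (S.P₂ ⟶ T.P₂) × (S.P₀ ⟶ T.P₂)) :
    cocycles S.fold T.fold :=
  resCocycle S T a.2.2 (cocycleLift₂_comp S T a.1 a.2.1)

/-- Given `ζ`, the component `P₁ ⟶ Q₀` is a lift of `-(S.π ≫ ζ)`, unique up to maps into the syzygy
of `C`. Then `P₂ ⟶ Q₁` is determined up to maps `P₂ ⟶ Q₂`, and the two remaining components are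
given by a map `P₀ ⟶ Q₂`. -/
theorem cocycleParam_bijective : Function.Bijective (cocycleParam S T) := by
  constructor
  · rintro ⟨⟨ζ, c⟩, b, x⟩ ⟨⟨ζ', c'⟩, b', x'⟩ h
    have h₁ : biprod.desc (x ≫ T.i) (cocycleLift₂ S T (ζ, c) b) =
        biprod.desc (x' ≫ T.i) (cocycleLift₂ S T (ζ', c') b') :=
      congrArg (fun h : cocycles S.fold T.fold => h.1.1) h
    have h₂ : biprod.lift (cocycleLift₁ S T (ζ, c)) (-(S.π ≫ S.ι ≫ x)) =
        biprod.lift (cocycleLift₁ S T (ζ', c')) (-(S.π ≫ S.ι ≫ x')) :=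
      congrArg (fun h : cocycles S.fold T.fold => h.1.2) h
    have hx : x = x' := by
      have := biprod.inl ≫= h₁
      simpa [cancel_mono] using this
    have hL : cocycleLift₁ S T (ζ, c) = cocycleLift₁ S T (ζ', c') := by
      have := h₂ =≫ biprod.fst
      simpa using this
    have hζ : ζ = ζ' := by
      have := congrArg (· ≫ T.ε) hL
      rw [cocycleLift₁_ε, cocycleLift₁_ε, neg_inj, cancel_epi] at this
      exact this
    subst hζ
    have hc : c = c' := by
      rw [cocycleLift₁, cocycleLift₁, add_right_inj, cancel_mono] at hL
      exact hL
    subst hc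
    have hb : b = b' := by
      have := biprod.inr ≫= h₁
      rw [biprod.inr_desc, biprod.inr_desc, cocycleLift₂, cocycleLift₂, add_right_inj,
        cancel_mono] at this
      exact this
    rw [hb, hx]
  · intro h
    let h₀ : S.P₀ ⊞ S.P₂ ⟶ T.P₁ := h.1.1
    let h₁ : S.P₁ ⟶ T.P₀ ⊞ T.P₂ := h.1.2
    have r₁ : h₁ ≫ biprod.desc (0 : T.P₀ ⟶ T.P₁) T.i +
        biprod.lift (S.π ≫ S.ι) (0 : S.P₁ ⟶ S.P₂) ≫ h₀ = 0 := cocycles_rel₁ h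
    have r₀ : h₀ ≫ biprod.lift (T.π ≫ T.ι) (0 : T.P₁ ⟶ T.P₂) +
        biprod.desc (0 : S.P₀ ⟶ S.P₁) S.i ≫ h₁ = 0 := cocycles_rel₀ h
    have r₂ : (biprod.inl ≫ h₀) ≫ T.π = 0 := by
      rw [← cancel_mono T.ι]
      have := congrArg (fun f => biprod.inl ≫ f ≫ biprod.fst) r₀
      simpa using this
    have r₃ : (biprod.inr ≫ h₀) ≫ T.π ≫ T.ι + S.i ≫ h₁ ≫ biprod.fst = 0 := by
      have := congrArg (fun f => biprod.inr ≫ f ≫ biprod.fst) r₀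
      simpa using this
    obtain ⟨x, hx⟩ := exists_lift_of_shortExact T.exact₁ _ r₂
    -- The other cocycle equation, read after the monomorphism `T.i`, forces the component `P₁ ⟶
    -- Q₂`.
    have hw : h₁ ≫ biprod.snd = -(S.π ≫ S.ι ≫ x) := by
      rw [← cancel_mono T.i, Preadditive.neg_comp, Category.assoc, Category.assoc, Category.assoc,
        hx, eq_neg_iff_add_eq_zero, ← r₁]
      congr 1
      · congr 1
        ext <;> simp
      · rw [← Category.assoc, ← Category.assoc]
        congr 1
        ext <;> simp
    -- The component `P₁ ⟶ Q₀` followed by the augmentation vanishes on `P₂`, so up to sign it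
    -- factors through the syzygy of `A`; the factor is `ζ`.
    have hζ : S.i ≫ (-(h₁ ≫ biprod.fst ≫ T.ε)) = 0 := by
      have := congrArg (· ≫ T.ε) r₃
      simp only [Preadditive.add_comp, Category.assoc, T.ι_ε, comp_zero, zero_add,
        zero_comp] at this
      rw [Preadditive.comp_neg, this, neg_zero]
    have : Epi (ShortComplex.mk S.i S.π S.i_π).g := S.exact₁.epi_g
    obtain ⟨ζ, hζ'⟩ : ∃ ζ : S.Ω ⟶ C, S.π ≫ ζ = -(h₁ ≫ biprod.fst ≫ T.ε) :=
      ⟨S.exact₁.exact.desc _ hζ, S.exact₁.exact.g_desc _ _⟩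
    obtain ⟨c, hc⟩ := exists_lift_of_shortExact T.exact₀
      (h₁ ≫ biprod.fst - Projective.factorThru (-(S.π ≫ ζ)) T.ε) (by simp [hζ'])
    have hL : cocycleLift₁ S T (ζ, c) = h₁ ≫ biprod.fst := by
      simp [cocycleLift₁, hc]
    obtain ⟨b, hb⟩ := exists_lift_of_shortExact T.exact₁
      (biprod.inr ≫ h₀ - (exists_cocycleLift₂ S T (ζ, c)).choose) (by
        have := (exists_cocycleLift₂ S T (ζ, c)).choose_spec
        rw [← cancel_mono T.ι, zero_comp, Category.assoc, Preadditive.sub_comp, sub_eq_zero]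
        rw [← hL] at r₃
        rw [← Category.assoc, Category.assoc]
        exact add_right_cancel (r₃.trans this.symm))
    have hM : cocycleLift₂ S T (ζ, c) b = biprod.inr ≫ h₀ := by
      simp [cocycleLift₂, hb]
    refine ⟨((ζ, c), b, x), Subtype.ext (Prod.ext ?_ ?_)⟩
    · change biprod.desc (x ≫ T.i) (cocycleLift₂ S T (ζ, c) b) = h₀
      ext <;> simp [hx, hM]
    · change biprod.lift (cocycleLift₁ S T (ζ, c)) (-(S.π ≫ S.ι ≫ x)) = h₁
      ext <;> simp [hL, hw]

end Horseshoe

/-! ### Comparison of the two products -/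

section Multiplicativity

variable (k : Type w) [Field k] [Finite k] {𝒜 : Type u} [Category.{v} 𝒜] [Abelian 𝒜] [Linear k 𝒜]
  [hfin : ∀ X Y : 𝒜, Module.Finite k (X ⟶ Y)]

/-- The element of the torus in the normalized class of a resolution. -/
def resTorus {A : 𝒜} (T : Res A) : Torus k 𝒜 :=
  -torusK k T.P₁ + torusK k T.P₂ - torusKStar k T.P₂

omit [Finite k] hfin in
/-- The exponent of `t` in the normalized class of a resolution. -/
def resExp {A : 𝒜} (T : Res A) : ℤ :=
  hd k T.P₁ (T.P₀ ⊞ T.P₂) - hd k T.P₁ T.P₁ - 2 * (hd k T.P₂ (T.P₀ ⊞ T.P₂) - hd k T.P₂ T.P₁)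

theorem resCls_eq {A : 𝒜} (T : Res A) : resCls k T =
    sqrtCard k ^ resExp k T • ((resTorus k T).exp * DH.cls k T.fold T.isProj_fold) := rfl

theorem cls_fold {A : 𝒜} (T : Res A) : DH.cls k T.fold T.isProj_fold =
    sqrtCard k ^ (-resExp k T) • ((-resTorus k T).exp * resCls k T) := by
  rw [resCls_eq, mul_smul_comm, smul_smul, ← zpow_add₀ (sqrtCard_ne_zero k), neg_add_cancel,
    zpow_zero, one_smul, ← mul_assoc, Torus.exp_neg_mul, one_mul]

omit [Finite k] hfin in
/-- The exponent in the commutation of the torus element of `T` with the complex of `S`. -/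
def resSkew {A C : 𝒜} (S : Res A) (T : Res C) : ℤ :=
  -(hd k S.P₁ T.P₁ - hd k (S.P₀ ⊞ S.P₂) T.P₁ - (hd k T.P₁ (S.P₀ ⊞ S.P₂) - hd k T.P₁ S.P₁)) +
    2 * (hd k S.P₁ T.P₂ - hd k (S.P₀ ⊞ S.P₂) T.P₂ -
      (hd k T.P₂ (S.P₀ ⊞ S.P₂) - hd k T.P₂ S.P₁))

theorem skew_resTorus {A C : 𝒜} (S : Res A) (T : Res C) :
    Skew (resSkew k S T) (resTorus k T) (DH.cls k S.fold S.isProj_fold) := by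
  have h := (((skew_torusK k T.P₁ S.isProj_fold).neg).add
    (skew_torusK k T.P₂ S.isProj_fold)).sub (skew_torusKStar k T.P₂ S.isProj_fold)
  convert h using 1
  swap
  · rfl
  change resSkew k S T = -(hd k S.P₁ T.P₁ - hd k (S.P₀ ⊞ S.P₂) T.P₁ -
      (hd k T.P₁ (S.P₀ ⊞ S.P₂) - hd k T.P₁ S.P₁)) +
    (hd k S.P₁ T.P₂ - hd k (S.P₀ ⊞ S.P₂) T.P₂ -
      (hd k T.P₂ (S.P₀ ⊞ S.P₂) - hd k T.P₂ S.P₁)) -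
    (hd k (S.P₀ ⊞ S.P₂) T.P₂ - hd k S.P₁ T.P₂ -
      (hd k T.P₂ S.P₁ - hd k T.P₂ (S.P₀ ⊞ S.P₂)))
  unfold resSkew
  ring

/-- Moving the torus element of `T` to the left past the complex of `S` costs `t ^ resSkew k S T`
and leaves the product of two honest complexes. -/
theorem resCls_mul_eq {A C : 𝒜} (S : Res A) (T : Res C) : resCls k S * resCls k T =
    sqrtCard k ^ (resExp k S + resExp k T + resSkew k S T) • ((resTorus k S + resTorus k T).exp *
      (DH.cls k S.fold S.isProj_fold * DH.cls k T.fold T.isProj_fold)) := by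
  have h : DH.cls k S.fold S.isProj_fold * (resTorus k T).exp = _ := skew_resTorus k S T
  have ht := sqrtCard_ne_zero k
  rw [resCls_eq, resCls_eq, smul_mul_smul_comm, ← zpow_add₀ ht, mul_assoc, ← mul_assoc (DH.cls k _ _),
    h, smul_mul_assoc, mul_smul_comm, smul_smul, ← zpow_add₀ ht, mul_assoc, ← mul_assoc,
    ← Torus.exp_add]

theorem cls_mul_cls {M N : C2 𝒜} (hM : isProj 𝒜 M) (hN : isProj 𝒜 N) :
    DH.cls k M hM * DH.cls k N hN =
      sqrtCard k ^ (-(hd k (M.X 0) (N.X 0) + hd k (M.X 1) (N.X 1))) •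
        ∑ᶠ h : cocycles M N, DH.cls k (cone h) (isProj_cone hM hN h) := by
  have := finite_cocycles k M N
  unfold DH.cls
  rw [← Loc.of_mul, hcls_mul_hcls, Loc.of_smul, zpow_neg]
  congr 1
  exact (Loc.ofLinear (acyclicSet k 𝒜)).toAddMonoidHom.map_finsum (Set.toFinite _)

variable (hres : ∀ X : 𝒜, Nonempty (Res X))

/-- The linear map sending `[A]` to the normalized class of a projective resolution of `A`. -/
def resHom : HallTw k 𝒜 →ₗ[ℂ] DH k 𝒜 :=
  (TwHall.basis ⊤ (sqrtCard k) (euler k)).constr ℂ fun a => resCls k (hres a.rep).some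

theorem resHom_acls {A : 𝒜} (T : Res A) : resHom k hres (acls k 𝒜 A) = resCls k T := by
  obtain ⟨e⟩ := nonempty_rep_iso (P := (⊤ : ObjectProperty 𝒜)) A trivial
  unfold acls resHom
  rw [TwHall.cls_eq_basis, Module.Basis.constr_basis]
  exact resCls_congr k _ _ e

/-- The horseshoe resolution has terms `Qᵢ ⊕ Pᵢ` whatever the cocycle is, so the torus element and
the exponent are constant; only the class of the pushout varies, and it depends on `ζ` alone. -/
theorem cls_cone_cocycleParam [EnoughProjectives 𝒜] {A C : 𝒜} (S : Res A) (T : Res C)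
    (a : ((S.Ω ⟶ C) × (S.P₁ ⟶ T.Ω)) × (S.P₂ ⟶ T.P₂) × (S.P₀ ⟶ T.P₂)) :
    DH.cls k (cone (cocycleParam S T a)) (isProj_cone S.isProj_fold T.isProj_fold _) =
      sqrtCard k ^ (-(hd k (T.P₁ ⊞ S.P₁) ((T.P₀ ⊞ S.P₀) ⊞ (T.P₂ ⊞ S.P₂)) -
        hd k (T.P₁ ⊞ S.P₁) (T.P₁ ⊞ S.P₁) -
        2 * (hd k (T.P₂ ⊞ S.P₂) ((T.P₀ ⊞ S.P₀) ⊞ (T.P₂ ⊞ S.P₂)) -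
          hd k (T.P₂ ⊞ S.P₂) (T.P₁ ⊞ S.P₁)))) •
        ((-(resTorus k S + resTorus k T)).exp *
          resHom k hres (acls k 𝒜 (pushout S.ι a.1.1))) := by
  refine (DH.cls_congr k _ (Res.isProj_fold _) (coneResCocycle S T a.2.2 (cocycleLift₁_ε S T a.1)
    (cocycleLift₂_comp S T a.1 a.2.1))).trans ?_
  rw [cls_fold, resHom_acls k hres (horseshoe S T
      (cocycleLift₁_ε S T a.1) (cocycleLift₂_comp S T a.1 a.2.1))]
  have e : resTorus k S + resTorus k T = -torusK k (T.P₁ ⊞ S.P₁) + torusK k (T.P₂ ⊞ S.P₂) -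
      torusKStar k (T.P₂ ⊞ S.P₂) := by
    unfold resTorus
    rw [torusK_biprod, torusK_biprod, torusKStar_biprod]
    abel
  rw [e]
  rfl

theorem finsum_prod_fst {α β M : Type*} [Finite α] [Finite β] [AddCommGroup M] [Module ℂ M]
    (f : α → M) : ∑ᶠ x : α × β, f x.1 = (Nat.card β : ℂ) • ∑ᶠ a, f a := by
  classical
  haveI := Fintype.ofFinite α
  haveI := Fintype.ofFinite β
  rw [finsum_eq_sum_of_fintype, finsum_eq_sum_of_fintype, Fintype.sum_prod_type, Finset.smul_sum]
  refine Finset.sum_congr rfl fun a _ => ?_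
  simp [Nat.card_eq_fintype_card, Nat.cast_smul_eq_nsmul]

theorem hd_add_hd {P : 𝒜} [Projective P] {A : 𝒜} (T : Res A) :
    hd k P T.Ω = hd k P T.P₁ - hd k P T.P₂ := by
  have := hd_shortExact k (P := P) T.exact₁
  omega

theorem resCls_mul_resCls [EnoughProjectives 𝒜] {A C : 𝒜} (S : Res A) (T : Res C) :
    resCls k S * resCls k T = resHom k hres (acls k 𝒜 A * acls k 𝒜 C) := by
  have ht := sqrtCard_ne_zero k
  have := finite_hom k S.Ω C
  have := finite_hom k S.P₁ T.Ω
  have := finite_hom k S.P₂ T.P₂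
  have := finite_hom k S.P₀ T.P₂
  have key : ∑ᶠ h : cocycles S.fold T.fold, DH.cls k (cone h)
      (isProj_cone S.isProj_fold T.isProj_fold h) =
      sqrtCard k ^ (-(hd k (T.P₁ ⊞ S.P₁) ((T.P₀ ⊞ S.P₀) ⊞ (T.P₂ ⊞ S.P₂)) -
        hd k (T.P₁ ⊞ S.P₁) (T.P₁ ⊞ S.P₁) -
        2 * (hd k (T.P₂ ⊞ S.P₂) ((T.P₀ ⊞ S.P₀) ⊞ (T.P₂ ⊞ S.P₂)) -
          hd k (T.P₂ ⊞ S.P₂) (T.P₁ ⊞ S.P₁))) +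
        (2 * hd k S.P₁ T.Ω + (2 * hd k S.P₂ T.P₂ + 2 * hd k S.P₀ T.P₂))) •
      ((-(resTorus k S + resTorus k T)).exp *
        ∑ᶠ ζ : S.Ω ⟶ C, resHom k hres (acls k 𝒜 (pushout S.ι ζ))) := by
    -- The summand depends only on `ζ`; the other three parameters contribute the cardinalities of
    -- their spaces of maps.
    rw [← finsum_comp_equiv (Equiv.ofBijective _ (cocycleParam_bijective S T))]
    simp only [Equiv.ofBijective_apply, cls_cone_cocycleParam k hres]
    rw [finsum_prod_fst (fun x : (S.Ω ⟶ C) × (S.P₁ ⟶ T.Ω) => _ • (_ *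
      resHom k hres (acls k 𝒜 (pushout S.ι x.1)))),
      finsum_prod_fst (fun ζ : S.Ω ⟶ C => _ • (_ * resHom k hres (acls k 𝒜 (pushout S.ι ζ))))]
    rw [← smul_finsum' _ (Set.toFinite _), ← mul_finsum' _ _ (Set.toFinite _), smul_smul,
      smul_smul, Nat.card_prod]
    congr 1
    push_cast
    rw [natCard_hom k, natCard_hom k, natCard_hom k, zpow_add₀ ht, zpow_add₀ ht, zpow_add₀ ht]
    ring
  rw [resCls_mul_eq, cls_mul_cls, key, acls_mul_acls k hres S, map_smul]
  have hsum : resHom k hres (∑ᶠ ζ : S.Ω ⟶ C, acls k 𝒜 (pushout S.ι ζ)) =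
      ∑ᶠ ζ : S.Ω ⟶ C, resHom k hres (acls k 𝒜 (pushout S.ι ζ)) :=
    (resHom k hres).toAddMonoidHom.map_finsum (Set.toFinite _)
  rw [hsum, mul_smul_comm, mul_smul_comm, ← mul_assoc, Torus.exp_mul_neg, one_mul, smul_smul,
    smul_smul, ← zpow_add₀ ht, ← zpow_add₀ ht]
  congr 2
  change resExp k S + resExp k T + resSkew k S T + -(hd k (S.P₀ ⊞ S.P₂) (T.P₀ ⊞ T.P₂) +
    hd k S.P₁ T.P₁) + _ = _
  -- Every exponent is now expressed by dimensions of maps between the terms of `S` and `T`, and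
  -- what remains is a linear identity in these integers.
  rw [euler_eq_of_res k S, hd_res k T, hd_res k T, hd_res k T, hd_add_hd k T]
  unfold resExp resSkew
  simp only [hd_biprod_left, hd_biprod_right]
  ring

end Multiplicativity

/-! ### Multiplication and unit under the homomorphism -/

section AlgebraHomomorphism

variable (k : Type w) [Field k] [Finite k] {𝒜 : Type u} [Category.{v} 𝒜] [Abelian 𝒜] [Linear k 𝒜]
  [hfin : ∀ X Y : 𝒜, Module.Finite k (X ⟶ Y)]

theorem resHom_mul [EnoughProjectives 𝒜] (hres : ∀ X : 𝒜, Nonempty (Res X)) (x y : HallTw k 𝒜) :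
    resHom k hres (x * y) = resHom k hres x * resHom k hres y := by
  induction x using TwHall.induction with
  | zero => rw [zero_mul, map_zero, zero_mul]
  | add x x' hx hx' => rw [add_mul, map_add, map_add, add_mul, hx, hx']
  | smul c x hx => rw [smul_mul_assoc, map_smul, map_smul, smul_mul_assoc, hx]
  | cls A hA =>
    induction y using TwHall.induction with
    | zero => rw [mul_zero, map_zero, mul_zero]
    | add x x' hx hx' => rw [mul_add, map_add, map_add, mul_add, hx, hx']
    | smul c x hx => rw [mul_smul_comm, map_smul, map_smul, mul_smul_comm, hx]
    | cls C hC =>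
      obtain ⟨S⟩ := hres A
      obtain ⟨T⟩ := hres C
      rw [← resCls_mul_resCls k hres S T, resHom_acls k hres S, resHom_acls k hres T]

omit [Finite k] [Linear k 𝒜] hfin in
/-- The zero resolution. -/
def zeroRes {Z : 𝒜} (h : IsZero Z) : Res Z where
  P₂ := Z
  P₁ := Z
  P₀ := Z
  Ω := Z
  proj₂ := h.projective
  proj₁ := h.projective
  proj₀ := h.projective
  i := 0
  π := 0
  ι := 0
  ε := 0
  i_π := zero_comp
  ι_ε := zero_comp
  exact₁ :=
    haveI : Mono (0 : Z ⟶ Z) := ⟨fun _ _ _ => h.eq_of_tgt _ _⟩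
    haveI : Epi (0 : Z ⟶ Z) := ⟨fun _ _ _ => h.eq_of_src _ _⟩
    shortExact_of_lift _ _ _ fun _ _ _ => ⟨0, h.eq_of_tgt _ _⟩
  exact₀ :=
    haveI : Mono (0 : Z ⟶ Z) := ⟨fun _ _ _ => h.eq_of_tgt _ _⟩
    haveI : Epi (0 : Z ⟶ Z) := ⟨fun _ _ _ => h.eq_of_src _ _⟩
    shortExact_of_lift _ _ _ fun _ _ _ => ⟨0, h.eq_of_tgt _ _⟩

theorem resCls_zeroRes {Z : 𝒜} (h : IsZero Z) : resCls k (zeroRes h) = 1 := by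
  have hp : Projective Z := h.projective
  have e₁ : resTorus k (zeroRes h) = 0 := by
    change -torusK k Z + torusK k Z - torusKStar k Z = 0
    rw [torusKStar_zero k h]
    abel
  have e₂ : resExp k (zeroRes h) = 0 := by
    change hd k Z (Z ⊞ Z) - hd k Z Z - 2 * (hd k Z (Z ⊞ Z) - hd k Z Z) = 0
    simp only [hd_zero_left k h]
    ring
  rw [resCls_eq, e₁, e₂, Torus.exp_zero, zpow_zero, one_smul, one_mul]
  refine DH.cls_eq_one k _ (C2.isZero ?_ h)
  change IsZero (Z ⊞ Z)
  rw [biprod_isZero_iff]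
  exact ⟨h, h⟩

theorem resHom_one (hres : ∀ X : 𝒜, Nonempty (Res X)) : resHom k hres 1 = 1 := by
  have h0 : IsZero (0 : (⊤ : ObjectProperty 𝒜).FullSubcategory) := isZero_zero _
  have h0' : IsZero (0 : (⊤ : ObjectProperty 𝒜).FullSubcategory).obj := by
    rw [IsZero.iff_id_eq_zero] at h0 ⊢
    exact congrArg (⊤ : ObjectProperty 𝒜).ι.map h0
  exact (resHom_acls k hres (zeroRes h0')).trans (resCls_zeroRes k h0')

end AlgebraHomomorphism

/-! ### Acyclic complexes of projectives and even homology -/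

section Acyclic

variable {𝒜 : Type u} [Category.{v} 𝒜] [Abelian 𝒜]

theorem exact_one_zero {M : C2 𝒜} (h : M.ExactAt 0) :
    (ShortComplex.mk (M.d 1 0) (M.d 0 1) (M.d_comp_d _ _ _)).Exact :=
  (HomologicalComplex.exactAt_iff' _ 1 0 1
    (ComplexShape.prev_eq' _ ((rel_iff 1 0).2 (by decide)))
    (ComplexShape.next_eq' _ ((rel_iff 0 1).2 (by decide)))).1 h

theorem exact_zero_one {M : C2 𝒜} (h : M.ExactAt 1) :
    (ShortComplex.mk (M.d 0 1) (M.d 1 0) (M.d_comp_d _ _ _)).Exact :=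
  (HomologicalComplex.exactAt_iff' _ 0 1 0
    (ComplexShape.prev_eq' _ ((rel_iff 0 1).2 (by decide)))
    (ComplexShape.next_eq' _ ((rel_iff 1 0).2 (by decide)))).1 h

theorem shortExact_kernel_of_exact {X Y Z : 𝒜} {f : X ⟶ Y} {g : Y ⟶ Z} {w : f ≫ g = 0}
    (h : (ShortComplex.mk f g w).Exact) :
    ∃ w', (ShortComplex.mk (kernel.ι f) (kernel.lift g f w) w').ShortExact := by
  have : Epi (kernel.lift g f w) := (ShortComplex.exact_iff_epi_kernel_lift _).1 h
  refine ⟨by rw [← cancel_mono (kernel.ι g)]; simp, shortExact_of_lift _ _ _ fun T x hx => ?_⟩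
  refine ⟨kernel.lift f x ?_, kernel.lift_ι _ _ _⟩
  have := congrArg (· ≫ kernel.ι g) hx
  simpa using this

/-- An acyclic complex of projectives over a category of global dimension at most two is a direct
sum of complexes `K_P` and `K_Q^*`. -/
theorem exists_iso_of_acyclic (hgl : ∀ X : 𝒜, HasProjectiveDimensionLE X 2) {M : C2 𝒜}
    (hM : isProj 𝒜 M) (h : M.Acyclic) : ∃ (P Q : 𝒜) (_ : Projective P) (_ : Projective Q),
      Nonempty (M ≅ dsum (complexK P) (complexKStar Q)) := by
  have hM₀ : Projective (M.X 0) := hM 0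
  have hM₁ : Projective (M.X 1) := hM 1
  obtain ⟨w₁, h₁⟩ := shortExact_kernel_of_exact (exact_one_zero (h 0))
  obtain ⟨w₀, h₀⟩ := shortExact_kernel_of_exact (exact_zero_one (h 1))
  have syz : ∀ {X Y Z : 𝒜} {f : X ⟶ Y} {g : Y ⟶ Z} {w : f ≫ g = 0} (n : ℕ), Projective Y →
      (ShortComplex.mk f g w).ShortExact → HasProjectiveDimensionLT Z (n + 2) →
      HasProjectiveDimensionLT X (n + 1) := fun n hY hS =>
    (hS.hasProjectiveDimensionLT_X₃_iff n hY).1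
  -- Each kernel is a syzygy of the other, so each is its own second syzygy and is projective in
  -- global dimension at most two.
  have hP : Projective (kernel (M.d 0 1)) := by
    have := syz 0 hM₀ h₀ (syz 1 hM₁ h₁ (hgl _))
    infer_instance
  have hQ : Projective (kernel (M.d 1 0)) := by
    have := syz 0 hM₁ h₁ (syz 1 hM₀ h₀ (hgl _))
    infer_instance
  let e₁ := kernel.lift (M.d 0 1) (M.d 1 0) (M.d_comp_d _ _ _)
  let e₀ := kernel.lift (M.d 1 0) (M.d 0 1) (M.d_comp_d _ _ _)
  have : Epi e₁ := h₁.epi_g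
  have : Epi e₀ := h₀.epi_g
  let s := Projective.factorThru (𝟙 _) e₁
  let r := Projective.factorThru (𝟙 _) e₀
  have hs : s ≫ e₁ = 𝟙 _ := Projective.factorThru_comp _ _
  have hr : r ≫ e₀ = 𝟙 _ := Projective.factorThru_comp _ _
  have hs' : s ≫ M.d 1 0 = kernel.ι (M.d 0 1) := by
    have := congrArg (· ≫ kernel.ι (M.d 0 1)) hs
    simpa [e₁] using this
  have hr' : r ≫ M.d 0 1 = kernel.ι (M.d 1 0) := by
    have := congrArg (· ≫ kernel.ι (M.d 1 0)) hr
    simpa [e₀] using this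
  let i₁ := (ShortComplex.Splitting.ofExactOfSection _ h₁.exact s hs h₁.mono_f).isoBinaryBiproduct
  let i₀ := (ShortComplex.Splitting.ofExactOfSection _ h₀.exact r hr h₀.mono_f).isoBinaryBiproduct
  have hi₁ : i₁.inv = biprod.desc (kernel.ι (M.d 1 0)) s := rfl
  have hi₀ : i₀.inv = biprod.desc (kernel.ι (M.d 0 1)) r := rfl
  -- The splitting of `M.X 1` lists `kernel (M.d 1 0)` first, while the direct sum lists it second;
  -- hence the braiding.
  refine ⟨_, _, hP, hQ, ⟨(C2.isoMk (M := dsum (complexK (kernel (M.d 0 1)))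
    (complexKStar (kernel (M.d 1 0)))) (N := M) (biprod.braiding _ _ ≪≫ i₁.symm) i₀.symm
      ?_ ?_).symm⟩⟩
  · change ((biprod.braiding _ _).hom ≫ i₁.inv) ≫ M.d 1 0 =
      biprod.map (𝟙 _) (0 : kernel (M.d 1 0) ⟶ _) ≫ i₀.inv
    rw [hi₁, hi₀]
    ext <;> simp [hs']
  · change i₀.inv ≫ M.d 0 1 = biprod.map (0 : kernel (M.d 0 1) ⟶ _) (𝟙 _) ≫
      (biprod.braiding _ _).hom ≫ i₁.inv
    rw [hi₁, hi₀]
    ext <;> simp [hr']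

/-- The even cycles of the complex of a resolution. -/
def foldKernel {A : 𝒜} (T : Res A) : IsLimit (KernelFork.ofι (biprod.inl : T.P₀ ⟶ T.P₀ ⊞ T.P₂)
    (biprod.inl_desc (0 : T.P₀ ⟶ T.P₁) T.i)) :=
  KernelFork.IsLimit.ofι' _ _ fun x hx => ⟨x ≫ biprod.fst, by
    have : (x ≫ biprod.snd) = 0 := by
      rw [← cancel_mono T.i, zero_comp, ← hx, Category.assoc]
      congr 1
      ext <;> simp
    ext <;> simp [this]⟩

theorem foldKernel_lift {A : 𝒜} (T : Res A) (w : biprod.lift (T.π ≫ T.ι) (0 : T.P₁ ⟶ T.P₂) ≫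
    biprod.desc (0 : T.P₀ ⟶ T.P₁) T.i = 0) :
    (foldKernel T).lift (KernelFork.ofι (biprod.lift (T.π ≫ T.ι) (0 : T.P₁ ⟶ T.P₂)) w) =
      T.π ≫ T.ι := by
  have h : _ ≫ (biprod.inl : T.P₀ ⟶ T.P₀ ⊞ T.P₂) = biprod.lift (T.π ≫ T.ι) (0 : T.P₁ ⟶ T.P₂) :=
    (foldKernel T).fac (KernelFork.ofι (biprod.lift (T.π ≫ T.ι) (0 : T.P₁ ⟶ T.P₂)) w)
    WalkingParallelPair.zero
  have := congrArg (· ≫ biprod.fst) h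
  simpa using this

/-- The even homology of the complex of a resolution. -/
def homologyFold {A : 𝒜} (T : Res A) : T.fold.homology 0 ≅ A :=
  (T.fold.homologyIsoSc' 1 0 1 (ComplexShape.prev_eq' _ ((rel_iff 1 0).2 (by decide)))
    (ComplexShape.next_eq' _ ((rel_iff 0 1).2 (by decide)))) ≪≫
  ShortComplex.LeftHomologyData.homologyIso
    (S := ShortComplex.mk (biprod.lift (T.π ≫ T.ι) (0 : T.P₁ ⟶ T.P₂))
      (biprod.desc (0 : T.P₀ ⟶ T.P₁) T.i) (T.fold.d_comp_d 1 0 1))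
    -- As `T.i` is a monomorphism, the even cycles are `P₀`; the boundaries are the image of `T.π ≫
    -- T.ι`, which is the syzygy, so the quotient is `A`.
    { K := T.P₀
      H := A
      i := biprod.inl
      π := T.ε
      wi := biprod.inl_desc _ _
      hi := foldKernel T
      wπ := by
        erw [foldKernel_lift]
        rw [Category.assoc, T.ι_ε, comp_zero]
      hπ := CokernelCofork.IsColimit.ofπ' _ _ fun x hx => by
        have : Epi (ShortComplex.mk T.ι T.ε T.ι_ε).g := T.exact₀.epi_g
        have hx' : (T.π ≫ T.ι) ≫ x = 0 := by
          rw [← hx]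
          exact congrArg (· ≫ x) (foldKernel_lift T _).symm
        rw [Category.assoc, ← comp_zero (f := T.π), cancel_epi] at hx'
        exact ⟨T.exact₀.exact.desc x hx', T.exact₀.exact.g_desc _ _⟩ }

/-- The inclusion of the second summand of a direct sum of complexes. -/
def dsumInr (M N : C2 𝒜) : N ⟶ dsum M N :=
  C2.homToMk biprod.inr biprod.inr (by simp) (by simp)

/-- The inclusion of the first summand of a direct sum of complexes. -/
def dsumInl (M N : C2 𝒜) : M ⟶ dsum M N :=
  C2.homToMk biprod.inl biprod.inl (by simp) (by simp)

/-- The projection to the second summand of a direct sum of complexes. -/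
def dsumSnd (M N : C2 𝒜) : dsum M N ⟶ N :=
  C2.homOfMk biprod.snd biprod.snd (by simp) (by simp)

/-- The projection to the first summand of a direct sum of complexes. -/
def dsumFst (M N : C2 𝒜) : dsum M N ⟶ M :=
  C2.homOfMk biprod.fst biprod.fst (by simp) (by simp)

/-- Adding an acyclic complex does not change the homology. -/
def homologyDsum (M N : C2 𝒜) (h : M.Acyclic) : (dsum M N).homology 0 ≅ N.homology 0 where
  hom := HomologicalComplex.homologyMap (dsumSnd M N) 0
  inv := HomologicalComplex.homologyMap (dsumInr M N) 0
  hom_inv_id := by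
    have e : dsumSnd M N ≫ dsumInr M N = 𝟙 _ - dsumFst M N ≫ dsumInl M N := by
      refine C2.hom_ext ?_ ?_
      · exact eq_sub_of_add_eq' (biprod.total (X := M.X 0) (Y := N.X 0))
      · exact eq_sub_of_add_eq' (biprod.total (X := M.X 1) (Y := N.X 1))
    rw [← HomologicalComplex.homologyMap_comp, e, HomologicalComplex.homologyMap_sub,
      HomologicalComplex.homologyMap_comp, (h 0).isZero_homology.eq_of_tgt
        (HomologicalComplex.homologyMap (dsumFst M N) 0) 0, zero_comp, sub_zero,
      HomologicalComplex.homologyMap_id]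
  inv_hom_id := by
    rw [← HomologicalComplex.homologyMap_comp, ← HomologicalComplex.homologyMap_id]
    congr 1
    exact C2.hom_ext biprod.inr_snd biprod.inr_snd

end Acyclic

/-! ### A representation of the localized Hall algebra -/

section Representation

variable (k : Type w) [Field k] [Finite k] (𝒜 : Type u) [Category.{v} 𝒜] [Abelian 𝒜] [Linear k 𝒜]
  [hfin : ∀ X Y : 𝒜, Module.Finite k (X ⟶ Y)]

omit [Finite k] hfin in
/-- The classes of the complexes `K_P` and `K_P^*` in the twisted Hall algebra. -/
def contractibleSet : Set (HallTwC2 k 𝒜) :=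
  {x | ∃ (P : 𝒜) (_ : Projective P), x = hcls k 𝒜 (isProj_complexK P) ∨
    x = hcls k 𝒜 (isProj_complexKStar P)}

omit [Finite k] hfin in
/-- The left ideal generated by the elements `c - 1` with `c` the class of `K_P` or `K_P^*`. -/
def contractibleIdeal : Submodule ℂ (HallTwC2 k 𝒜) :=
  Submodule.span ℂ {y | ∃ m, ∃ c ∈ contractibleSet k 𝒜, y = m * c - m}

/-- The quotient of the twisted Hall algebra in which the classes `K_P` and `K_P^*` are
identified with the unit. -/
abbrev ContractibleQuotient : Type (max u v) := HallTwC2 k 𝒜 ⧸ contractibleIdeal k 𝒜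

variable {𝒜}

/-- By associativity, `x * (m * c - m) = (x * m) * c - x * m`. -/
theorem contractibleIdeal_le_comap (x : HallTwC2 k 𝒜) : contractibleIdeal k 𝒜 ≤
    (contractibleIdeal k 𝒜).comap (LinearMap.mulLeft ℂ x) := by
  refine Submodule.span_le.2 ?_
  rintro _ ⟨m, c, hc, rfl⟩
  refine Submodule.subset_span ⟨x * m, c, hc, ?_⟩
  rw [LinearMap.mulLeft_apply, mul_sub, hall_mul_assoc]

/-- Left multiplication on the quotient. -/
def quotientMul (x : HallTwC2 k 𝒜) : Module.End ℂ (ContractibleQuotient k 𝒜) :=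
  (contractibleIdeal k 𝒜).mapQ _ (LinearMap.mulLeft ℂ x) (contractibleIdeal_le_comap k x)

theorem quotientMul_mk (x y : HallTwC2 k 𝒜) :
    quotientMul k x (Submodule.Quotient.mk y) = Submodule.Quotient.mk (x * y) := rfl

variable {k} in
theorem contractibleQuotient_ext {f g : Module.End ℂ (ContractibleQuotient k 𝒜)}
    (h : ∀ (M : C2 𝒜) (hM : isProj 𝒜 M), f (Submodule.Quotient.mk (hcls k 𝒜 hM)) =
      g (Submodule.Quotient.mk (hcls k 𝒜 hM))) : f = g := by
  refine Submodule.linearMap_qext _ (LinearMap.ext fun x => ?_)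
  induction x using TwHall.induction with
  | zero => rw [map_zero, map_zero]
  | add x y hx hy => rw [map_add, map_add, hx, hy]
  | smul c x hx => rw [map_smul, map_smul, hx]
  | cls M hM => exact h M hM

theorem quotientMul_add (x y : HallTwC2 k 𝒜) :
    quotientMul k (x + y) = quotientMul k x + quotientMul k y :=
  contractibleQuotient_ext fun M hM => by
    rw [LinearMap.add_apply, quotientMul_mk, quotientMul_mk, quotientMul_mk, add_mul]
    rfl

theorem quotientMul_smul (c : ℂ) (x : HallTwC2 k 𝒜) :
    quotientMul k (c • x) = c • quotientMul k x :=
  contractibleQuotient_ext fun M hM => by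
    rw [LinearMap.smul_apply, quotientMul_mk, quotientMul_mk, smul_mul_assoc]
    rfl

theorem quotientMul_mul (x y : HallTwC2 k 𝒜) :
    quotientMul k (x * y) = quotientMul k x * quotientMul k y :=
  contractibleQuotient_ext fun M hM => by
    rw [Module.End.mul_apply, quotientMul_mk, quotientMul_mk, quotientMul_mk, hall_mul_assoc]

theorem quotientMul_one : quotientMul k (1 : HallTwC2 k 𝒜) = 1 :=
  contractibleQuotient_ext fun M hM => by
    rw [quotientMul_mk, hall_one_mul]
    rfl

variable {k} in
omit [Finite k] hfin in
theorem mk_mul_of_mem (m : HallTwC2 k 𝒜) {c : HallTwC2 k 𝒜} (hc : c ∈ contractibleSet k 𝒜) :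
    (Submodule.Quotient.mk (m * c) : ContractibleQuotient k 𝒜) = Submodule.Quotient.mk m :=
  (Submodule.Quotient.eq _).2 (Submodule.subset_span ⟨m, c, hc, rfl⟩)

section

variable (P : 𝒜) [Projective P]

theorem hcls_complexK_mul_comm {M : C2 𝒜} (hM : isProj 𝒜 M) :
    hcls k 𝒜 (isProj_complexK P) * hcls k 𝒜 hM =
      sqrtCard k ^ (hd k P (M.X 0) - hd k P (M.X 1) - (hd k (M.X 1) P - hd k (M.X 0) P)) •
        (hcls k 𝒜 hM * hcls k 𝒜 (isProj_complexK P)) := by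
  rw [hcls_complexK_mul, mul_hcls_complexK, smul_smul, ← zpow_add₀ (sqrtCard_ne_zero k)]
  congr 2
  ring

theorem hcls_complexKStar_mul_comm {M : C2 𝒜} (hM : isProj 𝒜 M) :
    hcls k 𝒜 (isProj_complexKStar P) * hcls k 𝒜 hM =
      sqrtCard k ^ (-(hd k P (M.X 0) - hd k P (M.X 1) - (hd k (M.X 1) P - hd k (M.X 0) P))) •
        (hcls k 𝒜 hM * hcls k 𝒜 (isProj_complexKStar P)) := by
  rw [hcls_complexKStar_mul, mul_hcls_complexKStar, smul_smul, ← zpow_add₀ (sqrtCard_ne_zero k)]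
  congr 2
  ring

/-- Moved to the right of `[M]`, both factors become `1` in the quotient, and the powers of `t`
picked up on the way are opposite. -/
theorem quotientMul_complexK_mul_complexKStar :
    quotientMul k (hcls k 𝒜 (isProj_complexK P)) *
      quotientMul k (hcls k 𝒜 (isProj_complexKStar P)) = 1 :=
  contractibleQuotient_ext fun M hM => by
    rw [Module.End.mul_apply, quotientMul_mk, quotientMul_mk, hcls_complexKStar_mul_comm,
      mul_smul_comm, ← hall_mul_assoc, hcls_complexK_mul_comm, smul_mul_assoc, smul_smul,
      ← zpow_add₀ (sqrtCard_ne_zero k), neg_add_cancel, zpow_zero, one_smul,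
      mk_mul_of_mem _ ⟨P, inferInstance, Or.inr rfl⟩,
      mk_mul_of_mem _ ⟨P, inferInstance, Or.inl rfl⟩]
    rfl

theorem quotientMul_complexKStar_mul_complexK :
    quotientMul k (hcls k 𝒜 (isProj_complexKStar P)) *
      quotientMul k (hcls k 𝒜 (isProj_complexK P)) = 1 :=
  contractibleQuotient_ext fun M hM => by
    rw [Module.End.mul_apply, quotientMul_mk, quotientMul_mk, hcls_complexK_mul_comm,
      mul_smul_comm, ← hall_mul_assoc, hcls_complexKStar_mul_comm, smul_mul_assoc, smul_smul,
      ← zpow_add₀ (sqrtCard_ne_zero k), add_neg_cancel, zpow_zero, one_smul,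
      mk_mul_of_mem _ ⟨P, inferInstance, Or.inl rfl⟩,
      mk_mul_of_mem _ ⟨P, inferInstance, Or.inr rfl⟩]
    rfl

end

theorem exists_quotientMul_inverse (hgl : ∀ X : 𝒜, HasProjectiveDimensionLE X 2)
    (s : acyclicSet k 𝒜) : ∃ f : Module.End ℂ (ContractibleQuotient k 𝒜),
      quotientMul k s.1 * f = 1 ∧ f * quotientMul k s.1 = 1 := by
  obtain ⟨_, M, hM, hac, rfl⟩ := s
  obtain ⟨P, Q, hP, hQ, ⟨e⟩⟩ := exists_iso_of_acyclic hgl hM hac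
  have h : hcls k 𝒜 hM = hcls k 𝒜 (isProj_complexK P) * hcls k 𝒜 (isProj_complexKStar Q) := by
    rw [hcls_complexK_mul]
    change _ = sqrtCard k ^ (hd k P Q - hd k P Q) • _
    rw [sub_self, zpow_zero, one_smul]
    exact TwHall.cls_congr _ _ e
  -- The inverse of `K_P * K_Q^*` acts as `K_Q * K_P^*`, since starring inverts the action.
  refine ⟨quotientMul k (hcls k 𝒜 (isProj_complexK Q)) *
    quotientMul k (hcls k 𝒜 (isProj_complexKStar P)), ?_, ?_⟩
  · change quotientMul k (hcls k 𝒜 hM) * _ = 1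
    rw [h, quotientMul_mul, mul_assoc, ← mul_assoc _ _ (quotientMul k (hcls k 𝒜 (isProj_complexKStar P))),
      quotientMul_complexKStar_mul_complexK, one_mul, quotientMul_complexK_mul_complexKStar]
  · change _ * quotientMul k (hcls k 𝒜 hM) = 1
    rw [h, quotientMul_mul, mul_assoc, ← mul_assoc _ _ (quotientMul k (hcls k 𝒜 (isProj_complexKStar Q))),
      quotientMul_complexKStar_mul_complexK, one_mul, quotientMul_complexK_mul_complexKStar]

/-- The representation of the localized Hall algebra on the quotient. -/
def quotientRep (hgl : ∀ X : 𝒜, HasProjectiveDimensionLE X 2) :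
    DH k 𝒜 →ₐ[ℂ] Module.End ℂ (ContractibleQuotient k 𝒜) :=
  RingQuot.liftAlgHom ℂ ⟨FreeAlgebra.lift ℂ (Sum.elim (quotientMul k)
    fun s => (exists_quotientMul_inverse k hgl s).choose), by
      intro x y h
      cases h with
      | add x y => simp [quotientMul_add]
      | smul c x => simp [quotientMul_smul]
      | mul x y => simp [quotientMul_mul]
      | one => simp [quotientMul_one]
      | mul_inv s => simpa using (exists_quotientMul_inverse k hgl s).choose_spec.1
      | inv_mul s => simpa using (exists_quotientMul_inverse k hgl s).choose_spec.2⟩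

theorem quotientRep_of (hgl : ∀ X : 𝒜, HasProjectiveDimensionLE X 2) (x : HallTwC2 k 𝒜) :
    quotientRep k hgl (Loc.of _ x) = quotientMul k x := by
  unfold quotientRep Loc.of
  rw [RingQuot.liftAlgHom_mkAlgHom_apply, FreeAlgebra.lift_ι_apply]
  rfl

/-- A generator `c` satisfies `c * 1 = 1 * c`, which equals `1` in the quotient; products and
inverses inherit the fixed vector. -/
theorem quotientRep_exp (hgl : ∀ X : 𝒜, HasProjectiveDimensionLE X 2) (a : Torus k 𝒜) :
    quotientRep k hgl a.exp (Submodule.Quotient.mk 1) = Submodule.Quotient.mk 1 := by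
  obtain ⟨a, ha⟩ := a
  change quotientRep k hgl ((Additive.toMul a : (DH k 𝒜)ˣ) : DH k 𝒜) _ = _
  induction ha using AddSubgroup.closure_induction with
  | mem x hx =>
    obtain ⟨P, hP, rfl | rfl⟩ := hx
    · change quotientRep k hgl (Loc.of _ (hcls k 𝒜 (isProj_complexK P))) _ = _
      rw [quotientRep_of, quotientMul_mk, hall_mul_one, ← hall_one_mul k (hcls k 𝒜 _)]
      exact mk_mul_of_mem _ ⟨P, hP, Or.inl rfl⟩
    · change quotientRep k hgl (Loc.of _ (hcls k 𝒜 (isProj_complexKStar P))) _ = _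
      rw [quotientRep_of, quotientMul_mk, hall_mul_one, ← hall_one_mul k (hcls k 𝒜 _)]
      exact mk_mul_of_mem _ ⟨P, hP, Or.inr rfl⟩
  | zero =>
    rw [toMul_zero, Units.val_one, map_one]
    rfl
  | add x y _ _ hx hy =>
    rw [toMul_add, Units.val_mul, map_mul, Module.End.mul_apply, hy, hx]
  | neg x _ hx =>
    rw [toMul_neg]
    conv_lhs => rw [← hx]
    rw [← Module.End.mul_apply, ← map_mul, Units.inv_mul, map_one]
    rfl

end Representation

/-! ### Recovering an object from its even homology -/

section Injectivity

variable (k : Type w) [Field k] {𝒜 : Type u} [Category.{v} 𝒜] [Abelian 𝒜] [Linear k 𝒜]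
  [hfin : ∀ X Y : 𝒜, Module.Finite k (X ⟶ Y)]

/-- The kernel of a direct sum of morphisms. -/
def kernelBiprodMap {X Y X' Y' : 𝒜} (f : X ⟶ Y) (g : X' ⟶ Y') :
    kernel (biprod.map f g) ≅ kernel f ⊞ kernel g where
  hom := biprod.lift (kernel.lift f (kernel.ι _ ≫ biprod.fst) (by
      rw [Category.assoc, ← biprod.map_fst f g, kernel.condition_assoc, zero_comp]))
    (kernel.lift g (kernel.ι _ ≫ biprod.snd) (by
      rw [Category.assoc, ← biprod.map_snd f g, kernel.condition_assoc, zero_comp]))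
  inv := kernel.lift _ (biprod.map (kernel.ι f) (kernel.ι g)) (by ext <;> simp)
  hom_inv_id := by
    rw [← cancel_mono (kernel.ι _)]
    ext <;> simp
  inv_hom_id := by
    ext <;> simp [← cancel_mono (kernel.ι f), ← cancel_mono (kernel.ι g)]

theorem hd_kernel_biprodMap (Z : 𝒜) {X Y X' Y' : 𝒜} (f : X ⟶ Y) (g : X' ⟶ Y') :
    hd k Z (kernel (biprod.map f g)) = hd k Z (kernel f) + hd k Z (kernel g) := by
  rw [hd_congr k (Iso.refl Z) (kernelBiprodMap f g), hd_biprod_right]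

omit hfin in
theorem hd_kernel_id (Z X : 𝒜) : hd k Z (kernel (𝟙 X)) = 0 :=
  hd_zero_right k Z (isZero_kernel_of_mono _)

omit hfin in
theorem hd_kernel_zero (Z X Y : 𝒜) : hd k Z (kernel (0 : X ⟶ Y)) = hd k Z X :=
  hd_congr k (Iso.refl Z) kernelZeroIsoSource

omit hfin in
/-- An additive defect of the two twists on a complex. -/
def homologyExp (M : C2 𝒜) : ℤ :=
  hd k (M.X 0) (kernel (M.d 0 1)) - hd k (M.X 1) (kernel (M.d 0 1)) +
    (hd k (M.X 1) (kernel (M.d 1 0)) - hd k (M.X 0) (kernel (M.d 1 0)))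

omit hfin in
theorem homologyExp_congr {M N : C2 𝒜} (e : M ≅ N) : homologyExp k M = homologyExp k N := by
  have e₀ : kernel (M.d 0 1) ≅ kernel (N.d 0 1) :=
    kernel.mapIso _ _ (C2.evalIso e 0) (C2.evalIso e 1) (by simp)
  have e₁ : kernel (M.d 1 0) ≅ kernel (N.d 1 0) :=
    kernel.mapIso _ _ (C2.evalIso e 1) (C2.evalIso e 0) (by simp)
  unfold homologyExp
  rw [hd_congr k (C2.evalIso e 0) e₀, hd_congr k (C2.evalIso e 1) e₀,
    hd_congr k (C2.evalIso e 0) e₁, hd_congr k (C2.evalIso e 1) e₁]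

/-- `homologyExp` pairs `M₀ - M₁` with `ker d₀ - ker d₁`. Adding `K_P` keeps the first difference
and adds `P` to the second. The resulting defect is minus the exponent in `[M] * [K_P]`, as needed
for the weighted homology to descend. -/
theorem homologyExp_dsum_complexK (P : 𝒜) (M : C2 𝒜) : homologyExp k (dsum (complexK P) M) =
    homologyExp k M - (hd k (M.X 1) P - hd k (M.X 0) P) := by
  have h₀ : ∀ Z : 𝒜, hd k Z (kernel ((dsum (complexK P) M).d 0 1)) =
      hd k Z P + hd k Z (kernel (M.d 0 1)) := fun Z =>
    (hd_kernel_biprodMap k Z (0 : P ⟶ P) (M.d 0 1)).trans (by rw [hd_kernel_zero])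
  have h₁ : ∀ Z : 𝒜, hd k Z (kernel ((dsum (complexK P) M).d 1 0)) =
      hd k Z (kernel (M.d 1 0)) := fun Z =>
    (hd_kernel_biprodMap k Z (𝟙 P) (M.d 1 0)).trans (by rw [hd_kernel_id, zero_add])
  have l₀ : ∀ Z : 𝒜, hd k ((dsum (complexK P) M).X 0) Z = hd k P Z + hd k (M.X 0) Z :=
    hd_biprod_left k P (M.X 0)
  have l₁ : ∀ Z : 𝒜, hd k ((dsum (complexK P) M).X 1) Z = hd k P Z + hd k (M.X 1) Z :=
    hd_biprod_left k P (M.X 1)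
  unfold homologyExp
  simp only [h₀, h₁, l₀, l₁]
  ring

theorem homologyExp_dsum_complexKStar (P : 𝒜) (M : C2 𝒜) :
    homologyExp k (dsum (complexKStar P) M) =
      homologyExp k M - (hd k (M.X 0) P - hd k (M.X 1) P) := by
  have h₀ : ∀ Z : 𝒜, hd k Z (kernel ((dsum (complexKStar P) M).d 0 1)) =
      hd k Z (kernel (M.d 0 1)) := fun Z =>
    (hd_kernel_biprodMap k Z (𝟙 P) (M.d 0 1)).trans (by rw [hd_kernel_id, zero_add])
  have h₁ : ∀ Z : 𝒜, hd k Z (kernel ((dsum (complexKStar P) M).d 1 0)) =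
      hd k Z P + hd k Z (kernel (M.d 1 0)) := fun Z =>
    (hd_kernel_biprodMap k Z (0 : P ⟶ P) (M.d 1 0)).trans (by rw [hd_kernel_zero])
  have l₀ : ∀ Z : 𝒜, hd k ((dsum (complexKStar P) M).X 0) Z = hd k P Z + hd k (M.X 0) Z :=
    hd_biprod_left k P (M.X 0)
  have l₁ : ∀ Z : 𝒜, hd k ((dsum (complexKStar P) M).X 1) Z = hd k P Z + hd k (M.X 1) Z :=
    hd_biprod_left k P (M.X 1)
  unfold homologyExp
  simp only [h₀, h₁, l₀, l₁]
  ring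

variable [Finite k]

variable (𝒜) in
/-- The linear map sending the class of a complex to a multiple of the class of its even
homology. -/
def homologyMap : HallTwC2 k 𝒜 →ₗ[ℂ] HallTw k 𝒜 :=
  (TwHall.basis (isProj 𝒜) (sqrtCard k) (eulerC2 k)).constr ℂ fun a =>
    sqrtCard k ^ homologyExp k a.rep • acls k 𝒜 (a.rep.homology 0)

theorem homologyMap_hcls {M : C2 𝒜} (hM : isProj 𝒜 M) : homologyMap k 𝒜 (hcls k 𝒜 hM) =
    sqrtCard k ^ homologyExp k M • acls k 𝒜 (M.homology 0) := by
  obtain ⟨e⟩ := nonempty_rep_iso M hM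
  unfold hcls homologyMap
  rw [TwHall.cls_eq_basis, Module.Basis.constr_basis, homologyExp_congr k e]
  congr 1
  exact TwHall.cls_congr _ _ ((HomologicalComplex.homologyFunctor 𝒜 _ 0).mapIso e)

theorem homologyMap_mul (m : HallTwC2 k 𝒜) {c : HallTwC2 k 𝒜} (hc : c ∈ contractibleSet k 𝒜) :
    homologyMap k 𝒜 (m * c) = homologyMap k 𝒜 m := by
  induction m using TwHall.induction with
  | zero => rw [zero_mul]
  | add x y hx hy => rw [add_mul, map_add, map_add, hx, hy]
  | smul a x hx => rw [smul_mul_assoc, map_smul, map_smul, hx]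
  | cls M hM =>
    obtain ⟨P, hP, rfl | rfl⟩ := hc
    · rw [mul_hcls_complexK, map_smul, homologyMap_hcls, homologyMap_hcls, smul_smul,
        ← zpow_add₀ (sqrtCard_ne_zero k), homologyExp_dsum_complexK, add_sub_cancel]
      congr 1
      exact TwHall.cls_congr _ _ (homologyDsum _ _ (acyclic_complexK P))
    · rw [mul_hcls_complexKStar, map_smul, homologyMap_hcls, homologyMap_hcls, smul_smul,
        ← zpow_add₀ (sqrtCard_ne_zero k), homologyExp_dsum_complexKStar, add_sub_cancel]
      congr 1
      exact TwHall.cls_congr _ _ (homologyDsum _ _ (acyclic_complexKStar P))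

variable (𝒜) in
/-- The map induced on the quotient by taking homology. -/
def quotientHomologyMap : ContractibleQuotient k 𝒜 →ₗ[ℂ] HallTw k 𝒜 :=
  (contractibleIdeal k 𝒜).liftQ (homologyMap k 𝒜) (by
    refine Submodule.span_le.2 ?_
    rintro _ ⟨m, c, hc, rfl⟩
    rw [SetLike.mem_coe, LinearMap.mem_ker, map_sub, homologyMap_mul k m hc, sub_self])

theorem quotientHomologyMap_resCls (hgl : ∀ X : 𝒜, HasProjectiveDimensionLE X 2) {A : 𝒜}
    (T : Res A) : ∃ c : ℂ, c ≠ 0 ∧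
      quotientHomologyMap k 𝒜 (quotientRep k hgl (resCls k T) (Submodule.Quotient.mk 1)) =
        c • acls k 𝒜 A := by
  have ht := sqrtCard_ne_zero k
  have hs : DH.cls k T.fold T.isProj_fold * (resTorus k T).exp =
    sqrtCard k ^ resSkew k T T • ((resTorus k T).exp * DH.cls k T.fold T.isProj_fold) :=
      skew_resTorus k T T
  -- The torus element is moved to the right, where it fixes the class of `1`.
  have hs' : resCls k T = sqrtCard k ^ (resExp k T - resSkew k T T) •
      (DH.cls k T.fold T.isProj_fold * (resTorus k T).exp) := by
    rw [resCls_eq, hs, smul_smul, ← zpow_add₀ ht, sub_add_cancel]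
  refine ⟨sqrtCard k ^ (resExp k T - resSkew k T T) * sqrtCard k ^ homologyExp k T.fold,
    mul_ne_zero (zpow_ne_zero _ ht) (zpow_ne_zero _ ht), ?_⟩
  have h₁ : quotientRep k hgl (DH.cls k T.fold T.isProj_fold) =
      quotientMul k (hcls k 𝒜 T.isProj_fold) := quotientRep_of k hgl _
  rw [hs', map_smul, LinearMap.smul_apply, map_smul, map_mul, Module.End.mul_apply,
    quotientRep_exp, h₁, quotientMul_mk, hall_mul_one, mul_smul]
  congr 1
  refine (homologyMap_hcls k T.isProj_fold).trans ?_
  congr 1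
  exact TwHall.cls_congr _ _ (homologyFold T)

/-- Followed by the action on the class of `1` and by weighted homology, `resHom` is diagonal in the
basis of isomorphism classes with nonzero entries, hence injective. -/
theorem resHom_injective (hgl : ∀ X : 𝒜, HasProjectiveDimensionLE X 2)
    (hres : ∀ X : 𝒜, Nonempty (Res X)) : Function.Injective (resHom k hres) := by
  let b := TwHall.basis (⊤ : ObjectProperty 𝒜) (sqrtCard k) (euler k)
  let Ψ : DH k 𝒜 →ₗ[ℂ] HallTw k 𝒜 := (quotientHomologyMap k 𝒜).comp
    ((LinearMap.applyₗ (Submodule.Quotient.mk 1 : ContractibleQuotient k 𝒜)).comp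
      (quotientRep k hgl).toLinearMap)
  have h : ∀ a, ∃ c : ℂ, c ≠ 0 ∧ (Ψ ∘ₗ resHom k hres) (b a) = c • b a := by
    intro a
    obtain ⟨c, hc, h⟩ := quotientHomologyMap_resCls k hgl (hres a.rep).some
    refine ⟨c, hc, ?_⟩
    have e : b a = acls k 𝒜 a.rep := TwHall.basis_eq_cls a
    rw [e, LinearMap.comp_apply, resHom_acls k hres (hres a.rep).some]
    exact h
  choose c hc h using h
  have hinj : Function.Injective (Ψ ∘ₗ resHom k hres) := by
    rw [← LinearMap.ker_eq_bot, LinearMap.ker_eq_bot']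
    intro x hx
    have hrepr : ∀ a, b.repr ((Ψ ∘ₗ resHom k hres) x) a = c a * b.repr x a := by
      intro a
      have : (Finsupp.lapply a) ∘ₗ b.repr.toLinearMap ∘ₗ (Ψ ∘ₗ resHom k hres) =
          c a • ((Finsupp.lapply a) ∘ₗ b.repr.toLinearMap) := by
        refine b.ext fun a' => ?_
        rw [LinearMap.comp_apply, LinearMap.comp_apply, h]
        by_cases haa : a' = a
        · subst haa
          simp
        · simp [Finsupp.single_eq_of_ne' haa]
      exact LinearMap.congr_fun this x
    apply b.repr.injective
    ext a
    have := hrepr a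
    rw [hx, map_zero] at this
    simpa [hc a] using this.symm
  exact Function.Injective.of_comp (f := Ψ) (g := resHom k hres) hinj

end Injectivity

/-! ### Projective covers and minimal resolutions from finiteness -/

theorem exists_pow_isIdempotentElem {M : Type*} [Monoid M] [Finite M] (x : M) :
    ∃ n, IsIdempotentElem (x ^ (n + 1)) := by
  obtain ⟨a, b, hne, hab⟩ := Finite.exists_ne_map_eq_of_infinite (fun n : ℕ => x ^ n)
  wlog h : a < b generalizing a b
  · exact this b a hne.symm hab.symm (by omega)
  obtain ⟨p, rfl⟩ := Nat.exists_eq_add_of_lt h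
  have step : ∀ m j, x ^ (a + m + j * (p + 1)) = x ^ (a + m) := by
    intro m j
    induction j with
    | zero => simp
    | succ j ih =>
      rw [show a + m + (j + 1) * (p + 1) = (a + p + 1) + (m + j * (p + 1)) by ring, pow_add, ← hab,
        ← pow_add, ← add_assoc, ih]
  -- The powers of `x` have period `p + 1` from exponent `a` on. The exponent used is `(a + 1) * (p
  -- + 1)`, a multiple of the period that is at least `a`.
  refine ⟨a + (a + 1) * p, ?_⟩
  rw [IsIdempotentElem, ← pow_add]
  have := step (1 + (a + 1) * p) (a + 1)
  rw [show a + (a + 1) * p + 1 + (a + (a + 1) * p + 1) =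
    a + (1 + (a + 1) * p) + (a + 1) * (p + 1) by ring, this]
  congr 1
  ring

section ProjectiveCovers

variable {𝒜 : Type u} [Category.{v} 𝒜] [Abelian 𝒜] [EnoughProjectives 𝒜]

/-- Projective covers exist if there are enough projectives and the sets of morphisms are
finite. -/
theorem exists_projectiveCover (hfin : ∀ X Y : 𝒜, Finite (X ⟶ Y)) (A : 𝒜) :
    ∃ (P : 𝒜) (f : P ⟶ A), IsProjectiveCover f := by
  classical
  -- The size of the endomorphism monoid measures the projective, and a minimal one will be the
  -- cover.
  let good : ℕ → Prop := fun n => ∃ (P : 𝒜) (f : P ⟶ A), Projective P ∧ Epi f ∧ Nat.card (End P) = n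
  have hex : ∃ n, good n :=
    ⟨_, Projective.over A, Projective.π A, inferInstance, inferInstance, rfl⟩
  obtain ⟨P, f, hP, hf, hcard⟩ := Nat.find_spec hex
  refine ⟨P, f, hP, hf, fun W g hg => ?_⟩
  have hfinEnd : Finite (End P) := hfin P P
  let s : P ⟶ W := Projective.factorThru f (g ≫ f)
  have hs : (s ≫ g) ≫ f = f := by
    rw [Category.assoc]
    exact Projective.factorThru_comp f (g ≫ f)
  let e : End P := s ≫ g
  have hpow : ∀ n : ℕ, (show P ⟶ P from e ^ n) ≫ f = f := by
    intro n
    induction n with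
    | zero => exact Category.id_comp f
    | succ n ih =>
      rw [pow_succ]
      change ((s ≫ g) ≫ (show P ⟶ P from e ^ n)) ≫ f = f
      rw [Category.assoc, ih, hs]
  obtain ⟨n, hn⟩ := exists_pow_isIdempotentElem e
  obtain ⟨Q, i, r, hir, hri⟩ :=
    IsIdempotentComplete.idempotents_split P (show P ⟶ P from e ^ (n + 1)) hn
  have hQ : Projective Q := Retract.projective ⟨i, r, hir⟩
  have hri' : r ≫ i ≫ f = f := by
    rw [← Category.assoc, hri, hpow]
  have hepi : Epi (i ≫ f) := epi_of_epi_fac hri'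
  have hmin : Nat.card (End P) ≤ Nat.card (End Q) := by
    rw [hcard]
    exact Nat.find_min' hex ⟨Q, i ≫ f, hQ, hepi, rfl⟩
  -- The image `Q` of the idempotent still maps onto `A`. By minimality this injection is onto, so
  -- `𝟙 P` factors through `Q`; the idempotent is then `𝟙 P`, and `g` is a split epimorphism.
  let F : End Q → End P := fun x => r ≫ x ≫ i
  have hF : Function.Injective F := by
    intro x y hxy
    have h : i ≫ (r ≫ x ≫ i) ≫ r = i ≫ (r ≫ y ≫ i) ≫ r := congrArg (fun z => i ≫ z ≫ r) hxy
    simpa [reassoc_of% hir, hir] using h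
  have hbij : Function.Bijective F := by
    have hfinQ : Finite (End Q) := hfin Q Q
    exact (Nat.bijective_iff_injective_and_card F).2
      ⟨hF, le_antisymm (Nat.card_le_card_of_injective F hF) hmin⟩
  obtain ⟨x, hx⟩ := hbij.2 (𝟙 P)
  have hx' : r ≫ x ≫ i = 𝟙 P := hx
  have hmono : r ≫ i = 𝟙 P := by
    have : (r ≫ i) ≫ (r ≫ x ≫ i) = r ≫ x ≫ i := by simp [reassoc_of% hir]
    rwa [hx', Category.comp_id] at this
  have hsec : ((show P ⟶ P from e ^ n) ≫ s) ≫ g = 𝟙 P := by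
    rw [← hmono, hri, Category.assoc]
    exact (pow_succ' e n).symm
  exact epi_of_epi_fac hsec

/-- Minimal projective resolutions exist over categories of global dimension at most two with
finite sets of morphisms. -/
theorem nonempty_minimalResolution (hfin : ∀ X Y : 𝒜, Finite (X ⟶ Y))
    (hgl : ∀ X : 𝒜, HasProjectiveDimensionLE X 2) (A : 𝒜) : Nonempty (MinimalResolution A) := by
  obtain ⟨P₀, a₀, c₀⟩ := exists_projectiveCover hfin A
  obtain ⟨P₁, p, c₁⟩ := exists_projectiveCover hfin (kernel a₀)
  have := c₀.projective
  have := c₀.epi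
  have := c₁.projective
  have := c₁.epi
  have h₀ : (ShortComplex.mk (kernel.ι a₀) a₀ (kernel.condition a₀)).ShortExact :=
    shortExact_of_lift _ _ _ fun T x hx => ⟨kernel.lift a₀ x hx, kernel.lift_ι _ _ _⟩
  have w : kernel.ι (p ≫ kernel.ι a₀) ≫ p = 0 := by
    rw [← cancel_mono (kernel.ι a₀), Category.assoc, kernel.condition, zero_comp]
  have h₁ : (ShortComplex.mk (kernel.ι (p ≫ kernel.ι a₀)) p w).ShortExact :=
    shortExact_of_lift _ _ _ fun T x hx =>
      ⟨kernel.lift _ x (by rw [reassoc_of% hx, zero_comp]), kernel.lift_ι _ _ _⟩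
  have hK : HasProjectiveDimensionLT (kernel a₀) 2 :=
    (h₀.hasProjectiveDimensionLT_X₃_iff 1 c₀.projective).1 (hgl A)
  -- The second syzygy is already projective, so the identity is its projective cover and the
  -- resolution stops.
  have hK' : HasProjectiveDimensionLT (kernel (p ≫ kernel.ι a₀)) 1 :=
    (h₁.hasProjectiveDimensionLT_X₃_iff 0 c₁.projective).1 hK
  have hproj : Projective (kernel (p ≫ kernel.ι a₀)) := inferInstance
  have e₁ : kernel.lift a₀ (p ≫ kernel.ι a₀) (by simp) = p := by
    rw [← cancel_mono (kernel.ι a₀), kernel.lift_ι]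
  have e₂ : kernel.lift (p ≫ kernel.ι a₀) (kernel.ι _) (kernel.condition _) = 𝟙 _ := by
    rw [← cancel_mono (kernel.ι _), kernel.lift_ι, Category.id_comp]
  exact ⟨{
    a₂ := kernel.ι (p ≫ kernel.ι a₀)
    a₁ := p ≫ kernel.ι a₀
    a₀ := a₀
    a₂_a₁ := kernel.condition _
    a₁_a₀ := by simp
    mono := inferInstance
    cover₀ := c₀
    cover₁ := by
      rw [e₁]
      exact c₁
    cover₂ := by
      rw [e₂]
      exact ⟨hproj, inferInstance, fun W g hg => by rwa [Category.comp_id] at hg⟩ }⟩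

end ProjectiveCovers

/-- The embedding of the twisted Hall algebra into the localized Hall algebra, for an abelian
category of global dimension at most two with enough projectives and finite spaces of
morphisms. -/
theorem exists_embedding (k : Type w) [Field k] [Finite k] {𝒜 : Type u} [Category.{v} 𝒜]
    [Abelian 𝒜] [Linear k 𝒜] [EnoughProjectives 𝒜] (hfin : ∀ X Y : 𝒜, Module.Finite k (X ⟶ Y))
    (hgl : ∀ X : 𝒜, HasProjectiveDimensionLE X 2) :
    (∀ A : 𝒜, Nonempty (MinimalResolution A)) ∧
    ∃ I : HallTw k 𝒜 →ₙₐ[ℂ] DH k 𝒜, Function.Injective I ∧ I 1 = 1 ∧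
      ∀ (A : 𝒜) (R : MinimalResolution A), I (TwHall.cls _ _ _ A trivial) = R.E k := by
  have hmin := nonempty_minimalResolution (finite_hom k (𝒜 := 𝒜)) hgl
  have hres : ∀ X : 𝒜, Nonempty (Res X) := fun X => (hmin X).map MinimalResolution.toRes
  refine ⟨hmin, { resHom k hres with
    map_zero' := map_zero _
    map_mul' := resHom_mul k hres }, resHom_injective k hgl hres, resHom_one k hres,
    fun A R => ?_⟩
  rw [MinimalResolution.E_eq]
  exact resHom_acls k hres R.toRes

/-! ### Finitely generated right modules over a finite-dimensional algebra -/

section RightModules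

variable (k : Type w) [Field k] (B : Type u) [Ring B] [Algebra k B] [Module.Finite k B]

theorem enoughProjectives_fgModuleCat (R : Type u) [Ring R] [IsNoetherianRing R] :
    EnoughProjectives (FGModuleCat.{u} R) where
  presentation M := by
    obtain ⟨n, f, hf⟩ := Module.Finite.exists_fin' R M
    have hproj : Projective (FGModuleCat.of R (Fin n → R)) := by
      refine ⟨fun {E X} g e he => ?_⟩
      have he' : Epi ((forget₂ (FGModuleCat.{u} R) (ModuleCat.{u} R)).map e) := inferInstance
      obtain ⟨l, hl⟩ := Module.projective_lifting_property e.hom.hom g.hom.hom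
        ((ModuleCat.epi_iff_surjective _).1 he')
      exact ⟨FGModuleCat.ofHom l, FGModuleCat.hom_ext hl⟩
    let p : FGModuleCat.of R (Fin n → R) ⟶ M := FGModuleCat.ofHom (V := Fin n → R) (W := M) f
    have hp : Epi p := by
      apply (forget₂ (FGModuleCat.{u} R) (ModuleCat.{u} R)).epi_of_epi_map
      rw [ModuleCat.epi_iff_surjective]
      exact hf
    exact ⟨{ p := FGModuleCat.of R (Fin n → R), projective := hproj, f := p, epi := hp }⟩

instance : EnoughProjectives (RMod k B) :=
  haveI := isNoetherianRing_op k B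
  enoughProjectives_fgModuleCat Bᵐᵒᵖ

/-- Over a finite field `B` is a finite ring, so finitely generated modules and the sets of maps
between them are finite. -/
theorem finite_hom_rMod [Finite k] (X Y : RMod k B) : Module.Finite k (X ⟶ Y) := by
  have hB : Finite B := Module.finite_of_finite k
  have hB' : Finite Bᵐᵒᵖ := Finite.of_equiv B MulOpposite.opEquiv
  have hfinite : ∀ M : FGModuleCat.{u} Bᵐᵒᵖ, Finite M := fun M => Module.finite_of_finite Bᵐᵒᵖ
  have hX : Finite (show FGModuleCat.{u} Bᵐᵒᵖ from X) := hfinite X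
  have hY : Finite (show FGModuleCat.{u} Bᵐᵒᵖ from Y) := hfinite Y
  have : Finite (X ⟶ Y) := Finite.of_injective
    (fun (f : X ⟶ Y) (x : (show FGModuleCat.{u} Bᵐᵒᵖ from X)) =>
      ((show (show FGModuleCat.{u} Bᵐᵒᵖ from X) ⟶ (show FGModuleCat.{u} Bᵐᵒᵖ from Y) from
        f).hom.hom x : (show FGModuleCat.{u} Bᵐᵒᵖ from Y)))
    fun f g h => FGModuleCat.hom_ext (LinearMap.ext fun x => congrFun h x)
  exact Module.Finite.of_finite

end RightModules

end

end BridgelandHall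

theorem theorem3 {k : Type w} [Field k] [Finite k] {B : Type u} [Ring B] [Algebra k B]
    [Module.Finite k B]
    (hB : ∀ X : BridgelandHall.RMod k B, HasProjectiveDimensionLE X 2) :
    (∀ A : BridgelandHall.RMod k B, Nonempty (BridgelandHall.MinimalResolution A)) ∧
    ∃ I : BridgelandHall.HallTw k (BridgelandHall.RMod k B) →ₙₐ[ℂ]
        BridgelandHall.DH k (BridgelandHall.RMod k B),
      Function.Injective I ∧ I 1 = 1 ∧
      ∀ (A : BridgelandHall.RMod k B) (R : BridgelandHall.MinimalResolution A),
        I (BridgelandHall.TwHall.cls _ _ _ A trivial) = R.E k :=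
  BridgelandHall.exists_embedding k (BridgelandHall.finite_hom_rMod k B) hB
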